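/- Let $n\ge 1$ and $[n]=\{1,\dots,n\}$. **Partitions.** A noncommutative crossing partition of $[n]$ is an ordered list of nonempty blocks $\pi=\pi_1/\pi_2/\cdots/\pi_l$, each written as an increasing sequence, which together contain every element of $[n]$ exactly once and satisfy $\max(\pi_i)>\min(\pi_{i+1})$ for $1\le i<l$. Let $\mathtt{NCCP}(n)$ be the set of these, and let $\rho'(\pi)=l$ be the number of blocks. Let $\mathtt{NCCP}(n;312)$ be the set of those $\pi$ for which there are no $i<j\le k$ and $x\in\pi_i$, $y\in\pi_j$, $z\in\pi_k$ with $y<z<x$. Let $\mathtt{NCP}(n)$ be the set of those $\pi$ that are non-crossing (there are no $a<b<c<d$ with $a,c$ in one block and $b,d$ in another) and canonical ($\min(\pi_l)<\cdots<\min(\pi_1)$), ordered by refinement: $\pi\subseteq\pi'$ if every block of $\pi$ is contained in a block of $\pi'$. Put $\hat 0=n/n{-}1/\cdots/1$ and $\hat 1=12\cdots n$. **Rotations.** Identify $\pi$ with the binary tree $T$ with nodes labeled by $[n]$, labels increasing away from the root, whose in-order reading (left subtree, root, right subtree) is the word $\pi_1\pi_2\cdots\pi_l$. Nodes are denoted by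 their labels. Let $b$ be a node which is a left child, and let $b=m_0,m_1,\dots,m_p$ be the maximal sequence in which $m_i$ is the left child of $m_{i-1}$. Let $a$ be a node having $b$ in its left subtree such that there is no proper descendant $c$ of $a$ with $b$ in the left subtree of $c$ and some $b'<b$ in the right subtree of $c$. Let $S\subseteq\{m_1,\dots,m_p\}$. The rotation of $T$ with triplet $(b,a,S)$ is obtained as follows. Let $T_1$ be the tree consisting of the nodes of $\{b\}\cup S$ with their right subtrees, these nodes being connected by left edges in increasing order from the root. Let $T_2$ be obtained from $T$ by replacing the subtree below $b$ by the nodes of $\{m_1,\dots,m_p\}\setminus S$ with their right subtrees, connected by left edges in the same way. Then merge the sequence $b$, right child of $b$, right child of that, and so on, in $T_1$ with the sequence $a$, right child of $a$, and so on, in $T_2$, into one sequence of nodes connected by right edges, in increasing order, every node keeping its left subtree. Write $\pi\lessdot\pi'$ if the tree of $\pi'$ is a rotation of the tree of $\pi$, and let $\le$ be the reflexive transitive closure of $\lessdot$; it is a partial order on $\mathtt{NCCP}(n)$. If $\pi\lessdot\pi'$ by a triplet $(b,a,S)$, the label $a$ depends only on $\pi,\pi'$; put $\widetilde L(\pi,\pi')=a$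 and $L(\pi,\pi')=n+\rho'(\pi)-\widetilde L(\pi,\pi')$. A maximal chain of $\mathtt{NCCP}(n)$ is a sequence $\hat 0=x_0\lessdot x_1\lessdot\cdots\lessdot x_{n-1}=\hat 1$ (every rotation lowers the number of blocks by one); it is called decreasing if $L(x_0,x_1)>L(x_1,x_2)>\cdots>L(x_{n-2},x_{n-1})$. **Theorem.** Let $A(n-1)$ be the set of integer sequences $\mathbf a=(a_1,\dots,a_{n-1})$ with $1\le a_i\le i$ and $a_1\le a_2\le\cdots\le a_{n-1}$. 1. For every $\mathbf a\in A(n-1)$ there is exactly one decreasing maximal chain $x_0\lessdot\cdots\lessdot x_{n-1}$ of $\mathtt{NCCP}(n)$ all of whose elements lie in $\mathtt{NCCP}(n;312)$ and for which $\widetilde L(x_{i-1},x_i)=a_i$ for $1\le i\le n-1$. Conversely, for every decreasing maximal chain all of whose elements lie in $\mathtt{NCCP}(n;312)$, the sequence of labels $\widetilde L(x_{i-1},x_i)$ belongs to $A(n-1)$. 2. The Möbius function of the Kreweras lattice satisfies $\mu(\hat 0,\hat 1)=(-1)^{n-1}C_{n-1}$, where $C_{n-1}$ is the $(n-1)$-st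 Catalan number. This holds for both forms of the lattice: $\mathtt{NCCP}(n;312)$ with the order $\le$ induced from $\mathtt{NCCP}(n)$, and $\mathtt{NCP}(n)$ with the refinement order $\subseteq$. Here $\mu(x,x)=1$ and $\mu(x,y)=-\sum_{x\le z<y}\mu(x,z)$ for $x<y$. -/

import Mathlib

namespace Nccp

open BinaryTree

/-! ### Noncommutative crossing partitions -/

/-- A noncommutative crossing partition of `[n] = {1, …, n}`: an ordered list of nonempty blocks,
each written as an increasing sequence, such that every integer of `[n]` occurs exactly once and
`max π_i > min π_{i+1}` for any two consecutive blocks (some element of `π_i` exceeds some element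
of `π_{i+1}`). -/
@[ext]
structure NCCP (n : ℕ) where
  blocks : List (List ℕ)
  perm : blocks.flatten.Perm (List.range' 1 n)
  nonempty : ∀ B ∈ blocks, B ≠ []
  increasing : ∀ B ∈ blocks, B.Pairwise (· < ·)
  descent : blocks.IsChain fun B C => ∃ b ∈ B, ∃ c ∈ C, c < b

/-- The one-line notation: the concatenation of the blocks from left to right. -/
def NCCP.word {n : ℕ} (π : NCCP n) : List ℕ := π.blocks.flatten

/-- `π` avoids the pattern `312`: there are no `i < j ≤ k` and `x ∈ π_i`, `y ∈ π_j`, `z ∈ π_k`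
with `y < z < x`. -/
def NCCP.Avoids312 {n : ℕ} (π : NCCP n) : Prop :=
  ∀ i j k : Fin π.blocks.length, i < j → j ≤ k →
    ∀ x ∈ π.blocks[i], ∀ y ∈ π.blocks[j], ∀ z ∈ π.blocks[k], ¬ (y < z ∧ z < x)

/-- There are no `a < b < c < d` with `a, c` in one block and `b, d` in another one. -/
def NCCP.NonCrossing {n : ℕ} (π : NCCP n) : Prop :=
  ∀ B ∈ π.blocks, ∀ C ∈ π.blocks, B ≠ C →
    ∀ a b c d : ℕ, a < b → b < c → c < d → a ∈ B → c ∈ B → b ∈ C → d ∈ C → False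

/-- `min π_l < min π_{l-1} < ⋯ < min π_1`. -/
def NCCP.Canonical {n : ℕ} (π : NCCP n) : Prop :=
  π.blocks.Pairwise fun B C => ∃ c ∈ C, ∀ b ∈ B, c < b

/-- The partition `n/n-1/⋯/2/1`. -/
def NCCP.zero (n : ℕ) : NCCP n where
  blocks := (List.range' 1 n).reverse.map fun i => [i]
  perm := by
    have h : ∀ l : List ℕ, (l.map fun i => [i]).flatten = l := by
      intro l
      induction l with
      | nil => rfl
      | cons x l ih => simp [ih]
    rw [h]
    exact List.reverse_perm _
  nonempty := by
    intro B hB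
    obtain ⟨i, -, rfl⟩ := List.mem_map.1 hB
    simp
  increasing := by
    intro B hB
    obtain ⟨i, -, rfl⟩ := List.mem_map.1 hB
    simp
  descent := by
    have h : ((List.range' 1 n).reverse.map fun i => [i]).Pairwise
        fun B C => ∃ b ∈ B, ∃ c ∈ C, c < b := by
      rw [List.pairwise_map, List.pairwise_reverse]
      exact (List.pairwise_lt_range' (s := 1) (n := n)).imp
        fun h => ⟨_, List.mem_singleton_self _, _, List.mem_singleton_self _, h⟩
    exact h.isChain

/-- The partition `12⋯n` with one block (the empty partition if `n = 0`). -/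
def NCCP.one (n : ℕ) : NCCP n where
  blocks := if n = 0 then [] else [List.range' 1 n]
  perm := by
    split_ifs with h
    · subst h; simp
    · simp
  nonempty := by
    split_ifs with h
    · simp
    · simp [h]
  increasing := by
    split_ifs with h
    · simp
    · simpa using List.pairwise_lt_range' (s := 1) (n := n)
  descent := by split_ifs <;> simp

theorem NCCP.word_injective {n : ℕ} : Function.Injective (NCCP.word (n := n)) := by
  have key : ∀ π : NCCP n, π.word.splitBy (fun a b => decide (a < b)) = π.blocks := by
    intro π
    apply List.splitBy_flatten
    · exact fun h => π.nonempty _ h rfl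
    · intro m hm
      exact ((π.increasing m hm).imp (by simp)).isChain
    · have h2 := π.nonempty
      have h3 := π.increasing
      rw [List.isChain_iff_getElem]
      intro i hi
      obtain ⟨b, hb, c, hc, hcb⟩ := List.isChain_iff_getElem.1 π.descent i hi
      have hB := h2 _ (List.getElem_mem (l := π.blocks) (by omega : i < π.blocks.length))
      have hC := h2 _ (List.getElem_mem (l := π.blocks) hi)
      refine ⟨hB, hC, ?_⟩
      have h4 := ((h3 _ (List.getElem_mem (l := π.blocks)
        (by omega : i < π.blocks.length))).imp le_of_lt).rel_getLast hb
      have h5 := ((h3 _ (List.getElem_mem (l := π.blocks) hi)).imp le_of_lt).rel_head hc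
      simp only [decide_eq_false_iff_not, not_lt]
      omega
  intro π π' h
  ext1
  rw [← key, ← key, h]

instance (n : ℕ) : Finite (NCCP n) := by
  have : Finite {w : List ℕ // w ∈ (List.range' 1 n).permutations} := by
    exact Set.finite_coe_iff.2 (List.finite_toSet _)
  exact Finite.of_injective
    (fun π : NCCP n => (⟨π.word, List.mem_permutations.2 π.perm⟩ :
      {w : List ℕ // w ∈ (List.range' 1 n).permutations}))
    (fun π π' h => NCCP.word_injective (congrArg Subtype.val h))

/-! ### Labeled binary trees and rotations -/

/-- The word of a tree in in-order: left subtree, root, right subtree. -/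
def word : BinaryTree ℕ → List ℕ
  | nil => []
  | node x l r => word l ++ x :: word r

/-- The labels increase from the root to the leaves. -/
def Increasing : BinaryTree ℕ → Prop
  | nil => True
  | node x l r => (∀ y ∈ word l, x < y) ∧ (∀ y ∈ word r, x < y) ∧ Increasing l ∧ Increasing r

/-- `t` is the labeled binary tree of `π`: its labels increase from the root to the leaves, and
reading them in in-order gives the one-line notation of `π`. -/
def IsTreeOf {n : ℕ} (t : BinaryTree ℕ) (π : NCCP n) : Prop :=
  Increasing t ∧ word t = π.word

/-- `s` is the full subtree of `t` below one of the nodes of `t` (or empty). -/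
def IsSubtree (s : BinaryTree ℕ) : BinaryTree ℕ → Prop
  | nil => s = nil
  | node x l r => s = node x l r ∨ IsSubtree s l ∨ IsSubtree s r

/-- The node `b` is connected to its parent by a left edge. -/
def IsLeftChild (b : ℕ) (t : BinaryTree ℕ) : Prop :=
  ∃ x l r r', IsSubtree (node x (node b l r) r') t

/-- The node `a` belongs to the left set of the node `b`: the path from `b` to the root enters `a`
through a left edge. -/
def InLeftSet (t : BinaryTree ℕ) (b a : ℕ) : Prop :=
  ∃ l r, IsSubtree (node a l r) t ∧ b ∈ word l

/-- The node `a` is a proper ancestor of the node `c`. -/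
def IsProperAncestor (t : BinaryTree ℕ) (a c : ℕ) : Prop :=
  ∃ l r, IsSubtree (node a l r) t ∧ (c ∈ word l ∨ c ∈ word r)

/-- The nodes `a` at which `b` may be inserted: `a` is in the left set of `b`, and whenever a
smaller label `b' < b` lies to the right of the path of `b`, the two paths meeting at the node `c`
(so that `b` is in the left and `b'` in the right subtree of `c`), the node `a` is not strictly
above `c`. (The lowest such `c`, which is the only one that matters, is the one that belongs to the
left-most such `b'`.) -/
def Admissible (t : BinaryTree ℕ) (b a : ℕ) : Prop :=
  InLeftSet t b a ∧
    ∀ c l r, IsSubtree (node c l r) t → b ∈ word l → (∃ b' ∈ word r, b' < b) →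
      ¬ IsProperAncestor t a c

/-- The subtree whose root has the label `b`. -/
def subtreeAt (b : ℕ) : BinaryTree ℕ → BinaryTree ℕ
  | nil => nil
  | node x l r =>
    if x = b then node x l r else if b ∈ word l then subtreeAt b l else subtreeAt b r

/-- The labels of the left-extended sequence that starts at the root: the root, its left child,
the left child of the left child, and so on. -/
def leftSeq : BinaryTree ℕ → List ℕ
  | nil => []
  | node x l _ => x :: leftSeq l

/-- The nodes of the left-extended sequence of the root whose labels satisfy `p`, together with
their right subtrees, connected again by left edges. -/
def filterLeft (p : ℕ → Bool) : BinaryTree ℕ → BinaryTree ℕ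
  | nil => nil
  | node x l r => if p x then node x (filterLeft p l) r else filterLeft p l

/-- The tree `T₁`: the nodes `{b} ∪ S` of the left-extended sequence of `b`, with their right
subtrees, connected by left edges. -/
def extract (b : ℕ) (S : Finset ℕ) (t : BinaryTree ℕ) : BinaryTree ℕ :=
  filterLeft (fun y => decide (y ∈ insert b S)) (subtreeAt b t)

/-- The tree `T₂`: the subtree of `t` below `b` is replaced by the remaining nodes of the
left-extended sequence of `b`, with their right subtrees, connected by left edges. -/
def prune (b : ℕ) (S : Finset ℕ) : BinaryTree ℕ → BinaryTree ℕ
  | nil => nil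
  | node x l r =>
    if x = b then filterLeft (fun y => decide (y ∉ insert b S)) (node x l r)
    else node x (prune b S l) (prune b S r)

/-- The right-extended sequences of the two roots are merged into one right-extended sequence, in
increasing order; every node on it keeps its left subtree. -/
def mergeRight : BinaryTree ℕ → BinaryTree ℕ → BinaryTree ℕ
  | nil, t => t
  | node x l r, nil => node x l r
  | node x l r, node x' l' r' =>
    if x < x' then node x l (mergeRight r (node x' l' r'))
    else node x' l' (mergeRight (node x l r) r')

/-- The tree `s` is inserted into the right-extended sequence of the node `a`. -/
def attach (a : ℕ) (s : BinaryTree ℕ) : BinaryTree ℕ → BinaryTree ℕ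
  | nil => nil
  | node x l r =>
    if x = a then node x l (mergeRight r s) else node x (attach a s l) (attach a s r)

/-- `t'` is obtained from `t` by the rotation with a triplet `(b, a, S)`: `b` is connected to its
parent by a left edge, `a` is admissible for `b`, and `S` is a set of nodes of the left-extended
sequence of `b`, without `b` itself. -/
def IsRotation (t t' : BinaryTree ℕ) (b a : ℕ) : Prop :=
  IsLeftChild b t ∧ Admissible t b a ∧
    ∃ S : Finset ℕ, (∀ m ∈ S, m ∈ (leftSeq (subtreeAt b t)).tail) ∧
      t' = attach a (extract b S t) (prune b S t)

/-- `π'` is the rotation of `π` with a triplet whose first two entries are `b` and `a`. -/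
def IsRotationOf {n : ℕ} (π π' : NCCP n) (b a : ℕ) : Prop :=
  ∃ t t', IsTreeOf t π ∧ IsTreeOf t' π' ∧ IsRotation t t' b a

/-- The cover relation: `π'` is a rotation of `π`. -/
def Covers {n : ℕ} (π π' : NCCP n) : Prop := ∃ b a, IsRotationOf π π' b a

/-- The labeling `L̃` of the edge from `π` to `π'`: the entry `a` of the triplet `(b, a, S)`
of a rotation from `π` to `π'`. It is determined by `π` and `π'`, see `tildeLabel_eq` below. -/
noncomputable def tildeLabel {n : ℕ} (π π' : NCCP n) : ℕ :=
  sInf {a | ∃ b, IsRotationOf π π' b a}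

/-- The labeling `L(π, π') = n + ρ'(π) - L̃(π, π')`, where `ρ'(π)` is the number of blocks. -/
noncomputable def edgeLabel {n : ℕ} (π π' : NCCP n) : ℤ :=
  n + π.blocks.length - tildeLabel π π'


/-! ### The order -/

theorem word_eq_of_increasing {t t' : BinaryTree ℕ} (h : Increasing t) (h' : Increasing t')
    (hw : word t = word t') : t = t' := by
  induction t generalizing t' with
  | nil => cases t' with
    | nil => rfl
    | node x l r => simp [word] at hw
  | node x l r ihl ihr => cases t' with
    | nil => simp [word] at hw
    | node x' l' r' =>
      obtain ⟨h1, h2, h3, h4⟩ := h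
      obtain ⟨h1', h2', h3', h4'⟩ := h'
      simp only [word] at hw
      have hx : x = x' := by
        have m1 : x ∈ word l' ++ x' :: word r' := by rw [← hw]; simp
        have m2 : x' ∈ word l ++ x :: word r := by rw [hw]; simp
        simp only [List.mem_append, List.mem_cons] at m1 m2
        rcases m1 with m1 | m1 | m1
        · have := h1' _ m1
          rcases m2 with m2 | m2 | m2
          · have := h1 _ m2; omega
          · omega
          · have := h2 _ m2; omega
        · exact m1
        · have := h2' _ m1
          rcases m2 with m2 | m2 | m2
          · have := h1 _ m2; omega
          · omega
          · have := h2 _ m2; omega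
      subst hx
      have n1 : x ∉ word l := fun hh => lt_irrefl _ (h1 _ hh)
      have n1' : x ∉ word l' := fun hh => lt_irrefl _ (h1' _ hh)
      have key : word l = word l' ∧ word r = word r' := by
        rcases List.append_eq_append_iff.1 hw with ⟨u, hu, hv⟩ | ⟨u, hu, hv⟩
        · cases u with
          | nil => simp at hu hv; exact ⟨hu.symm, hv⟩
          | cons y u =>
            simp only [List.cons_append, List.cons.injEq] at hv
            exact absurd (by rw [hu, ← hv.1]; simp) n1'
        · cases u with
          | nil => simp at hu hv; exact ⟨hu, hv.symm⟩
          | cons y u =>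
            simp only [List.cons_append, List.cons.injEq] at hv
            exact absurd (by rw [hu, ← hv.1]; simp) n1
      rw [ihl h3 h3' key.1, ihr h4 h4' key.2]

theorem mem_word_of_isSubtree {s t : BinaryTree ℕ} (h : IsSubtree s t) {y : ℕ}
    (hy : y ∈ word s) : y ∈ word t := by
  induction t with
  | nil => simp only [IsSubtree] at h; rwa [h] at hy
  | node x l r ihl ihr =>
    rcases h with h | h | h
    · rwa [h] at hy
    · have := ihl h; simp [word, this]
    · have := ihr h; simp [word, this]

theorem prune_of_notMem {b : ℕ} {S : Finset ℕ} {t : BinaryTree ℕ} (h : b ∉ word t) :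
    prune b S t = t := by
  induction t with
  | nil => rfl
  | node x l r ihl ihr =>
    simp only [word, List.mem_append, List.mem_cons, not_or] at h
    rw [prune, if_neg (fun e => h.2.1 e.symm), ihl h.1, ihr h.2.2]

theorem attach_of_notMem {a : ℕ} {s t : BinaryTree ℕ} (h : a ∉ word t) : attach a s t = t := by
  induction t with
  | nil => rfl
  | node x l r ihl ihr =>
    simp only [word, List.mem_append, List.mem_cons, not_or] at h
    rw [attach, if_neg (fun e => h.2.1 e.symm), ihl h.1, ihr h.2.2]

theorem mem_word_mergeRight {s t : BinaryTree ℕ} {y : ℕ} :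
    y ∈ word (mergeRight s t) ↔ y ∈ word s ∨ y ∈ word t := by
  induction s, t using mergeRight.induct with
  | case1 t => simp [mergeRight, word]
  | case2 x l r => simp [mergeRight, word]
  | case3 x l r x' l' r' h ih =>
    rw [mergeRight, if_pos h]
    simp only [word, List.mem_append, List.mem_cons] at ih ⊢
    rw [ih]; tauto
  | case4 x l r x' l' r' h ih =>
    rw [mergeRight, if_neg h]
    simp only [word, List.mem_append, List.mem_cons] at ih ⊢
    rw [ih]; tauto

theorem mem_word_extract {b : ℕ} {S : Finset ℕ} {t : BinaryTree ℕ} (h : b ∈ word t) :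
    b ∈ word (extract b S t) := by
  have key : ∀ t, b ∈ word t → ∃ l r, subtreeAt b t = node b l r := by
    intro t
    induction t with
    | nil => simp [word]
    | node x l r ihl ihr =>
      intro h
      simp only [word, List.mem_append, List.mem_cons] at h
      rw [subtreeAt]
      split_ifs with h1 h2
      · exact ⟨l, r, by rw [h1]⟩
      · exact ihl h2
      · exact ihr (by tauto)
  obtain ⟨l, r, e⟩ := key t h
  simp [extract, e, filterLeft, word]

/-- The effect of a rotation on words. -/
theorem exists_word_attach_prune {a b : ℕ} {S : Finset ℕ} {s t : BinaryTree ℕ}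
    (hn : (word t).Nodup) (hi : Increasing t) (hs : b ∈ word s) (h : InLeftSet t b a) :
    ∃ P Q l r r' l', word t = P ++ (l ++ a :: r) ++ Q ∧
      word (attach a s (prune b S t)) = P ++ (l' ++ a :: r') ++ Q ∧ b ∈ l ∧ b ∈ r' ∧
      (∀ y ∈ l, a < y) ∧ ∀ y ∈ r, a < y := by
  induction t with
  | nil =>
    obtain ⟨l, r, h, -⟩ := h
    simp [IsSubtree] at h
  | node x l r ihl ihr =>
    obtain ⟨l0, r0, h, hb⟩ := h
    obtain ⟨h1, h2, h3, h4⟩ := hi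
    simp only [word, List.nodup_append, List.nodup_cons, List.mem_cons] at hn
    obtain ⟨n1, ⟨n2, n3⟩, n4⟩ := hn
    rcases h with h | h | h
    · injection h with e1 e2 e3
      subst e1 e2 e3
      have hab := h1 _ hb
      refine ⟨[], [], word l0, word r0, word (mergeRight (prune b S r0) s), word (prune b S l0),
        by simp [word], ?_, hb, mem_word_mergeRight.2 (Or.inr hs), h1, h2⟩
      rw [prune, if_neg (by omega), attach, if_pos rfl]
      simp [word]
    · have ha : a ∈ word l := mem_word_of_isSubtree h (by simp [word])
      have hb' : b ∈ word l := mem_word_of_isSubtree h (by simp [word, hb])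
      have hxb := h1 _ hb'
      have hxa := h1 _ ha
      obtain ⟨P, Q, l1, r1, r1', l1', e1, e2, i1, i2, i3, i4⟩ := ihl n1 h3 ⟨l0, r0, h, hb⟩
      refine ⟨P, Q ++ x :: word r, l1, r1, r1', l1', by simp [word, e1], ?_, i1, i2, i3, i4⟩
      rw [prune, if_neg (by omega), attach, if_neg (by omega),
        prune_of_notMem (t := r) (fun hh => n4 _ hb' _ (Or.inr hh) rfl),
        attach_of_notMem (t := r) (fun hh => n4 _ ha _ (Or.inr hh) rfl)]
      simp [word, e2]
    · have ha : a ∈ word r := mem_word_of_isSubtree h (by simp [word])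
      have hb' : b ∈ word r := mem_word_of_isSubtree h (by simp [word, hb])
      have hxb := h2 _ hb'
      have hxa := h2 _ ha
      obtain ⟨P, Q, l1, r1, r1', l1', e1, e2, i1, i2, i3, i4⟩ := ihr n3 h4 ⟨l0, r0, h, hb⟩
      refine ⟨word l ++ x :: P, Q, l1, r1, r1', l1', by simp [word, e1], ?_, i1, i2, i3, i4⟩
      rw [prune, if_neg (by omega), attach, if_neg (by omega),
        prune_of_notMem (t := l) (fun hh => n4 _ hh _ (Or.inr hb') rfl),
        attach_of_notMem (t := l) (fun hh => n4 _ hh _ (Or.inr ha) rfl)]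
      simp [word, e2]

theorem append_cons_unique {a : ℕ} {x y x' y' : List ℕ} (h : (x ++ a :: y).Nodup)
    (e : x ++ a :: y = x' ++ a :: y') : x = x' ∧ y = y' := by
  have n1 : a ∉ x := by
    intro hh
    rw [List.nodup_append] at h
    exact h.2.2 _ hh _ (by simp) rfl
  have n1' : a ∉ x' := by
    intro hh
    rw [e, List.nodup_append] at h
    exact h.2.2 _ hh _ (by simp) rfl
  rcases List.append_eq_append_iff.1 e with ⟨u, hu, hv⟩ | ⟨u, hu, hv⟩
  · cases u with
    | nil => simp at hu hv; exact ⟨hu.symm, hv⟩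
    | cons z u =>
      simp only [List.cons_append, List.cons.injEq] at hv
      exact absurd (by rw [hu, ← hv.1]; simp) n1'
  · cases u with
    | nil => simp at hu hv; exact ⟨hu, hv.symm⟩
    | cons z u =>
      simp only [List.cons_append, List.cons.injEq] at hv
      exact absurd (by rw [hu, ← hv.1]; simp) n1

theorem NCCP.nodup_word {n : ℕ} (π : NCCP n) : π.word.Nodup :=
  π.perm.nodup_iff.2 List.nodup_range'

theorem IsRotationOf.exists_word {n : ℕ} {π π' : NCCP n} {b a : ℕ} (h : IsRotationOf π π' b a) :
    ∃ P Q l r r' l', π.word = P ++ (l ++ a :: r) ++ Q ∧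
      π'.word = P ++ (l' ++ a :: r') ++ Q ∧ b ∈ l ∧ b ∈ r' ∧
      (∀ y ∈ l, a < y) ∧ ∀ y ∈ r, a < y := by
  obtain ⟨t, t', ⟨h1, h2⟩, ⟨h3, h4⟩, -, ⟨h5, -⟩, S, -, rfl⟩ := h
  rw [← h2, ← h4]
  refine exists_word_attach_prune (by rw [h2]; exact π.nodup_word) h1 (mem_word_extract ?_) h5
  obtain ⟨l, r, h, hb⟩ := h5
  exact mem_word_of_isSubtree h (by simp [word, hb])

theorem IsRotationOf.not_lt {n : ℕ} {π π' : NCCP n} {b a b₁ a₁ : ℕ} (h : IsRotationOf π π' b a)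
    (h₁ : IsRotationOf π π' b₁ a₁) : ¬ a < a₁ := by
  intro hlt
  obtain ⟨P, Q, l, r, r', l', e, e', hb, hb', -, -⟩ := h.exists_word
  obtain ⟨P₁, Q₁, l₁, r₁, r₁', l₁', e₁, e₁', -, -, g, g'⟩ := h₁.exists_word
  have nd := π.nodup_word
  have nd' := π'.nodup_word
  have f : (P ++ l) ++ a :: (r ++ Q) = π.word := by rw [e]; simp
  have f' : (P ++ l') ++ a :: (r' ++ Q) = π'.word := by rw [e']; simp
  have ha : a ∈ π.word := by rw [e]; simp
  rw [e₁] at ha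
  simp only [List.mem_append, List.mem_cons] at ha
  have ha2 : a ∈ P₁ ∨ a ∈ Q₁ := by
    rcases ha with (ha | ha | ha | ha) | ha
    · exact Or.inl ha
    · have := g _ ha; omega
    · omega
    · have := g' _ ha; omega
    · exact Or.inr ha
  rcases ha2 with ha | ha
  · obtain ⟨u, v, rfl⟩ := List.append_of_mem ha
    have k : u ++ a :: (v ++ (l₁ ++ a₁ :: r₁) ++ Q₁) = (P ++ l) ++ a :: (r ++ Q) := by
      rw [f, e₁]; simp
    have k' : (P ++ l') ++ a :: (r' ++ Q) = u ++ a :: (v ++ (l₁' ++ a₁ :: r₁') ++ Q₁) := by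
      rw [f', e₁']; simp
    have q := (append_cons_unique (by rw [k, f]; exact nd) k).1
    have q' := (append_cons_unique (by rw [f']; exact nd') k').1
    rw [← f', List.nodup_append] at nd'
    refine nd'.2.2 b ?_ b (by simp [hb']) rfl
    rw [q', q]; simp [hb]
  · obtain ⟨u, v, rfl⟩ := List.append_of_mem ha
    have k : (P₁ ++ (l₁ ++ a₁ :: r₁) ++ u) ++ a :: v = (P ++ l) ++ a :: (r ++ Q) := by
      rw [f, e₁]; simp
    have k' : (P ++ l') ++ a :: (r' ++ Q) = (P₁ ++ (l₁' ++ a₁ :: r₁') ++ u) ++ a :: v := by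
      rw [f', e₁']; simp
    have q := (append_cons_unique (by rw [k, f]; exact nd) k).2
    have q' := (append_cons_unique (by rw [f']; exact nd') k').2
    rw [← f, List.nodup_append] at nd
    refine nd.2.2 b (by simp [hb]) b ?_ rfl
    rw [← q, ← q']; simp [hb']

/-- The label of an edge does not depend on the triplet. -/
theorem tildeLabel_eq {n : ℕ} {π π' : NCCP n} {b a : ℕ} (h : IsRotationOf π π' b a) :
    tildeLabel π π' = a := by
  have : {a | ∃ b, IsRotationOf π π' b a} = {a} := by
    ext a₁
    simp only [Set.mem_ofPred_eq, Set.mem_singleton_iff]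
    constructor
    · rintro ⟨b₁, h₁⟩
      exact le_antisymm (not_lt.1 (h.not_lt h₁)) (not_lt.1 (h₁.not_lt h))
    · rintro rfl
      exact ⟨b, h⟩
  rw [tildeLabel, this, csInf_singleton]

/-- The number of right edges of a tree. -/
def rightEdges : BinaryTree ℕ → ℕ
  | nil => 0
  | node _ l r => rightEdges l + rightEdges r + if r = nil then 0 else 1

theorem rightEdges_filterLeft (p : ℕ → Bool) (t : BinaryTree ℕ) :
    rightEdges (filterLeft p t) + rightEdges (filterLeft (fun y => !p y) t) = rightEdges t := by
  induction t with
  | nil => simp [filterLeft, rightEdges]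
  | node x l r ihl ihr =>
    cases h : p x <;> simp [filterLeft, rightEdges, h] <;> omega

theorem rightEdges_mergeRight {s t : BinaryTree ℕ} (hs : s ≠ nil) (ht : t ≠ nil) :
    rightEdges (mergeRight s t) = rightEdges s + rightEdges t + 1 ∧ mergeRight s t ≠ nil := by
  induction s, t using mergeRight.induct with
  | case1 t => exact absurd rfl hs
  | case2 x l r => exact absurd rfl ht
  | case3 x l r x' l' r' h ih =>
    rw [mergeRight, if_pos h]
    refine ⟨?_, by simp⟩
    by_cases hr : r = nil
    · subst hr; simp [mergeRight, rightEdges]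
    · have := ih hr (by simp)
      rw [rightEdges, this.1, if_neg this.2,
        show rightEdges (node x l r) = rightEdges l + rightEdges r + 1 by simp [rightEdges, hr]]
      omega
  | case4 x l r x' l' r' h ih =>
    rw [mergeRight, if_neg h]
    refine ⟨?_, by simp⟩
    by_cases hr : r' = nil
    · subst hr; simp [mergeRight, rightEdges]; omega
    · have := ih (by simp) hr
      rw [rightEdges, this.1, if_neg this.2,
        show rightEdges (node x' l' r') = rightEdges l' + rightEdges r' + 1 by simp [rightEdges, hr]]
      omega

theorem attach_eq_nil {a : ℕ} {s t : BinaryTree ℕ} : attach a s t = nil ↔ t = nil := by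
  cases t with
  | nil => simp [attach]
  | node x l r => rw [attach]; split_ifs <;> simp

theorem rightEdges_le_attach {a : ℕ} {s : BinaryTree ℕ} (hs : s ≠ nil) (t : BinaryTree ℕ) :
    rightEdges t ≤ rightEdges (attach a s t) ∧
      (a ∈ word t → rightEdges t + rightEdges s + 1 ≤ rightEdges (attach a s t)) := by
  induction t with
  | nil => simp [attach, word]
  | node x l r ihl ihr =>
    rw [attach]
    split_ifs with h
    · have : rightEdges (node x l r) + rightEdges s + 1 ≤
          rightEdges (node x l (mergeRight r s)) := by
        by_cases hr : r = nil
        · subst hr; simp [mergeRight, rightEdges, hs]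
        · have := rightEdges_mergeRight hr hs
          rw [rightEdges, rightEdges, this.1, if_neg this.2, if_neg hr]; omega
      exact ⟨by omega, fun _ => this⟩
    · simp only [rightEdges, attach_eq_nil, word, List.mem_append, List.mem_cons]
      refine ⟨by omega, ?_⟩
      rintro (h' | h' | h')
      · have := ihl.2 h'; omega
      · omega
      · have := ihr.2 h'; omega

theorem rightEdges_prune {b : ℕ} {S : Finset ℕ} {t : BinaryTree ℕ} (hn : (word t).Nodup)
    (h : IsLeftChild b t) :
    rightEdges (prune b S t) + rightEdges (extract b S t) = rightEdges t := by
  have hroot : ∀ l r, rightEdges (prune b S (node b l r)) +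
      rightEdges (filterLeft (fun y => decide (y ∈ insert b S)) (node b l r)) =
      rightEdges (node b l r) := by
    intro l r
    rw [prune, if_pos rfl, add_comm]
    have := rightEdges_filterLeft (fun y => decide (y ∈ insert b S)) (node b l r)
    convert this using 5
    simp
  induction t with
  | nil =>
    obtain ⟨x, l, r, r', h⟩ := h
    simp [IsSubtree] at h
  | node x l r ihl ihr =>
    obtain ⟨x0, l0, r0, r0', h⟩ := h
    simp only [word, List.nodup_append, List.nodup_cons, List.mem_cons] at hn
    obtain ⟨n1, ⟨n2, n3⟩, n4⟩ := hn
    rcases h with h | h | h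
    · injection h with e1 e2 e3
      subst e1 e2 e3
      have hx : x0 ≠ b := fun e => n4 b (by simp [word]) x0 (Or.inl rfl) e.symm
      have hr : b ∉ word r0' := fun hh => n4 b (by simp [word]) b (Or.inr hh) rfl
      have := hroot l0 r0
      rw [prune, if_neg hx, prune_of_notMem hr, extract, subtreeAt, if_neg hx,
        if_pos (by simp [word]), subtreeAt, if_pos rfl]
      simp only [rightEdges] at this ⊢
      omega
    · have hb : b ∈ word l := mem_word_of_isSubtree h (by simp [word])
      have hx : x ≠ b := fun e => n4 b hb x (Or.inl rfl) e.symm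
      have hr : b ∉ word r := fun hh => n4 b hb b (Or.inr hh) rfl
      have := ihl n1 ⟨x0, l0, r0, r0', h⟩
      rw [prune, if_neg hx, prune_of_notMem hr, extract, subtreeAt, if_neg hx, if_pos hb]
      rw [extract] at this
      simp only [rightEdges] at this ⊢
      omega
    · have hb : b ∈ word r := mem_word_of_isSubtree h (by simp [word])
      have hx : x ≠ b := fun e => n2 (by rw [e]; exact hb)
      have hl : b ∉ word l := fun hh => n4 b hh b (Or.inr hb) rfl
      have := ihr n3 ⟨x0, l0, r0, r0', h⟩
      rw [prune, if_neg hx, prune_of_notMem hl, extract, subtreeAt, if_neg hx, if_neg hl]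
      rw [extract] at this
      have hne : prune b S r = nil ↔ r = nil := by
        cases r with
        | nil => simp [prune]
        | node y p q =>
          have hy : y ≠ b := by
            rintro rfl
            simp only [word, List.nodup_append, List.nodup_cons, List.mem_cons] at n3
            obtain ⟨m1, ⟨m2, m3⟩, m4⟩ := n3
            rcases h with h | h | h
            · injection h with e1 e2 e3
              exact m4 y (by rw [← e2]; simp [word]) y (Or.inl rfl) rfl
            · exact m4 y (mem_word_of_isSubtree h (by simp [word])) y (Or.inl rfl) rfl
            · exact m2 (mem_word_of_isSubtree h (by simp [word]))
          simp [prune, if_neg hy]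
      simp only [rightEdges, hne]
      omega

theorem mem_word_prune {a b : ℕ} {S : Finset ℕ} {t : BinaryTree ℕ} (hn : (word t).Nodup)
    (h : InLeftSet t b a) : a ∈ word (prune b S t) := by
  induction t with
  | nil =>
    obtain ⟨l, r, h, -⟩ := h
    simp [IsSubtree] at h
  | node x l r ihl ihr =>
    obtain ⟨l0, r0, h, hb⟩ := h
    simp only [word, List.nodup_append, List.nodup_cons, List.mem_cons] at hn
    obtain ⟨n1, ⟨n2, n3⟩, n4⟩ := hn
    rcases h with h | h | h
    · injection h with e1 e2 e3
      subst e1 e2 e3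
      have hx : a ≠ b := fun e => n4 b hb a (Or.inl rfl) e.symm
      rw [prune, if_neg hx]; simp [word]
    · have hb' : b ∈ word l := mem_word_of_isSubtree h (by simp [word, hb])
      have hx : x ≠ b := fun e => n4 b hb' x (Or.inl rfl) e.symm
      have := ihl n1 ⟨l0, r0, h, hb⟩
      rw [prune, if_neg hx]; simp [word, this]
    · have hb' : b ∈ word r := mem_word_of_isSubtree h (by simp [word, hb])
      have hx : x ≠ b := fun e => n2 (by rw [e]; exact hb')
      have := ihr n3 ⟨l0, r0, h, hb⟩
      rw [prune, if_neg hx]; simp [word, this]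

theorem IsRotation.rightEdges_lt {t t' : BinaryTree ℕ} {b a : ℕ} (hn : (word t).Nodup)
    (h : IsRotation t t' b a) : rightEdges t < rightEdges t' := by
  obtain ⟨h1, ⟨h2, -⟩, S, -, rfl⟩ := h
  have hb : b ∈ word t := by
    obtain ⟨l, r, h, hb⟩ := h2
    exact mem_word_of_isSubtree h (by simp [word, hb])
  have hne : extract b S t ≠ nil := by
    intro e
    have := mem_word_extract (S := S) hb
    simp [e, word] at this
  have k1 := rightEdges_prune (S := S) hn h1
  have k2 := (rightEdges_le_attach (a := a) hne (prune b S t)).2 (mem_word_prune hn h2)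
  omega

theorem transGen_covers {n : ℕ} {π π' : NCCP n} (h : Relation.TransGen Covers π π') :
    ∃ t t', IsTreeOf t π ∧ IsTreeOf t' π' ∧ rightEdges t < rightEdges t' := by
  induction h with
  | single h =>
    obtain ⟨b, a, t, t', h1, h2, h⟩ := h
    exact ⟨t, t', h1, h2, h.rightEdges_lt (by rw [h1.2]; exact π.nodup_word)⟩
  | @tail σ τ _ h ih =>
    obtain ⟨b, a, t, t', h1, h2, h⟩ := h
    obtain ⟨u, u', g1, g2, g⟩ := ih
    have e := word_eq_of_increasing g2.1 h1.1 (g2.2.trans h1.2.symm)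
    subst e
    exact ⟨u, t', g1, h2, g.trans (h.rightEdges_lt (by rw [h1.2]; exact σ.nodup_word))⟩

/-- The order on `NCCP n`: `π ≤ π'` if there is a sequence of rotations from `π` to `π'`. -/
instance (n : ℕ) : PartialOrder (NCCP n) where
  le := Relation.ReflTransGen Covers
  le_refl _ := Relation.ReflTransGen.refl
  le_trans _ _ _ := Relation.ReflTransGen.trans
  le_antisymm π π' h h' := by
    rcases Relation.reflTransGen_iff_eq_or_transGen.1 h with e | g
    · exact e.symm
    · obtain ⟨t, t', h1, h2, hlt⟩ := transGen_covers (g.trans_left h')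
      have e := word_eq_of_increasing h1.1 h2.1 (h1.2.trans h2.2.symm)
      rw [e] at hlt
      exact absurd hlt (lt_irrefl _)

/-- The set `NCCP(n;312)` of `312`-avoiding partitions, with the order induced from `NCCP n`. -/
abbrev NCCP312 (n : ℕ) : Type := {π : NCCP n // π.Avoids312}

/-- The element `n/n-1/⋯/1` of `NCCP(n;312)`. -/
def NCCP312.zero (n : ℕ) : NCCP312 n := ⟨NCCP.zero n, by
  intro i j k _ hjk x hx y hy z hz h
  have key : ∀ (m : ℕ) (hm : m < (NCCP.zero n).blocks.length),
      (NCCP.zero n).blocks[m] = [n - m] := by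
    intro m hm
    have : m < n := by simpa [NCCP.zero] using hm
    simp only [NCCP.zero, List.getElem_map, List.getElem_reverse, List.getElem_range',
      List.length_range', List.cons.injEq, and_true]
    omega
  rw [Fin.getElem_fin, key, List.mem_singleton] at hx hy hz
  have := Fin.le_def.1 hjk
  omega⟩

/-- The element `12⋯n` of `NCCP(n;312)`. -/
def NCCP312.one (n : ℕ) : NCCP312 n := ⟨NCCP.one n, by
  intro i j _ hij
  have hi := i.2
  have hj := j.2
  have := Fin.lt_def.1 hij
  have hl : (NCCP.one n).blocks.length ≤ 1 := by
    simp only [NCCP.one]; split_ifs <;> simp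
  omega⟩

/-! ### The Kreweras lattice -/

/-- The set `NCP(n)` of noncrossing canonical partitions of `[n]`. -/
structure NCP (n : ℕ) where
  toNCCP : NCCP n
  nonCrossing : toNCCP.NonCrossing
  canonical : toNCCP.Canonical

theorem NCP.toNCCP_injective {n : ℕ} : Function.Injective (NCP.toNCCP (n := n)) := by
  rintro ⟨π, h1, h2⟩ ⟨π', h1', h2'⟩ h
  simp only at h
  subst h
  rfl

instance (n : ℕ) : Finite (NCP n) := Finite.of_injective _ NCP.toNCCP_injective

theorem NCCP.block_eq {n : ℕ} (π : NCCP n) {B C : List ℕ} (hB : B ∈ π.blocks) (hC : C ∈ π.blocks)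
    {x : ℕ} (hxB : x ∈ B) (hxC : x ∈ C) : B = C := by
  by_contra hne
  have := (List.nodup_flatten.1 π.nodup_word).2
  have symm : Std.Symm (List.Disjoint (α := ℕ)) := ⟨fun _ _ h => List.Disjoint.symm h⟩
  exact List.Pairwise.forall this hB hC hne hxB hxC

/-- The order of the Kreweras lattice: `π ≤ π'` if `π` is a refinement of `π'` (or equal to it),
that is, every block of `π` is contained in a block of `π'`. -/
instance (n : ℕ) : PartialOrder (NCP n) where
  le π π' := ∀ B ∈ π.toNCCP.blocks, ∃ C ∈ π'.toNCCP.blocks, B ⊆ C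
  le_refl π B hB := ⟨B, hB, List.Subset.refl _⟩
  le_trans π π' π'' h h' B hB := by
    obtain ⟨C, hC, hBC⟩ := h B hB
    obtain ⟨D, hD, hCD⟩ := h' C hC
    exact ⟨D, hD, fun y hy => hCD (hBC hy)⟩
  le_antisymm π π' h h' := by
    have key : ∀ π π' : NCP n, (∀ B ∈ π.toNCCP.blocks, ∃ C ∈ π'.toNCCP.blocks, B ⊆ C) →
        (∀ B ∈ π'.toNCCP.blocks, ∃ C ∈ π.toNCCP.blocks, B ⊆ C) →
        π.toNCCP.blocks ⊆ π'.toNCCP.blocks := by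
      intro π π' h h' B hB
      obtain ⟨C, hC, hBC⟩ := h B hB
      obtain ⟨D, hD, hCD⟩ := h' C hC
      obtain ⟨x, hx⟩ := List.exists_mem_of_ne_nil _ (π.toNCCP.nonempty B hB)
      have e := π.toNCCP.block_eq hB hD hx (hCD (hBC hx))
      subst e
      have hp : B.Perm C := (List.perm_ext_iff_of_nodup
        ((π.toNCCP.increasing B hB).imp ne_of_lt) ((π'.toNCCP.increasing C hC).imp ne_of_lt)).2
        fun y => ⟨fun hy => hBC hy, fun hy => hCD hy⟩
      have : B = C := hp.eq_of_pairwise (fun a b _ _ h1 h2 => absurd h1 (not_lt.2 h2.le))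
        (π.toNCCP.increasing B hB) (π'.toNCCP.increasing C hC)
      rw [this]; exact hC
    have irr : ∀ B C : List ℕ, (∃ c ∈ C, ∀ b ∈ B, c < b) → (∃ c ∈ B, ∀ b ∈ C, c < b) → False := by
      rintro B C ⟨c, hc, h⟩ ⟨b, hb, h'⟩
      exact absurd (h b hb) (not_lt.2 (h' c hc).le)
    have nd : ∀ π : NCP n, π.toNCCP.blocks.Nodup := by
      intro π
      refine List.Pairwise.imp (R := fun B C => ∃ c ∈ C, ∀ b ∈ B, c < b) ?_ π.canonical
      rintro B C h rfl
      exact irr B B h h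
    have hp : π.toNCCP.blocks.Perm π'.toNCCP.blocks :=
      (List.perm_ext_iff_of_nodup (nd π) (nd π')).2 fun B =>
        ⟨fun hB => key π π' h h' hB, fun hB => key π' π h' h hB⟩
    apply NCP.toNCCP_injective
    ext1
    exact hp.eq_of_pairwise (fun a b _ _ h1 h2 => (irr a b h1 h2).elim) π.canonical π'.canonical

/-- The least element `n/n-1/⋯/1` of `NCP(n)`. -/
def NCP.zero (n : ℕ) : NCP n where
  toNCCP := NCCP.zero n
  nonCrossing := by
    intro B hB C hC _ a b c d hab hbc _ ha hc
    simp only [NCCP.zero] at hB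
    obtain ⟨i, -, rfl⟩ := List.mem_map.1 hB
    simp only [List.mem_singleton] at ha hc
    omega
  canonical := by
    simp only [NCCP.Canonical, NCCP.zero]
    rw [List.pairwise_map, List.pairwise_reverse]
    exact (List.pairwise_lt_range' (s := 1) (n := n)).imp (by simp)

/-- The greatest element `12⋯n` of `NCP(n)`. -/
def NCP.one (n : ℕ) : NCP n where
  toNCCP := NCCP.one n
  nonCrossing := by
    intro B hB C hC hne
    simp only [NCCP.one] at hB hC
    split_ifs at hB hC
    · simp at hB
    · simp only [List.mem_singleton] at hB hC
      exact absurd (hB.trans hC.symm) hne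
  canonical := by
    simp only [NCCP.Canonical, NCCP.one]
    split_ifs <;> simp

/-! ### Chains and the Möbius function -/

/-- An unrefinable chain `0̂ = c₀ ⋖ c₁ ⋖ ⋯ ⋖ c_{n-1} = 1̂`, that is, a maximal chain of `NCCP n`
(the number of blocks drops by one in every rotation, from `n` to `1`). -/
def IsMaximalChain {n : ℕ} (c : Fin (n - 1 + 1) → NCCP n) : Prop :=
  c 0 = NCCP.zero n ∧ c (Fin.last _) = NCCP.one n ∧
    ∀ i : Fin (n - 1), Covers (c i.castSucc) (c i.succ)

/-- The labels `L` along the chain are strictly decreasing. -/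
def IsDecreasing {n : ℕ} (c : Fin (n - 1 + 1) → NCCP n) : Prop :=
  StrictAnti fun i : Fin (n - 1) => edgeLabel (c i.castSucc) (c i.succ)

/-- The sequences `a₁ ≤ a₂ ≤ ⋯ ≤ a_m` of integers with `1 ≤ a_i ≤ i`; the term `a_{i+1}` is the
value at the index `i`, for `0 ≤ i < m`. -/
def IsSeqA {m : ℕ} (a : Fin m → ℕ) : Prop :=
  Monotone a ∧ ∀ i, 1 ≤ a i ∧ a i ≤ i + 1

open Classical in
/-- The Möbius function of a finite poset, `μ(x, x) = 1` and `μ(x, y) = -∑ μ(x, z)` over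
`x ≤ z < y` if `x < y`. -/
noncomputable def moebius {α : Type*} [PartialOrder α] [Finite α] (x y : α) : ℤ :=
  letI := Fintype.ofFinite α
  letI : LocallyFiniteOrder α := Fintype.toLocallyFiniteOrder
  IncidenceAlgebra.mu ℤ x y

end Nccp

open Nccp

/-! The carrying object is the set partition of [n] formed by the maximal right-extended sequences
("right chains") of the tree of π. Right chains are in general not the blocks of π: the partition
13/2 has the right chains {1,2} and {3}.

Two facts govern them. A rotation with triplet (b, a, S) merges the right chain of a with the right
chain of b and leaves all others unchanged, whatever S is (`IsRotation.chainRel_iff`); so π ≤ π'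
implies that the chains of π refine those of π'. And π avoids 312 exactly when the labels of its
tree increase in preorder (`preorderly_iff`). Such a tree is determined by its right chains
(`Preorderly.ext`), these are noncrossing, and every noncrossing partition arises
(`exists_preorderly`). If E < F are noncrossing, some merge of two classes of E stays noncrossing
and below F (`exists_merge_le`), and it is realized by a rotation in which S is the whole left
sequence below b (`isRotation_of_chainRel`). Hence NCCP(n;312), with the induced order, is the
lattice `NC n` of noncrossing equivalence relations. For NCP(n) the same lattice is obtained
directly from the blocks.

The Möbius function is computed in `NC n`. If p < q are the two least elements of a class of E, then
merging p with q is a closure operator on the interval below E, so μ(0̂, ·) sums to zero over the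
fiber of E. That fiber consists of E and of the relations that split off from the class of p an
initial segment of the class without p. With sizes inserted this is the Catalan recursion up to
sign, and μ(0̂, E) is a product of signed Catalan numbers over the classes (`moebius_NC`).

For part 1, in a maximal chain the number of blocks drops by one in each step, so L strictly
decreases exactly when L̃ weakly increases. In a rotation of a 312-avoiding partition b is the least
element of its class. A nontrivial class of b would contain an earlier label, which is at least b
and hence larger than the present label, against monotonicity. So every step adjoins a single
element b to the class of 1, and b is the least element above the label in the enlarged class. Read
backwards from 1̂, the labels therefore determine the chain; the elements up to a_i survive until a
class of size i is reached, whence a_i ≤ i; and for a sequence in A(n-1) the backward removal can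
always be carried out (`exists_chain`). -/

namespace Nccp

open BinaryTree Finset

/-! ### The Möbius function of a finite poset -/

section Moebius

variable {α β : Type*} [PartialOrder α] [PartialOrder β]

theorem moebius_self [Finite α] (x : α) : moebius x x = 1 := by
  simp [moebius]

open Classical in
theorem sum_moebius [Fintype α] {x y : α} (h : x < y) :
    ∑ z with x ≤ z ∧ z ≤ y, moebius x z = 0 := by
  let _ : LocallyFiniteOrder α := Fintype.toLocallyFiniteOrder
  have := IncidenceAlgebra.sum_Icc_mu_right (𝕜 := ℤ) x y
  rw [if_neg h.ne] at this
  rw [← this]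
  refine Finset.sum_congr (by ext z; simp) fun z _ => ?_
  unfold moebius
  congr!

open Classical in
theorem moebius_eq_neg_sum [Fintype α] {x y : α} (h : x < y) :
    moebius x y = - ∑ z with x ≤ z ∧ z < y, moebius x z := by
  have := sum_moebius h
  have e : (univ.filter fun z => x ≤ z ∧ z ≤ y) =
      insert y (univ.filter fun z => x ≤ z ∧ z < y) := by
    ext z
    simp only [mem_filter, mem_univ, true_and, mem_insert]
    constructor
    · rintro ⟨h1, h2⟩
      rcases h2.eq_or_lt with e | e
      · exact Or.inl e
      · exact Or.inr ⟨h1, e⟩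
    · rintro (rfl | ⟨h1, h2⟩)
      · exact ⟨h.le, le_rfl⟩
      · exact ⟨h1, h2.le⟩
  rw [e, Finset.sum_insert (by simp)] at this
  linarith

theorem moebius_orderIso [Finite α] [Finite β] (e : α ≃o β) (x y : α) (h : x ≤ y) :
    moebius (e x) (e y) = moebius x y := by
  classical
  let _ := Fintype.ofFinite α
  let _ := Fintype.ofFinite β
  induction y using WellFoundedLT.induction with
  | _ y ih =>
    rcases h.eq_or_lt with rfl | h
    · rw [moebius_self, moebius_self]
    · rw [moebius_eq_neg_sum h, moebius_eq_neg_sum (e.lt_iff_lt.2 h)]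
      congr 1
      symm
      refine Finset.sum_bij (fun z _ => e z) ?_ ?_ ?_ ?_
      · simp
      · simp
      · intro z hz
        exact ⟨e.symm z, by simpa [e.le_symm_apply, e.symm_apply_lt] using hz, by simp⟩
      · intro z hz
        simp only [mem_filter, mem_univ, true_and] at hz
        exact (ih z hz.2 hz.1).symm

open Classical in
/-- If `c` is a closure operator on the interval below `y`, with set of closed elements `K`, and
the least element `o` is not closed, then the Möbius function sums to zero over the fibers of `c`. -/
theorem sum_moebius_fiber [Fintype α] {o y : α} (ho : ∀ x, o ≤ x) {K : Set α} {c : α → α}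
    (hK : ∀ z ∈ K, z ≤ y) (hcK : ∀ x ≤ y, c x ∈ K)
    (hc : ∀ x ≤ y, ∀ z ∈ K, x ≤ z ↔ c x ≤ z) (hoK : o ∉ K) (z : α) (hz : z ∈ K) :
    ∑ x with x ≤ y ∧ c x = z, moebius o x = 0 := by
  induction z using WellFoundedLT.induction with
  | _ z ih =>
    -- The interval from `o` to `z` is nontrivial because `z` is closed and `o` is not.
    have h0 := sum_moebius (lt_of_le_of_ne (ho z) (fun e => hoK (e ▸ hz)))
    -- By `hc` this interval is the disjoint union of the fibers over the closed `w ≤ z`. Induction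
    -- kills all of them except the fiber over `z`.
    have e : (univ.filter fun x => o ≤ x ∧ x ≤ z) = univ.filter fun x => x ≤ y ∧ c x ≤ z := by
      ext x
      simp only [mem_filter, mem_univ, true_and, ho]
      exact ⟨fun h => ⟨h.trans (hK z hz), (hc x (h.trans (hK z hz)) z hz).1 h⟩,
        fun h => (hc x h.1 z hz).2 h.2⟩
    have hm : ∀ x ∈ univ.filter fun x => x ≤ y ∧ c x ≤ z,
        c x ∈ univ.filter fun w => w ∈ K ∧ w ≤ z := by
      intro x hx
      simp only [mem_filter, mem_univ, true_and] at hx ⊢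
      exact ⟨hcK x hx.1, hx.2⟩
    rw [e, ← Finset.sum_fiberwise_of_maps_to hm, Finset.sum_eq_single z] at h0
    · rw [← h0]
      refine Finset.sum_congr ?_ fun _ _ => rfl
      ext x
      simp only [mem_filter, mem_univ, true_and]
      exact ⟨fun h => ⟨⟨h.1, h.2.le⟩, h.2⟩, fun h => ⟨h.1.1, h.2⟩⟩
    · intro w hw hwz
      simp only [mem_filter, mem_univ, true_and] at hw
      rw [← ih w (lt_of_le_of_ne hw.2 hwz) hw.1]
      refine Finset.sum_congr ?_ fun _ _ => rfl
      ext x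
      simp only [mem_filter, mem_univ, true_and]
      exact ⟨fun h => ⟨h.1.1, h.2⟩, fun h => ⟨⟨h.1, h.2.le.trans hw.2⟩, h.2⟩⟩
    · intro h
      exact absurd (by simp [hz]) h

end Moebius

/-! ### Noncrossing equivalence relations -/

/-- `E` is a noncrossing equivalence relation on `[n]`, extended by equality to `ℕ`. -/
def IsNC (n : ℕ) (E : Setoid ℕ) : Prop :=
  (∀ u v, E u v → u ≠ v → 1 ≤ u ∧ u ≤ n) ∧
    ∀ a b c d, a < b → b < c → c < d → E a c → E b d → E a b

/-- The noncrossing equivalence relations on `[n]`. -/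
abbrev NC (n : ℕ) : Type := {E : Setoid ℕ // IsNC n E}

/-- Outside of [n] such a relation is equality, so its restriction to {0, …, n} determines it. -/
instance (n : ℕ) : Finite (NC n) := by
  refine Finite.of_injective
    (fun E : NC n => fun u v : Fin (n + 1) => E.1 u v) ?_
  intro E F h
  have key : ∀ E F : NC n, (∀ u v : Fin (n + 1), E.1 u v → F.1 u v) → E.1 ≤ F.1 := by
    intro E F h u v huv
    by_cases e : u = v
    · exact e ▸ F.1.refl u
    · exact h ⟨u, by have := E.2.1 u v huv e; omega⟩
        ⟨v, by have := E.2.1 v u (E.1.symm huv) (Ne.symm e); omega⟩ huv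
  refine Subtype.ext (le_antisymm (key E F fun u v => ?_) (key F E fun u v => ?_))
  · exact (iff_of_eq (congrFun (congrFun h u) v)).1
  · exact (iff_of_eq (congrFun (congrFun h u) v)).2

/-- The equivalence relation in which the classes of `p` and `q` are merged. -/
def merge (E : Setoid ℕ) (p q : ℕ) : Setoid ℕ where
  r u v := E u v ∨ (E u p ∧ E q v) ∨ (E u q ∧ E p v)
  iseqv := by
    refine ⟨fun u => Or.inl (E.refl u), ?_, ?_⟩
    · rintro u v (h | ⟨h, h'⟩ | ⟨h, h'⟩)
      · exact Or.inl (E.symm h)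
      · exact Or.inr (Or.inr ⟨E.symm h', E.symm h⟩)
      · exact Or.inr (Or.inl ⟨E.symm h', E.symm h⟩)
    · rintro u v w (h | ⟨h, h'⟩ | ⟨h, h'⟩) (g | ⟨g, g'⟩ | ⟨g, g'⟩)
      · exact Or.inl (E.trans h g)
      · exact Or.inr (Or.inl ⟨E.trans h g, g'⟩)
      · exact Or.inr (Or.inr ⟨E.trans h g, g'⟩)
      · exact Or.inr (Or.inl ⟨h, E.trans h' g⟩)
      · exact Or.inr (Or.inl ⟨h, g'⟩)
      · exact Or.inl (E.trans h g')
      · exact Or.inr (Or.inr ⟨h, E.trans h' g⟩)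
      · exact Or.inl (E.trans h g')
      · exact Or.inr (Or.inr ⟨h, g'⟩)

theorem merge_apply {E : Setoid ℕ} {p q u v : ℕ} :
    merge E p q u v ↔ E u v ∨ (E u p ∧ E q v) ∨ (E u q ∧ E p v) := Iff.rfl

theorem le_merge (E : Setoid ℕ) (p q : ℕ) : E ≤ merge E p q := fun _ _ h => Or.inl h

theorem merge_rel (E : Setoid ℕ) (p q : ℕ) : merge E p q p q :=
  Or.inr (Or.inl ⟨E.refl p, E.refl q⟩)

theorem merge_le {E F : Setoid ℕ} {p q : ℕ} (h : E ≤ F) (hpq : F p q) : merge E p q ≤ F := by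
  rintro u v (g | ⟨g, g'⟩ | ⟨g, g'⟩)
  · exact h g
  · exact F.trans (h g) (F.trans hpq (h g'))
  · exact F.trans (h g) (F.trans (F.symm hpq) (h g'))

theorem merge_congr {E : Setoid ℕ} {p q p' q' : ℕ} (hp : E p p') (hq : E q q') :
    merge E p q = merge E p' q' :=
  le_antisymm
    (merge_le (le_merge _ _ _) ((merge E p' q').trans (Or.inl hp)
      ((merge E p' q').trans (merge_rel _ _ _) (Or.inl (E.symm hq)))))
    (merge_le (le_merge _ _ _) ((merge E p q).trans (Or.inl (E.symm hp))
      ((merge E p q).trans (merge_rel _ _ _) (Or.inl hq))))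

/-- Merging inside of a class of a noncrossing relation the class of the least element with the
class of the least element that is not related to it leads to a noncrossing relation. -/
theorem IsNC.merge {n : ℕ} {E F : Setoid ℕ} (hE : IsNC n E) (hF : IsNC n F) (hEF : E ≤ F)
    {p q : ℕ} (hpq : F p q) (hlt : p < q) (hq : ∀ v, F p v → v < q → E p v) :
    IsNC n (merge E p q) := by
  refine ⟨fun u v h => hF.1 u v (merge_le hEF hpq h), ?_⟩
  have big : ∀ v, F p v → ¬ E p v → ¬ E q v → q < v := by
    intro v h1 h2 h3
    by_contra h
    rcases (not_lt.1 h).eq_or_lt with e | e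
    · exact h3 (e ▸ E.refl _)
    · exact h2 (hq v h1 e)
  -- A third `E`-class inside the `F`-class of `p` lies above `q`, hence above `p`. If it surrounded
  -- an element `w` of the merged class, it would already cross the class of `p` or of `q` in `E`.
  have key : ∀ v w z, v < w → w < z → E v z → F p v → ¬ E p v → ¬ E q v → (E w p ∨ E w q) →
      False := by
    intro v w z h1 h2 h3 h4 h5 h6 h7
    have h8 := big v h4 h5 h6
    rcases h7 with h7 | h7
    · exact h5 (hE.2 p v w z (by omega) h1 h2 (E.symm h7) h3)
    · exact h6 (hE.2 q v w z (by omega) h1 h2 (E.symm h7) h3)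
  have mF : ∀ u v, Nccp.merge E p q u v → F u v := fun u v h => merge_le hEF hpq h
  intro a b c d hab hbc hcd hac hbd
  have sym : ∀ u v, E u p ∨ E u q → E v p ∨ E v q → Nccp.merge E p q u v := by
    rintro u v (h | h) (h' | h')
    · exact Or.inl (E.trans h (E.symm h'))
    · exact Or.inr (Or.inl ⟨h, E.symm h'⟩)
    · exact Or.inr (Or.inr ⟨h, E.symm h'⟩)
    · exact Or.inl (E.trans h (E.symm h'))
  have mem : ∀ u v, Nccp.merge E p q u v → E u v ∨ ((E u p ∨ E u q) ∧ (E v p ∨ E v q)) := by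
    rintro u v (h | ⟨h, h'⟩ | ⟨h, h'⟩)
    · exact Or.inl h
    · exact Or.inr ⟨Or.inl h, Or.inr (E.symm h')⟩
    · exact Or.inr ⟨Or.inr h, Or.inl (E.symm h')⟩
  by_cases dab : (E a p ∨ E a q) ∧ (E b p ∨ E b q)
  · exact sym a b dab.1 dab.2
  -- In a mixed crossing one pair lies in the merged class and the other in a single `E`-class. As
  -- `F` is noncrossing, both are in the `F`-class of `p`, and `key` applies to the second pair.
  have Fab := hF.2 a b c d hab hbc hcd (mF a c hac) (mF b d hbd)
  rcases mem a c hac with h | ⟨h, h'⟩ <;> rcases mem b d hbd with g | ⟨g, g'⟩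
  · exact Or.inl (hE.2 a b c d hab hbc hcd h g)
  · exfalso
    have ha : ¬ E p a ∧ ¬ E q a := ⟨fun e => dab ⟨Or.inl (E.symm e), g⟩,
      fun e => dab ⟨Or.inr (E.symm e), g⟩⟩
    refine key a b c hab hbc h ?_ ha.1 ha.2 g
    rcases g with g | g
    · exact F.symm (F.trans Fab (hEF g))
    · exact F.trans hpq (F.symm (F.trans Fab (hEF g)))
  · exfalso
    have hb : ¬ E p b ∧ ¬ E q b := ⟨fun e => dab ⟨h, Or.inl (E.symm e)⟩,
      fun e => dab ⟨h, Or.inr (E.symm e)⟩⟩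
    refine key b c d hbc hcd g ?_ hb.1 hb.2 h'
    rcases h with g | g
    · exact F.trans (F.symm (hEF g)) Fab
    · exact F.trans hpq (F.trans (F.symm (hEF g)) Fab)
  · exact absurd ⟨h, g⟩ dab

/-- The least element of `NC n`. -/
def NC.bot (n : ℕ) : NC n := ⟨⊥, fun u v h h' => absurd h h', fun a b c d h1 h2 _ h _ =>
  absurd (show a = c from h) (by omega)⟩

theorem NC.bot_le {n : ℕ} (E : NC n) : NC.bot n ≤ E := by
  intro u v h
  obtain rfl : u = v := h
  exact E.1.refl u

/-- The equivalence relation on `ℕ` with the set `A` as its only nontrivial class. -/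
def singleClass (A : Set ℕ) : Setoid ℕ where
  r u v := u = v ∨ (u ∈ A ∧ v ∈ A)
  iseqv := by
    refine ⟨fun u => Or.inl rfl, ?_, ?_⟩
    · rintro u v (h | h)
      · exact Or.inl h.symm
      · exact Or.inr h.symm
    · rintro u v w (rfl | h) (rfl | g)
      · exact Or.inl rfl
      · exact Or.inr g
      · exact Or.inr h
      · exact Or.inr ⟨h.1, g.2⟩

theorem singleClass_apply {A : Set ℕ} {u v : ℕ} :
    singleClass A u v ↔ u = v ∨ (u ∈ A ∧ v ∈ A) := Iff.rfl

theorem isNC_singleClass {n : ℕ} {A : Set ℕ} (hA : ∀ u ∈ A, 1 ≤ u ∧ u ≤ n) :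
    IsNC n (singleClass A) := by
  refine ⟨?_, ?_⟩
  · rintro u v (h | h) h'
    · exact absurd h h'
    · exact hA u h.1
  · rintro a b c d h1 h2 h3 (h | h) (g | g)
    · omega
    · omega
    · omega
    · exact Or.inr ⟨h.1, g.1⟩

/-- The greatest element of `NC n`. -/
def NC.top (n : ℕ) : NC n := ⟨singleClass {u | 1 ≤ u ∧ u ≤ n}, isNC_singleClass fun _ h => h⟩

theorem NC.le_top {n : ℕ} (E : NC n) : E ≤ NC.top n := by
  intro u v h
  by_cases e : u = v
  · exact Or.inl e
  · exact Or.inr ⟨E.2.1 u v h e, E.2.1 v u (E.1.symm h) (Ne.symm e)⟩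

/-! ### Splitting a class -/

/-- The elements up to `k` of the class of `p`, without `p` itself, are split off. -/
def split (E : Setoid ℕ) (p k : ℕ) : Setoid ℕ :=
  E ⊓ Setoid.ker fun w => E p w ∧ w ≠ p ∧ w ≤ k

theorem split_apply {E : Setoid ℕ} {p k u v : ℕ} :
    split E p k u v ↔ E u v ∧ ((E p u ∧ u ≠ p ∧ u ≤ k) ↔ (E p v ∧ v ≠ p ∧ v ≤ k)) :=
  ⟨fun h => ⟨h.1, iff_of_eq h.2⟩, fun h => ⟨h.1, propext h.2⟩⟩

/-- Within the class of `p` the part split off is a run of consecutive elements, those directly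
after the least element `p`. Such a run cannot alternate with its complement. -/
theorem IsNC.split {n : ℕ} {E : Setoid ℕ} (hE : IsNC n E) {p k : ℕ} (hp : ∀ v, E p v → p ≤ v) :
    IsNC n (split E p k) := by
  refine ⟨fun u v h => hE.1 u v (split_apply.1 h).1, ?_⟩
  intro a b c d hab hbc hcd hac hbd
  rw [split_apply] at hac hbd ⊢
  obtain ⟨h1, h2⟩ := hac
  obtain ⟨g1, g2⟩ := hbd
  have e := hE.2 a b c d hab hbc hcd h1 g1
  refine ⟨e, ?_, ?_⟩
  · rintro ⟨q1, q2, q3⟩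
    have := h2.1 ⟨q1, q2, q3⟩
    have := hp a q1
    exact ⟨E.trans q1 e, by omega, by omega⟩
  · rintro ⟨q1, q2, q3⟩
    have r := E.trans q1 (E.symm e)
    refine ⟨r, ?_, by omega⟩
    rintro rfl
    have := g2.1 ⟨q1, q2, q3⟩
    exact (h2.2 ⟨E.trans q1 (E.trans (E.symm e) h1), by omega, by omega⟩).2.1 rfl

theorem split_le (E : Setoid ℕ) (p k : ℕ) : split E p k ≤ E := fun _ _ h => (split_apply.1 h).1

theorem merge_split {E : Setoid ℕ} {p q k : ℕ} (h : E p q) (hq : q ≠ p) (hqk : q ≤ k) :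
    merge (split E p k) p q = E := by
  apply le_antisymm (merge_le (split_le _ _ _) h)
  intro u v huv
  have key : ∀ u v, E u v → (E p u ∧ u ≠ p ∧ u ≤ k) → ¬ (E p v ∧ v ≠ p ∧ v ≤ k) →
      split E p k u q ∧ split E p k p v := by
    intro u v huv hu hv
    refine ⟨split_apply.2 ⟨E.trans (E.symm hu.1) h, by tauto⟩,
      split_apply.2 ⟨E.trans hu.1 huv, ?_⟩⟩
    constructor
    · intro g; exact absurd rfl g.2.1
    · intro g; exact absurd g hv
  by_cases hu : E p u ∧ u ≠ p ∧ u ≤ k <;> by_cases hv : E p v ∧ v ≠ p ∧ v ≤ k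
  · exact Or.inl (split_apply.2 ⟨huv, by tauto⟩)
  · exact Or.inr (Or.inr (key u v huv hu hv))
  · obtain ⟨h1, h2⟩ := key v u (E.symm huv) hv hu
    exact Or.inr (Or.inl ⟨(split E p k).symm h2, (split E p k).symm h1⟩)
  · exact Or.inl (split_apply.2 ⟨huv, by tauto⟩)

open Classical in
/-- The part in `[n]` of the class of `x`. -/
noncomputable def cls (n : ℕ) (E : Setoid ℕ) (x : ℕ) : Finset ℕ := {v ∈ Icc 1 n | E x v}

theorem mem_cls {n : ℕ} {E : Setoid ℕ} {x v : ℕ} : v ∈ cls n E x ↔ (1 ≤ v ∧ v ≤ n) ∧ E x v := by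
  simp [cls]

/-- `x` is the least element of its class. -/
def IsMin (E : Setoid ℕ) (x : ℕ) : Prop := ∀ v, E x v → x ≤ v

/-- A noncrossing relation on `[n]` that is obtained by splitting off from a class a part that
contains the second element but not the first one arises by `split`. -/
theorem exists_eq_split {n : ℕ} {E F : Setoid ℕ} (hE : IsNC n E) (hF : IsNC n F) {p q : ℕ}
    (hpq : p < q) (hq : ∀ v, F p v → v ≠ p → q ≤ v) (hm : merge E p q = F) (hne : ¬ E p q) :
    ∃ k ∈ (cls n F p).erase p, E = split F p k := by
  classical
  have hle : E ≤ F := hm ▸ le_merge _ _ _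
  have hFpq : F p q := hm ▸ merge_rel E p q
  have hmem : ∀ v, F p v → v ≠ p → v ∈ (cls n F p).erase p := fun v h h' =>
    mem_erase.2 ⟨h', mem_cls.2 ⟨hF.1 v p (F.symm h) h', h⟩⟩
  have hqE : ∀ v, E q v → v ≠ p := by
    rintro v h rfl
    exact hne (E.symm h)
  set Q := ((cls n F p).erase p).filter (E q) with hQ
  have hqQ : q ∈ Q := mem_filter.2 ⟨hmem q hFpq hpq.ne', E.refl q⟩
  have hmax := Q.max'_mem ⟨q, hqQ⟩
  -- The part that is split off is the `E`-class of `q`; its greatest element is the bound `k`.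
  set k := Q.max' ⟨q, hqQ⟩ with hk
  obtain ⟨k1, k2⟩ := mem_filter.1 hmax
  have key : ∀ v, E q v ↔ F p v ∧ v ≠ p ∧ v ≤ k := by
    intro v
    constructor
    · intro h
      have h1 := F.trans hFpq (hle h)
      exact ⟨h1, hqE v h, Q.le_max' v (mem_filter.2 ⟨hmem v h1 (hqE v h), h⟩)⟩
    · rintro ⟨h1, h2, h3⟩
      have h4 := hq v h1 h2
      rcases h4.eq_or_lt with rfl | h4
      · exact E.refl _
      rcases h3.eq_or_lt with rfl | h3
      · exact k2
      -- An element `v` of the `F`-class with `q < v < k` belongs to `p` or to `q` in `E`. The first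
      -- is impossible, since the pairs `p, v` and `q, k` would cross.
      have h5 : merge E p q p v := hm ▸ h1
      rcases h5 with h5 | h5 | h5
      · exact absurd (hE.2 p q v k hpq h4 h3 h5 k2) hne
      · exact h5.2
      · exact absurd h5.1 hne
  refine ⟨k, k1, le_antisymm ?_ ?_⟩
  · intro u v h
    refine split_apply.2 ⟨hle h, ?_⟩
    rw [← key, ← key]
    exact ⟨fun g => E.trans g h, fun g => E.trans g (E.symm h)⟩
  · intro u v h
    obtain ⟨h1, h2⟩ := split_apply.1 h
    rw [← key, ← key] at h2
    have h3 : merge E p q u v := hm ▸ h1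
    rcases h3 with h3 | h3 | h3
    · exact h3
    · exact absurd (E.trans (h2.2 h3.2) h3.1) fun g => hne (E.symm g)
    · exact absurd (E.trans (h2.1 (E.symm h3.1)) (E.symm h3.2)) fun g => hne (E.symm g)

/-! ### Catalan numbers and the Möbius function of a noncrossing relation -/

/-- The signed Catalan numbers. -/
def signedCatalan (m : ℕ) : ℤ := (-1) ^ (m - 1) * (catalan (m - 1) : ℤ)

open Classical in
/-- The product of the signed Catalan numbers of the sizes of the classes. -/
noncomputable def classProd (n : ℕ) (E : Setoid ℕ) : ℤ :=
  ∏ x ∈ Icc 1 n, if IsMin E x then signedCatalan (cls n E x).card else 1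

/-- The number of elements of `T` below `k` is the rank of `k`, which runs through 0, …, |T| - 1. -/
theorem sum_card_filter_lt (T : Finset ℕ) (f : ℕ → ℤ) :
    ∑ k ∈ T, f (T.filter (· < k)).card = ∑ i ∈ range T.card, f i := by
  induction T using Finset.induction_on_max with
  | empty => simp
  | insert a T h ih =>
    have ha : a ∉ T := fun hh => lt_irrefl _ (h a hh)
    rw [sum_insert ha, card_insert_of_notMem ha, sum_range_succ, ← ih, add_comm]
    congr 1
    · refine Finset.sum_congr rfl fun k hk => ?_
      rw [filter_insert, if_neg (not_lt.2 (h k hk).le)]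
    · rw [filter_insert, if_neg (lt_irrefl a), filter_true_of_mem h]

/-- This is the Catalan recursion: the exponents of -1 in each product add up to `m - 1`, one less
than the exponent `m` on the right. -/
theorem sum_signedCatalan (m : ℕ) (hm : 1 ≤ m) :
    ∑ i ∈ range m, signedCatalan (m - i) * signedCatalan (i + 1) = - signedCatalan (m + 1) := by
  obtain ⟨m, rfl⟩ := Nat.exists_eq_add_of_le' hm
  simp only [signedCatalan, Nat.add_sub_cancel, catalan_succ]
  rw [Finset.sum_range, Nat.cast_sum, Finset.mul_sum, ← Finset.sum_neg_distrib]
  refine Finset.sum_congr rfl fun i _ => ?_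
  have h := i.2
  rw [show m + 1 - (i : ℕ) - 1 = m - i by omega]
  have : ((-1 : ℤ)) ^ (m + 1) = - ((-1) ^ (m - i) * (-1) ^ (i : ℕ)) := by
    rw [← pow_add, show m - i + i = m by omega, pow_succ]; ring
  rw [this]; push_cast; ring

/-- Splitting at `k` replaces a class of size |T| + 1 by the class of `q`, whose size is one more
than the rank of `k` in `T`, and the class of `p`, which gets the rest. The common factor `R` makes
the Möbius sum over all splits a multiple of a single Catalan convolution. -/
theorem classProd_split {n : ℕ} {E : Setoid ℕ} (hE : IsNC n E) {p q : ℕ} (hpq : p < q)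
    (h : E p q) (hq : ∀ v, E p v → v ≠ p → q ≤ v) {T : Finset ℕ} (hT : T = (cls n E p).erase p) :
    ∃ R, classProd n E = R * signedCatalan (T.card + 1) ∧
      ∀ k ∈ T, classProd n (split E p k) = R *
        (signedCatalan (T.card - (T.filter (· < k)).card) *
          signedCatalan ((T.filter (· < k)).card + 1)) := by
  classical
  have hp0 : 1 ≤ p ∧ p ≤ n := hE.1 p q h hpq.ne
  have hq0 : 1 ≤ q ∧ q ≤ n := hE.1 q p (E.symm h) hpq.ne'
  have hpI : p ∈ Icc 1 n := mem_Icc.2 hp0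
  have hqI : q ∈ (Icc 1 n).erase p := mem_erase.2 ⟨hpq.ne', mem_Icc.2 hq0⟩
  have hmin : IsMin E p := fun v hv => by
    by_cases e : v = p
    · omega
    · have := hq v hv e; omega
  have hpT : p ∉ T := by simp [hT]
  have hins : cls n E p = insert p T := by
    rw [hT, insert_erase]
    exact mem_cls.2 ⟨hp0, E.refl p⟩
  have memT : ∀ v, v ∈ T ↔ E p v ∧ v ≠ p := by
    intro v
    rw [hT, mem_erase, mem_cls]
    exact ⟨fun g => ⟨g.2.2, g.1⟩, fun g => ⟨g.2, hE.1 v p (E.symm g.1) g.2, g.1⟩⟩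
  -- Only the factors at `p` and `q` change: `q` contributes 1 in `E`, and becomes a least element
  -- after the split.
  refine ⟨∏ x ∈ ((Icc 1 n).erase p).erase q,
    if IsMin E x then signedCatalan (cls n E x).card else 1, ?_, ?_⟩
  · rw [classProd, ← mul_prod_erase _ _ hpI, ← mul_prod_erase _ _ hqI, if_pos hmin,
      if_neg (fun g => absurd (g p (E.symm h)) (by omega)), hins, card_insert_of_notMem hpT]
    ring
  intro k hk
  have hk' := (memT k).1 hk
  have hqk := hq k hk'.1 hk'.2
  have hsplit : ∀ u v, split E p k u v ↔ E u v ∧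
      ((E p u ∧ u ≠ p ∧ u ≤ k) ↔ (E p v ∧ v ≠ p ∧ v ≤ k)) := fun u v => split_apply
  have hclsq : cls n (split E p k) q = insert k (T.filter (· < k)) := by
    ext v
    rw [mem_cls, hsplit, mem_insert, mem_filter, memT]
    constructor
    · rintro ⟨g1, g2, g3⟩
      have := g3.1 ⟨h, hpq.ne', hqk⟩
      rcases this.2.2.eq_or_lt with e | e
      · exact Or.inl e
      · exact Or.inr ⟨⟨this.1, this.2.1⟩, e⟩
    · intro g
      have : E p v ∧ v ≠ p ∧ v ≤ k := by
        rcases g with rfl | ⟨g1, g2⟩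
        · exact ⟨hk'.1, hk'.2, le_rfl⟩
        · exact ⟨g1.1, g1.2, g2.le⟩
      exact ⟨hE.1 v p (E.symm this.1) this.2.1, E.trans (E.symm h) this.1,
        fun _ => this, fun _ => ⟨h, hpq.ne', hqk⟩⟩
  have hclsp : cls n (split E p k) p = (cls n E p) \ cls n (split E p k) q := by
    ext v
    rw [mem_cls, mem_sdiff, mem_cls, mem_cls, hsplit, hsplit]
    constructor
    · rintro ⟨g1, g2, g3⟩
      exact ⟨⟨g1, g2⟩, fun g => (g3.2 (g.2.2.1 ⟨h, hpq.ne', hqk⟩)).2.1 rfl⟩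
    · rintro ⟨⟨g1, g2⟩, g3⟩
      refine ⟨g1, g2, fun g => absurd rfl g.2.1, fun g => absurd ?_ g3⟩
      exact ⟨g1, E.trans (E.symm h) g2, fun _ => g, fun _ => ⟨h, hpq.ne', hqk⟩⟩
  have cq : (cls n (split E p k) q).card = (T.filter (· < k)).card + 1 := by
    rw [hclsq, card_insert_of_notMem (by simp)]
  have cp : (cls n (split E p k) p).card = T.card - (T.filter (· < k)).card := by
    rw [hclsp, card_sdiff_of_subset, cq, hins, card_insert_of_notMem hpT]
    · omega
    · intro v hv
      rw [mem_cls, hsplit] at hv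
      exact mem_cls.2 ⟨hv.1, E.trans h hv.2.1⟩
  have hminp : IsMin (split E p k) p := fun v hv => hmin v ((hsplit _ _).1 hv).1
  have hminq : IsMin (split E p k) q := by
    intro v hv
    have := ((hsplit _ _).1 hv).2.1 ⟨h, hpq.ne', hqk⟩
    exact hq v this.1 this.2.1
  rw [classProd, ← mul_prod_erase _ _ hpI, ← mul_prod_erase _ _ hqI, if_pos hminp, if_pos hminq,
    cp, cq, ← mul_assoc, mul_comm]
  congr 1
  refine Finset.prod_congr rfl fun x hx => ?_
  simp only [mem_erase] at hx
  -- An `x` other than `p` and `q` in the class of `p` is not least before or after the split, since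
  -- it stays with `p` or with `q`. Classes elsewhere are untouched.
  by_cases hpx : E p x
  · have h1 : ¬ IsMin E x := fun g => by
      have := g p (E.symm hpx)
      have := hmin x hpx
      omega
    have h2 : ¬ IsMin (split E p k) x := by
      intro g
      have := hq x hpx hx.2.1
      by_cases hxk : x ≤ k
      · have := g q ((hsplit _ _).2 ⟨E.trans (E.symm hpx) h, fun _ => ⟨h, hpq.ne', hqk⟩,
          fun _ => ⟨hpx, hx.2.1, hxk⟩⟩)
        omega
      · have := g p ((hsplit _ _).2 ⟨E.symm hpx, fun g => absurd g.2.2 hxk,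
          fun g => absurd rfl g.2.1⟩)
        omega
    rw [if_neg h1, if_neg h2]
  · have h1 : ∀ v, split E p k x v ↔ E x v := by
      intro v
      rw [hsplit]
      exact ⟨fun g => g.1, fun g => ⟨g, fun g' => absurd g'.1 hpx,
        fun g' => absurd (E.trans g'.1 (E.symm g)) hpx⟩⟩
    have h2 : cls n (split E p k) x = cls n E x := by
      ext v; rw [mem_cls, mem_cls, h1]
    have h3 : IsMin (split E p k) x ↔ IsMin E x :=
      ⟨fun g v hv => g v ((h1 v).2 hv), fun g v hv => g v ((h1 v).1 hv)⟩
    rw [h2]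
    simp only [h3]

/-- A nontrivial noncrossing relation has two elements `p < q` that are the two least elements of
their class. -/
theorem exists_two_least {E : Setoid ℕ} (hE : E ≠ ⊥) :
    ∃ p q, p < q ∧ E p q ∧ (∀ v, E p v → p ≤ v) ∧ ∀ v, E p v → v ≠ p → q ≤ v := by
  classical
  have : ∃ u v, E u v ∧ u ≠ v := by
    by_contra hcon
    push Not at hcon
    exact hE (le_antisymm (fun u v h => hcon u v h) bot_le)
  obtain ⟨u, v, huv, hne⟩ := this
  have hu : ∃ w, E u w := ⟨u, E.refl u⟩
  have hpu := Nat.find_spec hu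
  have hmin : ∀ w, E (Nat.find hu) w → Nat.find hu ≤ w := fun w hw =>
    Nat.find_min' hu (E.trans hpu hw)
  set p := Nat.find hu
  have hq : ∃ w, E p w ∧ w ≠ p := by
    by_cases e : u = p
    · exact ⟨v, E.trans (E.symm hpu) huv, fun h => hne (e.trans h.symm)⟩
    · exact ⟨u, E.symm hpu, e⟩
  obtain ⟨h1, h2⟩ := Nat.find_spec hq
  exact ⟨p, Nat.find hq, lt_of_le_of_ne (hmin _ h1) h2.symm, h1, hmin,
    fun w hw hw' => Nat.find_min' hq ⟨hw, hw'⟩⟩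

theorem classProd_bot (n : ℕ) : classProd n ⊥ = 1 := by
  classical
  refine Finset.prod_eq_one fun x hx => ?_
  split_ifs with h
  · have : cls n ⊥ x = {x} := by
      ext v
      rw [mem_cls, mem_singleton, ← mem_Icc]
      constructor
      · exact fun h => Eq.symm h.2
      · rintro rfl
        exact ⟨hx, rfl⟩
    rw [this]
    simp [signedCatalan]
  · rfl

/-- The Möbius function of a noncrossing relation is multiplicative over its classes. -/
theorem moebius_NC {n : ℕ} (E : NC n) : moebius (NC.bot n) E = classProd n E.1 := by
  classical
  let _ := Fintype.ofFinite (NC n)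
  induction E using WellFoundedLT.induction with
  | _ y ih =>
    by_cases hy : y = NC.bot n
    · subst hy
      rw [moebius_self]
      exact (classProd_bot n).symm
    have hy' : y.1 ≠ ⊥ := fun h => hy (Subtype.ext h)
    obtain ⟨p, q, hpq, hypq, hmin, hsec⟩ := exists_two_least hy'
    have hNC : ∀ x : NC n, x ≤ y → IsNC n (merge x.1 p q) := fun x hx =>
      x.2.merge y.2 hx hypq hpq fun v h1 h2 => by
        by_cases e : v = p
        · exact e ▸ x.1.refl p
        · exact absurd (hsec v h1 e) (not_le.2 h2)
    -- The closure operator; its value outside of the interval below `y` is irrelevant.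
    let c : NC n → NC n := fun x => if h : x ≤ y then ⟨merge x.1 p q, hNC x h⟩ else x
    have hc : ∀ x, x ≤ y → (c x).1 = merge x.1 p q := fun x hx => by simp [c, hx]
    have hfib := sum_moebius_fiber (o := NC.bot n) (y := y) NC.bot_le
      (K := {z | z ≤ y ∧ z.1 p q}) (c := c) (fun z hz => hz.1)
      (fun x hx => ⟨(hc x hx).le.trans (merge_le hx hypq), (hc x hx) ▸ merge_rel x.1 p q⟩)
      (fun x hx z hz => ⟨fun h => (hc x hx).le.trans (merge_le h hz.2),
        fun h => (le_merge x.1 p q).trans ((hc x hx).ge.trans h)⟩)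
      (fun h => hpq.ne h.2) y ⟨le_rfl, hypq⟩
    set T := (cls n y.1 p).erase p with hT
    obtain ⟨R, hR, hRk⟩ := classProd_split y.2 hpq hypq hsec hT
    let s : ℕ → NC n := fun k => ⟨split y.1 p k, y.2.split hmin⟩
    have hyy : c y = y := Subtype.ext ((hc y le_rfl).trans
      (le_antisymm (merge_le le_rfl hypq) (le_merge _ _ _)))
    have hT' : ∀ k ∈ T, y.1 p k ∧ k ≠ p ∧ q ≤ k := fun k hk => by
      rw [hT, mem_erase, mem_cls] at hk
      exact ⟨hk.2.2, hk.1, hsec k hk.2.2 hk.1⟩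
    have hsne : ∀ k ∈ T, ¬ (split y.1 p k) p q := fun k hk h =>
      ((split_apply.1 h).2.2 ⟨hypq, hpq.ne', (hT' k hk).2.2⟩).2.1 rfl
    have hinj : Set.InjOn s T := by
      have key : ∀ k ∈ T, ∀ k' ∈ T, s k = s k' → k ≤ k' := by
        intro k hk k' hk' e
        have h1 : split y.1 p k q k := split_apply.2
          ⟨y.1.trans (y.1.symm hypq) (hT' k hk).1,
            fun _ => ⟨(hT' k hk).1, (hT' k hk).2.1, le_rfl⟩,
            fun _ => ⟨hypq, hpq.ne', (hT' k hk).2.2⟩⟩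
        have h2 : split y.1 p k' q k := by
          rwa [show split y.1 p k' = split y.1 p k from (congrArg Subtype.val e).symm]
        exact ((split_apply.1 h2).2.1 ⟨hypq, hpq.ne', (hT' k' hk').2.2⟩).2.2
      exact fun k hk k' hk' e => le_antisymm (key k hk k' hk' e) (key k' hk' k hk e.symm)
    -- The fiber over `y`: if `x` already relates `p` and `q`, it is closed and equals `y`;
    -- otherwise `exists_eq_split` shows that it is one of the splits of `y`.
    have hset : (univ.filter fun x => x ≤ y ∧ c x = y) = insert y (T.image s) := by
      ext x
      simp only [mem_filter, mem_univ, true_and, mem_insert, mem_image]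
      constructor
      · rintro ⟨h1, h2⟩
        by_cases hx : x.1 p q
        · left
          rw [← h2]
          exact Subtype.ext ((le_antisymm (merge_le le_rfl hx) (le_merge _ _ _)).symm.trans
            (hc x h1).symm)
        · right
          obtain ⟨k, hk, e⟩ := exists_eq_split x.2 y.2 hpq hsec
            ((hc x h1).symm.trans (congrArg Subtype.val h2)) hx
          exact ⟨k, hk, Subtype.ext e.symm⟩
      · rintro (rfl | ⟨k, hk, rfl⟩)
        · exact ⟨le_rfl, hyy⟩
        · have : s k ≤ y := split_le y.1 p k
          exact ⟨this, Subtype.ext ((hc _ this).trans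
            (merge_split hypq hpq.ne' (hT' k hk).2.2))⟩
    have hyn : y ∉ T.image s := by
      intro h
      obtain ⟨k, hk, e⟩ := mem_image.1 h
      exact hsne k hk (by rw [show split y.1 p k = y.1 from congrArg Subtype.val e]; exact hypq)
    have hfib : ∑ x ∈ insert y (T.image s), moebius (NC.bot n) x = 0 := by
      rw [← hset]; convert hfib
    rw [sum_insert hyn, sum_image hinj] at hfib
    -- The splits lie strictly below `y`, so the induction hypothesis evaluates them. Summing over
    -- the rank of `k` in `T` gives the Catalan convolution.
    have hsum : ∑ k ∈ T, moebius (NC.bot n) (s k) = R * - signedCatalan (T.card + 1) := by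
      rw [← sum_signedCatalan _ (card_pos.2 ⟨q, by
          rw [hT, mem_erase, mem_cls]
          exact ⟨hpq.ne', y.2.1 q p (y.1.symm hypq) hpq.ne', hypq⟩⟩),
        ← sum_card_filter_lt T fun i => signedCatalan (T.card - i) * signedCatalan (i + 1),
        Finset.mul_sum]
      refine Finset.sum_congr rfl fun k hk => ?_
      rw [← hRk k hk]
      refine ih (s k) (lt_of_le_of_ne (split_le y.1 p k) fun e => hyn ?_)
      exact mem_image.2 ⟨k, hk, e⟩
    rw [hsum] at hfib
    rw [hR]
    linarith

/-- The greatest element has the single class [n], so only the factor at 1 remains. -/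
theorem moebius_NC_top {n : ℕ} (hn : 1 ≤ n) :
    moebius (NC.bot n) (NC.top n) = (-1) ^ (n - 1) * (catalan (n - 1) : ℤ) := by
  classical
  rw [moebius_NC, classProd, Finset.prod_eq_single 1]
  · have h1 : IsMin (NC.top n).1 1 := by
      rintro v (h | h)
      · exact h.le
      · exact h.2.1
    have h2 : cls n (NC.top n).1 1 = Icc 1 n := by
      ext v
      rw [mem_cls, mem_Icc]
      exact ⟨fun h => h.1, fun h => ⟨h, Or.inr ⟨⟨le_rfl, hn⟩, h⟩⟩⟩
    rw [if_pos h1, h2, Nat.card_Icc]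
    simp [signedCatalan]
  · intro x hx hx1
    rw [mem_Icc] at hx
    refine if_neg fun h => ?_
    have := h 1 (Or.inr ⟨hx, le_rfl, hn⟩)
    omega
  · intro h
    exact absurd (mem_Icc.2 ⟨le_rfl, hn⟩) h

/-! ### The Kreweras lattice as a lattice of equivalence relations -/

/-- Two numbers are related if they are equal or lie in the same block of `π`. -/
def NCCP.sameBlock {n : ℕ} (π : NCCP n) : Setoid ℕ where
  r u v := u = v ∨ ∃ B ∈ π.blocks, u ∈ B ∧ v ∈ B
  iseqv := by
    refine ⟨fun u => Or.inl rfl, ?_, ?_⟩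
    · rintro u v (h | ⟨B, hB, h⟩)
      · exact Or.inl h.symm
      · exact Or.inr ⟨B, hB, h.symm⟩
    · rintro u v w (rfl | ⟨B, hB, h⟩) (rfl | ⟨C, hC, g⟩)
      · exact Or.inl rfl
      · exact Or.inr ⟨C, hC, g⟩
      · exact Or.inr ⟨B, hB, h⟩
      · have := π.block_eq hB hC h.2 g.1
        subst this
        exact Or.inr ⟨B, hB, h.1, g.2⟩

theorem NCCP.mem_block {n : ℕ} (π : NCCP n) {B : List ℕ} (hB : B ∈ π.blocks) {u : ℕ} (h : u ∈ B) :
    1 ≤ u ∧ u ≤ n := by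
  have := π.perm.mem_iff.1 (List.mem_flatten.2 ⟨B, hB, h⟩)
  rw [List.mem_range'_1] at this
  omega

theorem NCCP.exists_block {n : ℕ} (π : NCCP n) {u : ℕ} (h : 1 ≤ u ∧ u ≤ n) :
    ∃ B ∈ π.blocks, u ∈ B := by
  apply List.mem_flatten.1
  rw [π.perm.mem_iff, List.mem_range'_1]
  omega

/-- The noncrossing relation of a noncrossing partition. -/
def NCP.toNC {n : ℕ} (π : NCP n) : NC n := ⟨π.toNCCP.sameBlock, by
  refine ⟨?_, ?_⟩
  · rintro u v (h | ⟨B, hB, h⟩) h'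
    · exact absurd h h'
    · exact π.toNCCP.mem_block hB h.1
  · rintro a b c d h1 h2 h3 (h | ⟨B, hB, h, h'⟩) (g | ⟨C, hC, g, g'⟩)
    · omega
    · omega
    · omega
    · by_cases e : B = C
      · subst e
        exact Or.inr ⟨B, hB, h, g⟩
      · exact (π.nonCrossing B hB C hC e a b c d h1 h2 h3 h h' g g').elim⟩

theorem NCP.toNC_le_iff {n : ℕ} {π π' : NCP n} : π.toNC ≤ π'.toNC ↔ π ≤ π' := by
  constructor
  · intro h B hB
    obtain ⟨x, hx⟩ := List.exists_mem_of_ne_nil _ (π.toNCCP.nonempty B hB)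
    obtain ⟨C, hC, hxC⟩ := π'.toNCCP.exists_block (π.toNCCP.mem_block hB hx)
    refine ⟨C, hC, fun y hy => ?_⟩
    have : π.toNC.1 x y := Or.inr ⟨B, hB, hx, hy⟩
    rcases h this with rfl | ⟨D, hD, g, g'⟩
    · exact hxC
    · rwa [π'.toNCCP.block_eq hC hD hxC g]
  · rintro h u v (rfl | ⟨B, hB, hu, hv⟩)
    · exact Or.inl rfl
    · obtain ⟨C, hC, hBC⟩ := h B hB
      exact Or.inr ⟨C, hC, hBC hu, hBC hv⟩

/-! ### Recovering a noncrossing partition from its relation -/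

theorem exists_isMin (E : Setoid ℕ) (u : ℕ) : ∃ x, IsMin E x ∧ E x u := by
  classical
  have hu : ∃ w, E u w := ⟨u, E.refl u⟩
  have h := Nat.find_spec hu
  exact ⟨Nat.find hu, fun w hw => Nat.find_min' hu (E.trans h hw), E.symm h⟩

theorem IsMin.eq {E : Setoid ℕ} {x y : ℕ} (hx : IsMin E x) (hy : IsMin E y) (h : E x y) : x = y :=
  le_antisymm (hx y h) (hy x (E.symm h))

open Classical in
/-- The blocks of the relation `E` on `[n]`, with decreasing least elements. -/
noncomputable def blocksOf (n : ℕ) (E : Setoid ℕ) : List (List ℕ) :=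
  ((List.range' 1 n).reverse.filter (IsMin E)).map fun x => (List.range' 1 n).filter (E x)

theorem mem_blocksOf {n : ℕ} {E : Setoid ℕ} {B : List ℕ} (h : B ∈ blocksOf n E) :
    ∃ x, IsMin E x ∧ x ∈ B ∧ (∀ v, v ∈ B ↔ (1 ≤ v ∧ v < 1 + n) ∧ E x v) ∧ B.Pairwise (· < ·) := by
  classical
  rw [blocksOf, List.mem_map] at h
  obtain ⟨x, hx, rfl⟩ := h
  simp only [List.mem_filter, List.mem_reverse, List.mem_range'_1, decide_eq_true_eq] at hx ⊢
  exact ⟨x, hx.2, ⟨hx.1, E.refl x⟩, fun v => Iff.rfl,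
    (List.pairwise_lt_range' (s := 1) (n := n)).filter _⟩

theorem pairwise_blocksOf (n : ℕ) (E : Setoid ℕ) :
    (blocksOf n E).Pairwise fun B C => ∃ c ∈ C, ∀ b ∈ B, c < b := by
  classical
  rw [blocksOf, List.pairwise_map]
  have h : ((List.range' 1 n).reverse.filter (IsMin E)).Pairwise (· > ·) :=
    (List.pairwise_reverse.2 (List.pairwise_lt_range' (s := 1) (n := n))).filter _
  refine h.imp_of_mem ?_
  intro x y hx hy hxy
  simp only [List.mem_filter, List.mem_reverse, List.mem_range'_1, decide_eq_true_eq] at hx hy ⊢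
  exact ⟨y, ⟨hy.1, E.refl y⟩, fun b hb => lt_of_lt_of_le hxy (hx.2 b hb.2)⟩

theorem blocksOf_eq {n : ℕ} {E : Setoid ℕ} {B C : List ℕ} (hB : B ∈ blocksOf n E)
    (hC : C ∈ blocksOf n E) {u v : ℕ} (hu : u ∈ B) (hv : v ∈ C) (h : E u v) : B = C := by
  obtain ⟨x, hx, hxB, h1, p1⟩ := mem_blocksOf hB
  obtain ⟨y, hy, hyC, h2, p2⟩ := mem_blocksOf hC
  have hxy : x = y := hx.eq hy (E.trans ((h1 u).1 hu).2 (E.trans h (E.symm ((h2 v).1 hv).2)))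
  subst hxy
  refine ((List.perm_ext_iff_of_nodup (p1.imp ne_of_lt) (p2.imp ne_of_lt)).2 fun w =>
    (h1 w).trans (h2 w).symm).eq_of_pairwise
      (fun a b _ _ h1 h2 => absurd h1 (not_lt.2 h2.le)) p1 p2

/-- The noncrossing partition of a noncrossing relation. -/
noncomputable def NC.toNCP {n : ℕ} (E : NC n) : NCP n where
  toNCCP :=
    { blocks := blocksOf n E.1
      perm := by
        refine (List.perm_ext_iff_of_nodup (List.nodup_flatten.2 ⟨?_, ?_⟩) List.nodup_range').2 ?_
        · intro B hB
          obtain ⟨x, -, -, -, h⟩ := mem_blocksOf hB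
          exact h.imp ne_of_lt
        · refine (pairwise_blocksOf n E.1).imp_of_mem ?_
          rintro B C hB hC ⟨c, hc, h⟩ u hu hu'
          have := blocksOf_eq hB hC hu hu' (E.1.refl u)
          subst this
          exact lt_irrefl _ (h c hc)
        · intro u
          rw [List.mem_flatten]
          constructor
          · rintro ⟨B, hB, hu⟩
            obtain ⟨x, -, -, h, -⟩ := mem_blocksOf hB
            exact List.mem_range'_1.2 ((h u).1 hu).1
          · intro hu
            classical
            obtain ⟨x, hx, hxu⟩ := exists_isMin E.1 u
            refine ⟨_, List.mem_map.2 ⟨x, ?_, rfl⟩, ?_⟩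
            · simp only [List.mem_filter, List.mem_reverse, decide_eq_true_eq]
              refine ⟨?_, hx⟩
              by_cases e : x = u
              · rwa [e]
              · have := E.2.1 x u hxu e
                rw [List.mem_range'_1]
                omega
            · simpa using ⟨List.mem_range'_1.1 hu, hxu⟩
      nonempty := by
        rintro B hB rfl
        obtain ⟨x, -, h, -⟩ := mem_blocksOf hB
        simp at h
      increasing := fun B hB => by
        obtain ⟨x, -, -, -, h⟩ := mem_blocksOf hB
        exact h
      descent := by
        refine List.Pairwise.isChain ((pairwise_blocksOf n E.1).imp_of_mem ?_)
        rintro B C hB hC ⟨c, hc, h⟩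
        obtain ⟨x, -, hx, -⟩ := mem_blocksOf hB
        exact ⟨x, hx, c, hc, h x hx⟩ }
  nonCrossing := by
    intro B hB C hC hne a b c d h1 h2 h3 ha hc hb hd
    obtain ⟨x, -, -, h, -⟩ := mem_blocksOf hB
    obtain ⟨y, -, -, g, -⟩ := mem_blocksOf hC
    exact hne (blocksOf_eq hB hC ha hb (E.2.2 a b c d h1 h2 h3
      (E.1.trans (E.1.symm ((h a).1 ha).2) ((h c).1 hc).2)
      (E.1.trans (E.1.symm ((g b).1 hb).2) ((g d).1 hd).2)))
  canonical := pairwise_blocksOf n E.1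

theorem NC.toNC_toNCP {n : ℕ} (E : NC n) : E.toNCP.toNC = E := by
  refine Subtype.ext (Setoid.ext fun u v => ?_)
  constructor
  · rintro (rfl | ⟨B, hB, hu, hv⟩)
    · exact E.1.refl u
    · obtain ⟨x, -, -, h, -⟩ := mem_blocksOf hB
      exact E.1.trans (E.1.symm ((h u).1 hu).2) ((h v).1 hv).2
  · intro h
    by_cases e : u = v
    · exact Or.inl e
    · obtain ⟨B, hB, hu⟩ := E.toNCP.toNCCP.exists_block (E.2.1 u v h e)
      refine Or.inr ⟨B, hB, hu, ?_⟩
      obtain ⟨x, -, -, g, -⟩ := mem_blocksOf hB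
      have := E.2.1 v u (E.1.symm h) (Ne.symm e)
      exact (g v).2 ⟨by omega, E.1.trans ((g u).1 hu).2 h⟩

/-- The Kreweras lattice is the lattice of noncrossing equivalence relations. -/
noncomputable def NCP.orderIso (n : ℕ) : NCP n ≃o NC n :=
  RelIso.ofSurjective (OrderEmbedding.ofMapLEIff NCP.toNC fun _ _ => NCP.toNC_le_iff)
    fun E => ⟨E.toNCP, E.toNC_toNCP⟩

theorem NCP.toNC_zero (n : ℕ) : (NCP.zero n).toNC = NC.bot n := by
  refine le_antisymm ?_ (NC.bot_le _)
  rintro u v (h | ⟨B, hB, hu, hv⟩)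
  · exact h
  · simp only [NCP.zero, NCCP.zero] at hB
    obtain ⟨i, -, rfl⟩ := List.mem_map.1 hB
    rw [List.mem_singleton] at hu hv
    exact hu.trans hv.symm

theorem NCP.toNC_one (n : ℕ) : (NCP.one n).toNC = NC.top n := by
  refine le_antisymm (NC.le_top _) ?_
  rintro u v (h | ⟨hu, hv⟩)
  · exact Or.inl h
  · simp only [Set.mem_ofPred_eq] at hu hv
    refine Or.inr ⟨List.range' 1 n, ?_, ?_, ?_⟩
    · simp only [NCP.one, NCCP.one]
      rw [if_neg (by omega)]
      simp
    · rw [List.mem_range'_1]; omega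
    · rw [List.mem_range'_1]; omega

theorem moebius_NCP {n : ℕ} (hn : 1 ≤ n) :
    moebius (NCP.zero n) (NCP.one n) = (-1) ^ (n - 1) * (catalan (n - 1) : ℤ) := by
  rw [← moebius_NC_top hn, ← NCP.toNC_zero, ← NCP.toNC_one]
  refine (moebius_orderIso (NCP.orderIso n) _ _ ?_).symm
  rw [← NCP.toNC_le_iff, NCP.toNC_zero]
  exact NC.bot_le _

/-! ### Right chains of a tree -/

/-- The right-extended sequence that starts at the root. -/
def rightSeq : BinaryTree ℕ → List ℕ
  | nil => []
  | node x _ r => x :: rightSeq r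

/-- Two labels lie on the same right-extended sequence, which does not start at the root. -/
def offRel : BinaryTree ℕ → ℕ → ℕ → Prop
  | nil, _, _ => False
  | node _ l r, u, v => (offRel l u v ∨ (u ∈ rightSeq l ∧ v ∈ rightSeq l)) ∨ offRel r u v

/-- Two labels lie on the same maximal right-extended sequence. -/
def chainRel (t : BinaryTree ℕ) (u v : ℕ) : Prop :=
  offRel t u v ∨ (u ∈ rightSeq t ∧ v ∈ rightSeq t)

/-- The chain of the root is kept apart because it is the only one that changes when a tree becomes
a right subtree: the parent prolongs it. A left subtree passes on all of its chains unchanged. -/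
theorem offRel_node {x : ℕ} {l r : BinaryTree ℕ} {u v : ℕ} :
    offRel (node x l r) u v ↔ chainRel l u v ∨ offRel r u v := Iff.rfl

theorem chainRel_node {x : ℕ} {l r : BinaryTree ℕ} {u v : ℕ} :
    chainRel (node x l r) u v ↔ chainRel l u v ∨ offRel r u v ∨
      ((u = x ∨ u ∈ rightSeq r) ∧ (v = x ∨ v ∈ rightSeq r)) := by
  simp only [chainRel, offRel, rightSeq, List.mem_cons]
  tauto

theorem chainRel_node' {x : ℕ} {l r : BinaryTree ℕ} {u v : ℕ} :
    chainRel (node x l r) u v ↔ chainRel l u v ∨ chainRel r u v ∨ (u = x ∧ v = x) ∨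
      (u = x ∧ v ∈ rightSeq r) ∨ (v = x ∧ u ∈ rightSeq r) := by
  rw [chainRel_node]
  simp only [chainRel]
  tauto

theorem mem_word_node {x : ℕ} {l r : BinaryTree ℕ} {u : ℕ} :
    u ∈ word (node x l r) ↔ u ∈ word l ∨ u = x ∨ u ∈ word r := by
  simp [word]

theorem rightSeq_subset {t : BinaryTree ℕ} {u : ℕ} (h : u ∈ rightSeq t) : u ∈ word t := by
  induction t with
  | nil => simp [rightSeq] at h
  | node x l r _ ihr =>
    rw [mem_word_node]
    rcases List.mem_cons.1 h with h | h
    · exact Or.inr (Or.inl h)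
    · exact Or.inr (Or.inr (ihr h))

theorem offRel_symm {t : BinaryTree ℕ} {u v : ℕ} (h : offRel t u v) : offRel t v u := by
  induction t with
  | nil => exact h
  | node x l r ihl ihr =>
    rcases h with (h | h) | h
    · exact Or.inl (Or.inl (ihl h))
    · exact Or.inl (Or.inr h.symm)
    · exact Or.inr (ihr h)

theorem chainRel_symm {t : BinaryTree ℕ} {u v : ℕ} (h : chainRel t u v) : chainRel t v u :=
  h.imp offRel_symm And.symm

theorem mem_word_of_offRel {t : BinaryTree ℕ} {u v : ℕ} (h : offRel t u v) : u ∈ word t := by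
  induction t with
  | nil => exact h.elim
  | node x l r ihl ihr =>
    rw [mem_word_node]
    rcases h with (h | h) | h
    · exact Or.inl (ihl h)
    · exact Or.inl (rightSeq_subset h.1)
    · exact Or.inr (Or.inr (ihr h))

theorem mem_word_of_chainRel {t : BinaryTree ℕ} {u v : ℕ} (h : chainRel t u v) : u ∈ word t :=
  h.elim mem_word_of_offRel fun h => rightSeq_subset h.1

theorem chainRel_refl {t : BinaryTree ℕ} {u : ℕ} (h : u ∈ word t) : chainRel t u u := by
  induction t with
  | nil => simp [word] at h
  | node x l r ihl ihr =>
    rw [chainRel_node']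
    rcases mem_word_node.1 h with h | h | h
    · exact Or.inl (ihl h)
    · exact Or.inr (Or.inr (Or.inl ⟨h, h⟩))
    · exact Or.inr (Or.inl (ihr h))

theorem mem_word_iff_chainRel {t : BinaryTree ℕ} {u : ℕ} : u ∈ word t ↔ chainRel t u u :=
  ⟨chainRel_refl, mem_word_of_chainRel⟩

theorem nodup_node {x : ℕ} {l r : BinaryTree ℕ} (h : (word (node x l r)).Nodup) :
    (word l).Nodup ∧ (word r).Nodup ∧ x ∉ word l ∧ x ∉ word r ∧
      ∀ y ∈ word l, y ∉ word r := by
  simp only [word, List.nodup_append, List.nodup_cons, List.mem_cons] at h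
  obtain ⟨n1, ⟨n2, n3⟩, n4⟩ := h
  exact ⟨n1, n3, fun h => n4 x h x (Or.inl rfl) rfl, n2, fun y hy h => n4 y hy y (Or.inr h) rfl⟩

/-- With distinct labels the root chain is disjoint from all other chains. This is what makes
`chainRel` transitive. -/
theorem not_offRel {t : BinaryTree ℕ} (hn : (word t).Nodup) {u v : ℕ} (hu : u ∈ rightSeq t) :
    ¬ offRel t u v := by
  induction t with
  | nil => exact id
  | node x l r ihl ihr =>
    obtain ⟨n1, n2, n3, n4, n5⟩ := nodup_node hn
    rw [offRel_node]
    rintro (h | h)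
    · have := mem_word_of_chainRel h
      rcases List.mem_cons.1 hu with rfl | hu
      · exact n3 this
      · exact n5 u this (rightSeq_subset hu)
    · rcases List.mem_cons.1 hu with rfl | hu
      · exact n4 (mem_word_of_offRel h)
      · exact ihr n2 hu h

theorem chainRel_iff_of_mem_rightSeq {t : BinaryTree ℕ} (hn : (word t).Nodup) {u v : ℕ}
    (hu : u ∈ rightSeq t) : chainRel t u v ↔ v ∈ rightSeq t := by
  simp [chainRel, not_offRel hn hu, hu]

theorem offRel_trans {t : BinaryTree ℕ} (hn : (word t).Nodup) {u v w : ℕ} (h : offRel t u v)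
    (g : offRel t v w) : offRel t u w := by
  induction t with
  | nil => exact h
  | node x l r ihl ihr =>
    obtain ⟨n1, n2, n3, n4, n5⟩ := nodup_node hn
    rcases h with h | h <;> rcases g with g | g
    · rcases h with h | h <;> rcases g with g | g
      · exact Or.inl (Or.inl (ihl n1 h g))
      · exact (not_offRel n1 g.1 (offRel_symm h)).elim
      · exact (not_offRel n1 h.2 g).elim
      · exact Or.inl (Or.inr ⟨h.1, g.2⟩)
    · exact (n5 v (mem_word_of_chainRel (chainRel_symm h)) (mem_word_of_offRel g)).elim
    · exact (n5 v (mem_word_of_chainRel g) (mem_word_of_offRel (offRel_symm h))).elim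
    · exact Or.inr (ihr n2 h g)

theorem chainRel_trans {t : BinaryTree ℕ} (hn : (word t).Nodup) {u v w : ℕ} (h : chainRel t u v)
    (g : chainRel t v w) : chainRel t u w := by
  rcases h with h | h <;> rcases g with g | g
  · exact Or.inl (offRel_trans hn h g)
  · exact (not_offRel hn g.1 (offRel_symm h)).elim
  · exact (not_offRel hn h.2 g).elim
  · exact Or.inr ⟨h.1, g.2⟩

theorem chainRel_node_left {x : ℕ} {l r : BinaryTree ℕ} (hn : (word (node x l r)).Nodup)
    {u v : ℕ} (hu : u ∈ word l) : chainRel (node x l r) u v ↔ chainRel l u v := by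
  obtain ⟨n1, n2, n3, n4, n5⟩ := nodup_node hn
  rw [chainRel_node']
  constructor
  · rintro (h | h | h | h | h)
    · exact h
    · exact (n5 u hu (mem_word_of_chainRel h)).elim
    · exact (n3 (h.1 ▸ hu)).elim
    · exact (n3 (h.1 ▸ hu)).elim
    · exact (n5 u hu (rightSeq_subset h.2)).elim
  · exact Or.inl

theorem chainRel_node_right {x : ℕ} {l r : BinaryTree ℕ} (hn : (word (node x l r)).Nodup)
    {u v : ℕ} (hu : u ∈ word r) (hv : v ∈ word r) :
    chainRel (node x l r) u v ↔ chainRel r u v := by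
  obtain ⟨n1, n2, n3, n4, n5⟩ := nodup_node hn
  rw [chainRel_node']
  constructor
  · rintro (h | h | h | h | h)
    · exact (n5 u (mem_word_of_chainRel h) hu).elim
    · exact h
    · exact (n4 (h.1 ▸ hu)).elim
    · exact (n4 (h.1 ▸ hu)).elim
    · exact (n4 (h.1 ▸ hv)).elim
  · exact fun h => Or.inr (Or.inl h)

/-! ### The effect of a rotation on the right chains -/

/-- Every right chain lies inside one node of the left sequence together with its right subtree, so
distributing these nodes over two trees cuts no chain. -/
theorem chainRel_filterLeft {p : ℕ → Bool} {t : BinaryTree ℕ} {u v : ℕ} :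
    chainRel (filterLeft p t) u v ∨ chainRel (filterLeft (fun y => !p y) t) u v ↔
      chainRel t u v := by
  induction t with
  | nil => simp [filterLeft]
  | node x l r ihl _ =>
    cases h : p x <;> simp only [filterLeft, h, chainRel_node, ← ihl, Bool.not_true,
      Bool.not_false, if_true, if_false, Bool.false_eq_true] <;> tauto

theorem word_filterLeft_sublist (p : ℕ → Bool) (t : BinaryTree ℕ) :
    (word (filterLeft p t)).Sublist (word t) := by
  induction t with
  | nil => simp [filterLeft]
  | node x l r ihl _ =>
    rw [filterLeft]
    split_ifs
    · exact ihl.append (List.Sublist.refl _)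
    · exact ihl.trans (List.sublist_append_left _ _)

theorem word_prune_sublist (b : ℕ) (S : Finset ℕ) (t : BinaryTree ℕ) :
    (word (prune b S t)).Sublist (word t) := by
  induction t with
  | nil => simp [prune]
  | node x l r ihl ihr =>
    rw [prune]
    split_ifs
    · exact word_filterLeft_sublist _ _
    · exact ihl.append (ihr.cons_cons x)

/-- The chains of t are distributed over T₂ and T₁. As `b` is a left child, the root chain does not
pass through it and remains intact in T₂. -/
theorem prune_chainRel {b : ℕ} {S : Finset ℕ} {t : BinaryTree ℕ} (hn : (word t).Nodup)
    (h : IsLeftChild b t) :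
    rightSeq (prune b S t) = rightSeq t ∧
      ∀ u v, offRel (prune b S t) u v ∨ chainRel (extract b S t) u v ↔ offRel t u v := by
  induction t with
  | nil =>
    obtain ⟨x, l, r, r', h⟩ := h
    simp [IsSubtree] at h
  | node x l r ihl ihr =>
    obtain ⟨x0, l0, r0, r0', h⟩ := h
    obtain ⟨n1, n2, n3, n4, n5⟩ := nodup_node hn
    rcases h with h | h | h
    · injection h with e1 e2 e3
      subst e1 e2 e3
      have hx : x0 ≠ b := by rintro rfl; exact n3 (by simp [word])
      have hr : b ∉ word r0' := n5 b (by simp [word])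
      have e : prune b S (node x0 (node b l0 r0) r0') =
          node x0 (filterLeft (fun y => !decide (y ∈ insert b S)) (node b l0 r0)) r0' := by
        rw [prune, if_neg hx, prune_of_notMem hr, prune, if_pos rfl]
        simp
      have e' : extract b S (node x0 (node b l0 r0) r0') =
          filterLeft (fun y => decide (y ∈ insert b S)) (node b l0 r0) := by
        rw [extract, subtreeAt, if_neg hx, if_pos (by simp [word]), subtreeAt, if_pos rfl]
      refine ⟨by rw [e]; rfl, fun u v => ?_⟩
      rw [e, e', offRel_node, offRel_node,
        ← chainRel_filterLeft (p := fun y => decide (y ∈ insert b S)) (t := node b l0 r0)]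
      tauto
    · have hb : b ∈ word l := mem_word_of_isSubtree h (by simp [word])
      have hx : x ≠ b := fun e => n3 (e ▸ hb)
      obtain ⟨h1, h2⟩ := ihl n1 ⟨x0, l0, r0, r0', h⟩
      rw [extract] at h2
      rw [prune, if_neg hx, prune_of_notMem (n5 b hb), extract, subtreeAt, if_neg hx, if_pos hb]
      refine ⟨rfl, fun u v => ?_⟩
      rw [offRel_node, offRel_node, chainRel.eq_1 (prune b S l), chainRel.eq_1 l, h1, ← h2]
      tauto
    · have hb : b ∈ word r := mem_word_of_isSubtree h (by simp [word])
      have hx : x ≠ b := fun e => n4 (e ▸ hb)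
      have hl : b ∉ word l := fun hh => n5 b hh hb
      obtain ⟨h1, h2⟩ := ihr n2 ⟨x0, l0, r0, r0', h⟩
      rw [extract] at h2
      rw [prune, if_neg hx, prune_of_notMem hl, extract, subtreeAt, if_neg hx, if_neg hl]
      refine ⟨by rw [rightSeq, h1, rightSeq], fun u v => ?_⟩
      rw [offRel_node, offRel_node, ← h2]
      tauto

theorem mem_rightSeq_mergeRight {s t : BinaryTree ℕ} {u : ℕ} :
    u ∈ rightSeq (mergeRight s t) ↔ u ∈ rightSeq s ∨ u ∈ rightSeq t := by
  induction s, t using mergeRight.induct with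
  | case1 t => simp [mergeRight, rightSeq]
  | case2 x l r => simp [mergeRight, rightSeq]
  | case3 x l r x' l' r' h ih =>
    rw [mergeRight, if_pos h]
    simp only [rightSeq, List.mem_cons] at ih ⊢
    rw [ih]; tauto
  | case4 x l r x' l' r' h ih =>
    rw [mergeRight, if_neg h]
    simp only [rightSeq, List.mem_cons] at ih ⊢
    rw [ih]; tauto

/-- The nodes on the merged root chain keep their left subtrees, which contain all the other chains.
-/
theorem offRel_mergeRight {s t : BinaryTree ℕ} {u v : ℕ} :
    offRel (mergeRight s t) u v ↔ offRel s u v ∨ offRel t u v := by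
  induction s, t using mergeRight.induct with
  | case1 t => simp [mergeRight, offRel]
  | case2 x l r => simp [mergeRight, offRel]
  | case3 x l r x' l' r' h ih =>
    rw [mergeRight, if_pos h]
    simp only [offRel_node] at ih ⊢
    rw [ih]; tauto
  | case4 x l r x' l' r' h ih =>
    rw [mergeRight, if_neg h]
    simp only [offRel_node] at ih ⊢
    rw [ih]; tauto

theorem attach_of_mem_rightSeq {a : ℕ} {s t : BinaryTree ℕ} (hn : (word t).Nodup)
    (ha : a ∈ rightSeq t) :
    (∀ u, u ∈ rightSeq (attach a s t) ↔ u ∈ rightSeq t ∨ u ∈ rightSeq s) ∧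
      ∀ u v, offRel (attach a s t) u v ↔ offRel t u v ∨ offRel s u v := by
  induction t with
  | nil => simp [rightSeq] at ha
  | node x l r _ ihr =>
    obtain ⟨n1, n2, n3, n4, n5⟩ := nodup_node hn
    rw [attach]
    split_ifs with e
    · simp only [rightSeq, List.mem_cons, offRel_node, mem_rightSeq_mergeRight, offRel_mergeRight]
      exact ⟨fun u => by tauto, fun u v => by tauto⟩
    · have ha' : a ∈ rightSeq r := (List.mem_cons.1 ha).resolve_left (Ne.symm e)
      obtain ⟨h1, h2⟩ := ihr n2 ha'
      rw [attach_of_notMem (t := l) (fun h => n5 a h (rightSeq_subset ha'))]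
      simp only [rightSeq, List.mem_cons, offRel_node, h1, h2]
      exact ⟨fun u => by tauto, fun u v => by tauto⟩

theorem attach_of_notMem_rightSeq {a : ℕ} {s t : BinaryTree ℕ} (hn : (word t).Nodup)
    (ha : a ∈ word t) (ha' : a ∉ rightSeq t) :
    rightSeq (attach a s t) = rightSeq t ∧
      ∀ u v, offRel (attach a s t) u v ↔ offRel t u v ∨ offRel s u v ∨
        ((offRel t a u ∨ u ∈ rightSeq s) ∧ (offRel t a v ∨ v ∈ rightSeq s)) := by
  induction t with
  | nil => simp [word] at ha
  | node x l r ihl ihr =>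
    obtain ⟨n1, n2, n3, n4, n5⟩ := nodup_node hn
    simp only [rightSeq, List.mem_cons, not_or] at ha'
    rw [attach, if_neg (Ne.symm ha'.1)]
    rcases mem_word_node.1 ha with h | h | h
    · rw [attach_of_notMem (t := r) (n5 a h)]
      refine ⟨rfl, fun u v => ?_⟩
      have nr : ∀ w, ¬ offRel r a w := fun w hw => n5 a h (mem_word_of_offRel hw)
      by_cases hl : a ∈ rightSeq l
      · obtain ⟨h1, h2⟩ := attach_of_mem_rightSeq (s := s) n1 hl
        have nl : ∀ w, ¬ offRel l a w := fun w => not_offRel n1 hl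
        simp only [offRel_node, chainRel, h1, h2, nr, nl, hl, true_and, or_false, false_or]
        grind
      · obtain ⟨h1, h2⟩ := ihl n1 h hl
        simp only [offRel_node, chainRel, h1, h2, nr, hl, false_and, or_false]
        grind
    · exact absurd h ha'.1
    · have hl : a ∉ word l := fun hh => n5 a hh h
      have nl : ∀ w, ¬ chainRel l a w := fun w hw => hl (mem_word_of_chainRel hw)
      obtain ⟨h1, h2⟩ := ihr n2 h ha'.2
      rw [attach_of_notMem hl]
      refine ⟨by rw [rightSeq, h1, rightSeq], fun u v => ?_⟩
      simp only [offRel_node, h2, nl, false_or]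
      grind

/-- The root chain of `s` joins the chain of `a`; nothing else changes. The proof distinguishes
whether `a` is on the root chain of `t`, since only then does the root chain itself grow. -/
theorem chainRel_attach {a : ℕ} {s t : BinaryTree ℕ} (hn : (word t).Nodup) (ha : a ∈ word t)
    {u v : ℕ} :
    chainRel (attach a s t) u v ↔ chainRel t u v ∨ offRel s u v ∨
      ((chainRel t a u ∨ u ∈ rightSeq s) ∧ (chainRel t a v ∨ v ∈ rightSeq s)) := by
  by_cases h : a ∈ rightSeq t
  · obtain ⟨h1, h2⟩ := attach_of_mem_rightSeq (s := s) hn h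
    have nl : ∀ w, ¬ offRel t a w := fun w => not_offRel hn h
    simp only [chainRel, h1, h2, nl, h, true_and, false_or]
    grind
  · obtain ⟨h1, h2⟩ := attach_of_notMem_rightSeq (s := s) hn ha h
    simp only [chainRel, h1, h2, h, false_and, or_false]
    grind

theorem subtreeAt_root {b : ℕ} {t : BinaryTree ℕ} (h : b ∈ word t) :
    ∃ l r, subtreeAt b t = node b l r := by
  induction t with
  | nil => simp [word] at h
  | node x l r ihl ihr =>
    rw [subtreeAt]
    split_ifs with h1 h2
    · exact ⟨l, r, by rw [h1]⟩
    · exact ihl h2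
    · exact ihr (((mem_word_node.1 h).resolve_left h2).resolve_left (Ne.symm h1))

/-- The right chain of a left child starts at that child, so it is visible inside the subtree below
`b`. -/
theorem chainRel_of_isLeftChild {b : ℕ} {t : BinaryTree ℕ} (hn : (word t).Nodup)
    (h : IsLeftChild b t) {v : ℕ} : chainRel t b v ↔ v ∈ rightSeq (subtreeAt b t) := by
  induction t with
  | nil =>
    obtain ⟨x, l, r, r', h⟩ := h
    simp [IsSubtree] at h
  | node x l r ihl ihr =>
    obtain ⟨x0, l0, r0, r0', h⟩ := h
    obtain ⟨n1, n2, n3, n4, n5⟩ := nodup_node hn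
    rcases h with h | h | h
    · injection h with e1 e2 e3
      subst e1 e2 e3
      have hx : x0 ≠ b := by rintro rfl; exact n3 (by simp [word])
      rw [chainRel_node_left hn (by simp [word]), subtreeAt, if_neg hx, if_pos (by simp [word]),
        subtreeAt, if_pos rfl, chainRel_iff_of_mem_rightSeq n1 (by simp [rightSeq])]
    · have hb : b ∈ word l := mem_word_of_isSubtree h (by simp [word])
      have hx : x ≠ b := fun e => n3 (e ▸ hb)
      rw [chainRel_node_left hn hb, subtreeAt, if_neg hx, if_pos hb]
      exact ihl n1 ⟨x0, l0, r0, r0', h⟩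
    · have hb : b ∈ word r := mem_word_of_isSubtree h (by simp [word])
      have hx : x ≠ b := fun e => n4 (e ▸ hb)
      have hl : b ∉ word l := fun hh => n5 b hh hb
      have hlc : IsLeftChild b r := ⟨x0, l0, r0, r0', h⟩
      -- The chains of T₁ are chains off the root, by `prune_chainRel` with empty S, and `b` lies on
      -- one of them.
      have hbr : b ∉ rightSeq r := fun hh => by
        obtain ⟨h1, h2⟩ := prune_chainRel (S := ∅) n2 hlc
        exact not_offRel n2 hh ((h2 b b).1 (Or.inr (chainRel_refl (mem_word_extract hb))))
      rw [subtreeAt, if_neg hx, if_neg hl, ← ihr n2 hlc]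
      rw [chainRel_node']
      constructor
      · rintro (h | h | h | h | h)
        · exact (hl (mem_word_of_chainRel h)).elim
        · exact h
        · exact (hx h.1.symm).elim
        · exact (hx h.1.symm).elim
        · exact (hbr h.2).elim
      · exact fun h => Or.inr (Or.inl h)

theorem le_of_mem_subtreeAt {b : ℕ} {t : BinaryTree ℕ} (hi : Increasing t) {w : ℕ}
    (hb : b ∈ word t) (h : w ∈ word (subtreeAt b t)) : b ≤ w ∧ w ∈ word t := by
  induction t with
  | nil => simp [word] at hb
  | node x l r ihl ihr =>
    rw [subtreeAt] at h
    obtain ⟨i1, i2, i3, i4⟩ := hi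
    split_ifs at h with h1 h2
    · subst h1
      refine ⟨?_, h⟩
      rcases mem_word_node.1 h with h | h | h
      · exact (i1 w h).le
      · exact h.ge
      · exact (i2 w h).le
    · have := ihl i3 h2 h
      exact ⟨this.1, mem_word_node.2 (Or.inl this.2)⟩
    · have := ihr i4 (((mem_word_node.1 hb).resolve_left h2).resolve_left (Ne.symm h1)) h
      exact ⟨this.1, mem_word_node.2 (Or.inr (Or.inr this.2))⟩

theorem InLeftSet.mem {t : BinaryTree ℕ} {a b : ℕ} (h : InLeftSet t b a) :
    a ∈ word t ∧ b ∈ word t := by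
  obtain ⟨l, r, h, hb⟩ := h
  exact ⟨mem_word_of_isSubtree h (by simp [word]), mem_word_of_isSubtree h (by simp [word, hb])⟩

theorem increasing_of_isSubtree {s t : BinaryTree ℕ} (h : IsSubtree s t) (hi : Increasing t) :
    Increasing s := by
  induction t with
  | nil => simp only [IsSubtree] at h; rwa [h]
  | node x l r ihl ihr =>
    rcases h with h | h | h
    · rwa [h]
    · exact ihl h hi.2.2.1
    · exact ihr h hi.2.2.2

theorem InLeftSet.lt {t : BinaryTree ℕ} {a b : ℕ} (hi : Increasing t) (h : InLeftSet t b a) :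
    a < b := by
  obtain ⟨l, r, h, hb⟩ := h
  exact (increasing_of_isSubtree h hi).1 b hb

/-- A rotation merges the right chain of `a` and the right chain of `b`. -/
theorem IsRotation.chainRel_iff {t t' : BinaryTree ℕ} {a b : ℕ} (hn : (word t).Nodup)
    (hi : Increasing t) (h : IsRotation t t' b a) {u v : ℕ} :
    chainRel t' u v ↔ chainRel t u v ∨
      ((chainRel t a u ∨ chainRel t b u) ∧ (chainRel t a v ∨ chainRel t b v)) := by
  obtain ⟨h1, ⟨h2, -⟩, S, -, rfl⟩ := h
  have hab := h2.lt hi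
  have hb := h2.mem.2
  have hn' : (word (prune b S t)).Nodup := hn.sublist (word_prune_sublist b S t)
  obtain ⟨p1, p2⟩ := prune_chainRel (S := S) hn h1
  have p3 : ∀ u v, chainRel t u v ↔ chainRel (prune b S t) u v ∨ chainRel (extract b S t) u v := by
    intro u v
    simp only [chainRel.eq_1 t, chainRel.eq_1 (prune b S t), p1, ← p2]
    tauto
  obtain ⟨l, r, e⟩ := subtreeAt_root hb
  have p4 : rightSeq (extract b S t) = rightSeq (subtreeAt b t) := by
    rw [extract, e, filterLeft, if_pos (by simp)]
    rfl
  -- All labels of T₁ are at least `b`, hence above `a`.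
  have p5 : ∀ w, ¬ chainRel (extract b S t) a w := fun w hw => by
    have := (word_filterLeft_sublist _ _).subset (mem_word_of_chainRel hw)
    have := (le_of_mem_subtreeAt hi hb this).1
    omega
  rw [chainRel_attach hn' (mem_word_prune hn h2), p4]
  simp only [chainRel_of_isLeftChild hn h1, p3, p5]
  rw [chainRel.eq_1 (extract b S t), p4]
  tauto

/-! ### Trees labeled in preorder -/

/-- The labels increase in preorder: root, left subtree, right subtree. -/
def Preorderly : BinaryTree ℕ → Prop
  | nil => True
  | node x l r => (∀ y ∈ word l, x < y) ∧ (∀ z ∈ word r, x < z) ∧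
      (∀ y ∈ word l, ∀ z ∈ word r, y < z) ∧ Preorderly l ∧ Preorderly r

theorem Preorderly.increasing {t : BinaryTree ℕ} (h : Preorderly t) : Increasing t := by
  induction t with
  | nil => trivial
  | node x l r ihl ihr => exact ⟨h.1, h.2.1, ihl h.2.2.2.1, ihr h.2.2.2.2⟩

theorem Preorderly.nodup {t : BinaryTree ℕ} (h : Preorderly t) : (word t).Nodup := by
  induction t with
  | nil => simp [word]
  | node x l r ihl ihr =>
    obtain ⟨h1, h2, h3, h4, h5⟩ := h
    simp only [word, List.nodup_append, List.nodup_cons, List.mem_cons]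
    refine ⟨ihl h4, ⟨fun h => lt_irrefl _ (h2 x h), ihr h5⟩, ?_⟩
    rintro y hy z (rfl | hz)
    · exact (h1 y hy).ne'
    · exact (h3 y hy z hz).ne

theorem Preorderly.root_le {x : ℕ} {l r : BinaryTree ℕ} (h : Preorderly (node x l r)) {w : ℕ}
    (hw : w ∈ word (node x l r)) : x ≤ w := by
  rcases mem_word_node.1 hw with g | g | g
  · exact (h.1 w g).le
  · exact g.ge
  · exact (h.2.1 w g).le

/-- Labels of a left subtree precede those of the right subtree, and a chain meeting the left
subtree stays inside it. So a crossing is either inside one subtree or involves the root chain,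
which jumps over the left subtree as a whole. -/
theorem Preorderly.noncrossing {t : BinaryTree ℕ} (h : Preorderly t) {a b c d : ℕ} (hab : a < b)
    (hbc : b < c) (hcd : c < d) (hac : chainRel t a c) (hbd : chainRel t b d) :
    chainRel t a b := by
  induction t generalizing a with
  | nil => exact hac.elim (fun h => h.elim) fun h => by simp [rightSeq] at h
  | node x l r ihl ihr =>
    have hn := h.nodup
    have hx : ∀ w, w ∈ word (node x l r) → x ≤ w := fun w => h.root_le
    have hwa := mem_word_of_chainRel hac
    have hwb := mem_word_of_chainRel hbd
    have hwc := mem_word_of_chainRel (chainRel_symm hac)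
    have hwd := mem_word_of_chainRel (chainRel_symm hbd)
    obtain ⟨h1, h2, h3, h4, h5⟩ := h
    have hxa := hx a hwa
    have hbl : c ∈ word l → b ∈ word l := fun hc => by
      rcases mem_word_node.1 hwb with g | g | g
      · exact g
      · omega
      · have := h3 c hc b g; omega
    have hbr : a ∈ word r → b ∈ word r := fun ha => by
      rcases mem_word_node.1 hwb with g | g | g
      · have := h3 b g a ha; omega
      · omega
      · exact g
    have hdr : b ∈ word r → d ∈ word r := fun hb => by
      rcases mem_word_node.1 hwd with g | g | g
      · have := h3 d g b hb; omega
      · omega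
      · exact g
    rcases chainRel_node'.1 hac with g | g | g | g | g
    · have hb := hbl (mem_word_of_chainRel (chainRel_symm g))
      rw [chainRel_node_left hn hb] at hbd
      exact chainRel_node'.2 (Or.inl (ihl h4 hab g hbd))
    · have hb := hbr (mem_word_of_chainRel g)
      rw [chainRel_node_right hn hb (hdr hb)] at hbd
      exact chainRel_node'.2 (Or.inr (Or.inl (ihr h5 hab g hbd)))
    · omega
    · obtain ⟨rfl, hc⟩ := g
      have hb : b ∈ word r := by
        rcases mem_word_node.1 hwb with g | g | g
        · rw [chainRel_node_left hn g] at hbd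
          have := h3 d (mem_word_of_chainRel (chainRel_symm hbd)) c (rightSeq_subset hc)
          omega
        · omega
        · exact g
      rw [chainRel_node_right hn hb (hdr hb)] at hbd
      refine chainRel_node'.2 (Or.inr (Or.inr (Or.inr (Or.inl ⟨rfl, ?_⟩))))
      -- Here `a` is the root. The next node `y` of its chain is the least label of the right
      -- subtree, so `y ≤ b`, and `y` replaces `a` in the induction hypothesis.
      cases r with
      | nil => simp [word] at hb
      | node y l' r' =>
        have hy : y ∈ rightSeq (node y l' r') := by simp [rightSeq]
        rcases (h5.root_le hb).eq_or_lt with e | e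
        · exact e ▸ hy
        · exact (chainRel_iff_of_mem_rightSeq h5.nodup hy).1
            (ihr h5 e (Or.inr ⟨hy, hc⟩) hbd)
    · omega

theorem chainRel_root {x : ℕ} {l r : BinaryTree ℕ} (hn : (word (node x l r)).Nodup) {v : ℕ} :
    chainRel (node x l r) x v ↔ v = x ∨ v ∈ rightSeq r := by
  rw [chainRel_iff_of_mem_rightSeq hn (by simp [rightSeq])]
  simp [rightSeq]

/-- A tree that is labeled in preorder is determined by its right chains. -/
theorem Preorderly.ext {t t' : BinaryTree ℕ} (h : Preorderly t) (h' : Preorderly t')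
    (e : ∀ u v, chainRel t u v ↔ chainRel t' u v) : t = t' := by
  have hw : ∀ {t t' : BinaryTree ℕ}, (∀ u v, chainRel t u v ↔ chainRel t' u v) → ∀ u,
      u ∈ word t → u ∈ word t' := fun e u hu =>
    mem_word_iff_chainRel.2 ((e u u).1 (mem_word_iff_chainRel.1 hu))
  induction t generalizing t' with
  | nil =>
    cases t' with
    | nil => rfl
    | node x' l' r' =>
      have := hw (fun u v => (e u v).symm) x' (by simp [word])
      simp [word] at this
  | node x l r ihl ihr =>
    cases t' with
    | nil =>
      have := hw e x (by simp [word])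
      simp [word] at this
    | node x' l' r' =>
      have hx : x = x' := le_antisymm
        (h.root_le (hw (fun u v => (e u v).symm) x' (by simp [word])))
        (h'.root_le (hw e x (by simp [word])))
      subst hx
      have n := h.nodup
      have n' := h'.nodup
      -- The element after `x` on the root chain is the least label of the right subtree. Hence the
      -- root chain, which both trees share, tells where the left subtree ends.
      have aux : ∀ {l r l' r' : BinaryTree ℕ}, Preorderly (node x l r) →
          Preorderly (node x l' r') →
          (∀ u v, chainRel (node x l r) u v ↔ chainRel (node x l' r') u v) →
          ∀ u, u ∈ word l → u ∈ word l' := by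
        intro l r l' r' h h' e u hu
        have hu' := hw e u (mem_word_node.2 (Or.inl hu))
        rcases mem_word_node.1 hu' with g | rfl | g
        · exact g
        · exact absurd (h.1 u hu) (lt_irrefl _)
        · exfalso
          cases r' with
          | nil => simp [word] at g
          | node y p q =>
            have h1 : chainRel (node x l' (node y p q)) x y :=
              (chainRel_root h'.nodup).2 (Or.inr (by simp [rightSeq]))
            have h2 := h'.2.1 y (by simp [word])
            have h3 := h'.2.2.2.2.root_le g
            rcases (chainRel_root h.nodup).1 ((e _ _).2 h1) with h4 | h4
            · omega
            · have := h.2.2.1 u hu y (rightSeq_subset h4)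
              omega
      have hl : ∀ u, u ∈ word l ↔ u ∈ word l' := fun u =>
        ⟨aux h h' e u, aux h' h (fun u v => (e u v).symm) u⟩
      have aux2 : ∀ {l r l' r' : BinaryTree ℕ}, Preorderly (node x l r) →
          (∀ u, u ∈ word l ↔ u ∈ word l') →
          (∀ u v, chainRel (node x l r) u v ↔ chainRel (node x l' r') u v) →
          ∀ u, u ∈ word r → u ∈ word r' := by
        intro l r l' r' h hl e u hu
        rcases mem_word_node.1 (hw e u (mem_word_node.2 (Or.inr (Or.inr hu)))) with g | g | g
        · exact absurd (h.2.2.1 u ((hl u).2 g) u hu) (lt_irrefl _)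
        · exact absurd (h.2.1 u hu) (by omega)
        · exact g
      have hr : ∀ u, u ∈ word r ↔ u ∈ word r' := fun u =>
        ⟨aux2 h hl e u, aux2 h' (fun u => (hl u).symm) (fun u v => (e u v).symm) u⟩
      have el : ∀ u v, chainRel l u v ↔ chainRel l' u v := by
        intro u v
        by_cases hu : u ∈ word l
        · rw [← chainRel_node_left n hu, ← chainRel_node_left n' ((hl u).1 hu), e]
        · exact ⟨fun g => absurd (mem_word_of_chainRel g) hu,
            fun g => absurd ((hl u).2 (mem_word_of_chainRel g)) hu⟩
      have er : ∀ u v, chainRel r u v ↔ chainRel r' u v := by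
        intro u v
        by_cases hu : u ∈ word r
        · by_cases hv : v ∈ word r
          · rw [← chainRel_node_right n hu hv,
              ← chainRel_node_right n' ((hr u).1 hu) ((hr v).1 hv), e]
          · exact ⟨fun g => absurd (mem_word_of_chainRel (chainRel_symm g)) hv,
              fun g => absurd ((hr v).2 (mem_word_of_chainRel (chainRel_symm g))) hv⟩
        · exact ⟨fun g => absurd (mem_word_of_chainRel g) hu,
            fun g => absurd ((hr u).2 (mem_word_of_chainRel g)) hu⟩
      rw [ihl h.2.2.2.1 h'.2.2.2.1 el, ihr h.2.2.2.2 h'.2.2.2.2 er]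

/-- Every noncrossing relation on an interval consists of the right chains of a tree that is
labeled in preorder. -/
theorem exists_preorderly (E : Setoid ℕ)
    (hE : ∀ a b c d, a < b → b < c → c < d → E a c → E b d → E a b) (m s : ℕ) :
    ∃ t, Preorderly t ∧ ∀ u v, chainRel t u v ↔ E u v ∧ (s ≤ u ∧ u < s + m) ∧
      (s ≤ v ∧ v < s + m) := by
  classical
  induction m using Nat.strong_induction_on generalizing s with
  | _ m ih =>
    rcases m with _ | m
    · exact ⟨nil, trivial, fun u v => by simp [chainRel, offRel, rightSeq]⟩
    -- The split point `c` is the next element of the class of `s`, or the end of the interval if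
    -- there is none. The left subtree receives the labels between `s` and `c`, the right subtree
    -- those from `c` on.
    have hex : ∃ c, s < c ∧ (E s c ∨ s + (m + 1) ≤ c) := ⟨s + (m + 1), by omega, Or.inr le_rfl⟩
    obtain ⟨hc1, hc2⟩ := Nat.find_spec hex
    have hc3 : Nat.find hex ≤ s + (m + 1) := Nat.find_min' hex ⟨by omega, Or.inr le_rfl⟩
    have hc4 : ∀ v, s < v → E s v → Nat.find hex ≤ v := fun v h1 h2 =>
      Nat.find_min' hex ⟨h1, Or.inl h2⟩
    generalize Nat.find hex = c at hc1 hc2 hc3 hc4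
    have hc5 : c < s + (m + 1) → E s c := fun h => hc2.resolve_right (by omega)
    obtain ⟨l, hl, el⟩ := ih (c - (s + 1)) (by omega) (s + 1)
    obtain ⟨r, hr, er⟩ := ih (s + (m + 1) - c) (by omega) c
    have wl : ∀ u, u ∈ word l ↔ s < u ∧ u < c := fun u => by
      rw [mem_word_iff_chainRel, el]
      exact ⟨fun h => by omega, fun h => ⟨E.refl u, by omega, by omega⟩⟩
    have wr : ∀ u, u ∈ word r ↔ c ≤ u ∧ u < s + (m + 1) := fun u => by
      rw [mem_word_iff_chainRel, er]
      exact ⟨fun h => by omega, fun h => ⟨E.refl u, by omega, by omega⟩⟩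
    have hp : Preorderly (node s l r) :=
      ⟨fun y hy => ((wl y).1 hy).1, fun y hy => by have := (wr y).1 hy; omega,
        fun y hy z hz => by have := (wl y).1 hy; have := (wr z).1 hz; omega, hl, hr⟩
    have hseq : ∀ v, v ∈ rightSeq r ↔ E s v ∧ c ≤ v ∧ v < s + (m + 1) := by
      intro v
      cases r with
      | nil =>
        have := wr c
        simp only [word, List.not_mem_nil, false_iff] at this
        simp only [rightSeq, List.not_mem_nil, false_iff]
        omega
      | node y p q =>
        have hy := (wr y).1 (by simp [word])
        have hyc : y = c := le_antisymm (hr.root_le ((wr c).2 (by omega))) hy.1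
        subst hyc
        have hs := hc5 (by omega)
        rw [← chainRel_iff_of_mem_rightSeq hr.nodup (u := y) (by simp [rightSeq]), er]
        exact ⟨fun h => ⟨E.trans hs h.1, by omega⟩,
          fun h => ⟨E.trans (E.symm hs) h.1, by omega, by omega⟩⟩
    refine ⟨node s l r, hp, fun u v => ?_⟩
    -- No class meets both sides: it would cross the pair `s, c`, or else contain `c` and thus give
    -- an element of the class of `s` before `c`.
    have hcross : ∀ u v, s < u → u < c → c ≤ v → v < s + (m + 1) → ¬ E u v := by
      intro u v h1 h2 h3 h4 h
      have hs := hc5 (by omega)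
      rcases h3.eq_or_lt with e | e
      · exact absurd (hc4 u h1 (E.trans hs (E.symm (e ▸ h)))) (by omega)
      · exact absurd (hc4 u h1 (hE s u c v h1 h2 e hs h)) (by omega)
    rw [chainRel_node', el, er, hseq, hseq]
    constructor
    · rintro (h | h | h | h | h)
      · exact ⟨h.1, by omega, by omega⟩
      · exact ⟨h.1, by omega, by omega⟩
      · obtain ⟨rfl, rfl⟩ := h
        exact ⟨E.refl _, by omega, by omega⟩
      · obtain ⟨rfl, h⟩ := h
        exact ⟨h.1, by omega, by omega⟩
      · obtain ⟨rfl, h⟩ := h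
        exact ⟨E.symm h.1, by omega, by omega⟩
    · rintro ⟨h, hu, hv⟩
      by_cases hus : u = s
      · subst hus
        by_cases hvs : v = u
        · exact Or.inr (Or.inr (Or.inl ⟨rfl, hvs⟩))
        · exact Or.inr (Or.inr (Or.inr (Or.inl ⟨rfl, h, hc4 v (by omega) h, by omega⟩)))
      · by_cases hvs : v = s
        · subst hvs
          exact Or.inr (Or.inr (Or.inr (Or.inr ⟨rfl, E.symm h, hc4 u (by omega) (E.symm h),
            by omega⟩)))
        · by_cases huc : u < c <;> by_cases hvc : v < c
          · exact Or.inl ⟨h, by omega, by omega⟩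
          · exact absurd h (hcross u v (by omega) huc (by omega) (by omega))
          · exact absurd (E.symm h) (hcross v u (by omega) hvc (by omega) (by omega))
          · exact Or.inr (Or.inl ⟨h, by omega, by omega⟩)

/-! ### Rotations of trees labeled in preorder -/

/-- In preorder a right subtree has larger labels than the left subtree, so the obstructing `b' < b`
never occurs. -/
theorem Preorderly.admissible {t : BinaryTree ℕ} (h : Preorderly t) {a b : ℕ}
    (hab : InLeftSet t b a) : Admissible t b a := by
  refine ⟨hab, ?_⟩
  rintro c l r hs hb ⟨b', hb', hlt⟩
  have key : ∀ t, Preorderly t → IsSubtree (node c l r) t → Preorderly (node c l r) := by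
    intro t
    induction t with
    | nil => intro _ h; simp [IsSubtree] at h
    | node x p q ihl ihr =>
      rintro hp (h | h | h)
      · rwa [h]
      · exact ihl hp.2.2.2.1 h
      · exact ihr hp.2.2.2.2 h
  have := (key t h hs).2.2.1 b hb b' hb'
  omega

/-- The first node of a right chain is either the root or a left child, and in an increasing tree it
is the least element of its chain. -/
theorem isLeftChild_of_isMin {b : ℕ} {t : BinaryTree ℕ} (h : Preorderly t) (hb : b ∈ word t)
    (hmin : ∀ v, chainRel t v b → b ≤ v) (hr : b ∉ rightSeq t) : IsLeftChild b t := by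
  induction t with
  | nil => simp [word] at hb
  | node x l r ihl ihr =>
    have hn := h.nodup
    simp only [rightSeq, List.mem_cons, not_or] at hr
    rcases mem_word_node.1 hb with g | g | g
    · by_cases hl : b ∈ rightSeq l
      · cases l with
        | nil => simp [word] at g
        | node y p q =>
          have h1 : chainRel (node x (node y p q) r) y b :=
            chainRel_node.2 (Or.inl (Or.inr ⟨by simp [rightSeq], hl⟩))
          have : b = y := le_antisymm (hmin y h1) (h.2.2.2.1.root_le g)
          subst this
          exact ⟨x, p, q, r, Or.inl rfl⟩
      · obtain ⟨x', l', r', r'', h'⟩ := ihl h.2.2.2.1 g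
          (fun v hv => hmin v (chainRel_node.2 (Or.inl hv))) hl
        exact ⟨x', l', r', r'', Or.inr (Or.inl h')⟩
    · exact absurd g hr.1
    · obtain ⟨x', l', r', r'', h'⟩ := ihr h.2.2.2.2 g
        (fun v hv => hmin v (chainRel_node'.2 (Or.inr (Or.inl hv)))) hr.2
      exact ⟨x', l', r', r'', Or.inr (Or.inr h')⟩

/-- If `b` were in the right subtree of `a`, the right child of `a` would be an element of its chain
in (a, b], against `h1`. If the paths to `a` and `b` parted at a node `x` above `a`, then `x` and
its right child would enclose `a` without passing `b`, against `h2`. -/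
theorem inLeftSet_of_noncrossing {a b : ℕ} {t : BinaryTree ℕ} (h : Preorderly t)
    (ha : a ∈ word t) (hb : b ∈ word t) (hab : a < b)
    (h1 : ∀ v, chainRel t a v → v ≤ a ∨ b < v)
    (h2 : ∀ p q, chainRel t p q → p < a → a < q → q ≤ b → False) : InLeftSet t b a := by
  induction t with
  | nil => simp [word] at hb
  | node x l r ihl ihr =>
    rcases mem_word_node.1 ha with ga | ga | ga
    · rcases mem_word_node.1 hb with gb | gb | gb
      · obtain ⟨p, q, h', hb'⟩ := ihl h.2.2.2.1 ga gb
          (fun v hv => h1 v (chainRel_node.2 (Or.inl hv)))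
          (fun p q hpq => h2 p q (chainRel_node.2 (Or.inl hpq)))
        exact ⟨p, q, Or.inr (Or.inl h'), hb'⟩
      · have := h.1 a ga; omega
      · cases r with
        | nil => simp [word] at gb
        | node y p q =>
          exact (h2 x y (chainRel_node.2 (Or.inr (Or.inr ⟨Or.inl rfl,
            Or.inr (by simp [rightSeq])⟩))) (h.1 a ga) (h.2.2.1 a ga y (by simp [word]))
            (h.2.2.2.2.root_le gb)).elim
    · subst ga
      rcases mem_word_node.1 hb with gb | gb | gb
      · exact ⟨l, r, Or.inl rfl, gb⟩
      · omega
      · cases r with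
        | nil => simp [word] at gb
        | node y p q =>
          have h3 := h1 y (chainRel_node.2 (Or.inr (Or.inr ⟨Or.inl rfl,
            Or.inr (by simp [rightSeq])⟩)))
          have h4 := h.2.1 y (by simp [word])
          have h5 := h.2.2.2.2.root_le gb
          omega
    · have gb : b ∈ word r := by
        rcases mem_word_node.1 hb with gb | gb | gb
        · have := h.2.2.1 b gb a ga; omega
        · have := h.2.1 a ga; omega
        · exact gb
      obtain ⟨p, q, h', hb'⟩ := ihr h.2.2.2.2 ga gb
        (fun v hv => h1 v (chainRel_node'.2 (Or.inr (Or.inl hv))))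
        (fun p q hpq => h2 p q (chainRel_node'.2 (Or.inr (Or.inl hpq))))
      exact ⟨p, q, Or.inr (Or.inr h'), hb'⟩

/-! ### Moving the whole subtree below `b` -/

/-- The subtree below `b` is removed. -/
def cut (b : ℕ) : BinaryTree ℕ → BinaryTree ℕ
  | nil => nil
  | node x l r => if x = b then nil else node x (cut b l) (cut b r)

theorem cut_of_notMem {b : ℕ} {t : BinaryTree ℕ} (h : b ∉ word t) : cut b t = t := by
  induction t with
  | nil => rfl
  | node x l r ihl ihr =>
    simp only [mem_word_node, not_or] at h
    rw [cut, if_neg (Ne.symm h.2.1), ihl h.1, ihr h.2.2]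

theorem mem_word_cut {b : ℕ} {t : BinaryTree ℕ} (hn : (word t).Nodup) (hb : b ∈ word t) {w : ℕ}
    (h : w ∈ word (cut b t)) : w ∈ word t ∧ w ∉ word (subtreeAt b t) := by
  induction t with
  | nil => simp [word] at hb
  | node x l r ihl ihr =>
    obtain ⟨n1, n2, n3, n4, n5⟩ := nodup_node hn
    have sub : ∀ t, w ∈ word (subtreeAt b t) → w ∈ word t := by
      intro t
      induction t with
      | nil => simp [subtreeAt]
      | node x l r ihl ihr =>
        rw [subtreeAt]
        split_ifs
        · exact id
        · exact fun h => mem_word_node.2 (Or.inl (ihl h))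
        · exact fun h => mem_word_node.2 (Or.inr (Or.inr (ihr h)))
    rw [cut] at h
    split_ifs at h with e
    · simp [word] at h
    rw [subtreeAt, if_neg e]
    rcases mem_word_node.1 hb with gb | gb | gb
    · rw [if_pos gb]
      rw [cut_of_notMem (n5 b gb)] at h
      rcases mem_word_node.1 h with h | rfl | h
      · have := ihl n1 gb h
        exact ⟨mem_word_node.2 (Or.inl this.1), this.2⟩
      · exact ⟨by simp [word], fun hh => n3 (sub l hh)⟩
      · exact ⟨mem_word_node.2 (Or.inr (Or.inr h)), fun hh => n5 w (sub l hh) h⟩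
    · exact absurd gb.symm e
    · have hl : b ∉ word l := fun hh => n5 b hh gb
      rw [if_neg hl]
      rw [cut_of_notMem hl] at h
      rcases mem_word_node.1 h with h | rfl | h
      · exact ⟨mem_word_node.2 (Or.inl h), fun hh => n5 w h (sub r hh)⟩
      · exact ⟨by simp [word], fun hh => n4 (sub r hh)⟩
      · have := ihr n2 gb h
        exact ⟨mem_word_node.2 (Or.inr (Or.inr this.1)), this.2⟩

theorem Preorderly.cut {b : ℕ} {t : BinaryTree ℕ} (h : Preorderly t) : Preorderly (cut b t) := by
  have sub : ∀ t, ∀ w ∈ word (Nccp.cut b t), w ∈ word t := by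
    intro t
    induction t with
    | nil => simp [Nccp.cut]
    | node x l r ihl ihr =>
      intro w hw
      rw [Nccp.cut] at hw
      split_ifs at hw
      · simp [word] at hw
      · rcases mem_word_node.1 hw with g | g | g
        · exact mem_word_node.2 (Or.inl (ihl w g))
        · exact mem_word_node.2 (Or.inr (Or.inl g))
        · exact mem_word_node.2 (Or.inr (Or.inr (ihr w g)))
  induction t with
  | nil => trivial
  | node x l r ihl ihr =>
    rw [Nccp.cut]
    split_ifs
    · trivial
    · exact ⟨fun y hy => h.1 y (sub l y hy), fun y hy => h.2.1 y (sub r y hy),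
        fun y hy z hz => h.2.2.1 y (sub l y hy) z (sub r z hz), ihl h.2.2.2.1, ihr h.2.2.2.2⟩

theorem filterLeft_eq_self {p : ℕ → Bool} {t : BinaryTree ℕ} (h : ∀ y ∈ leftSeq t, p y = true) :
    filterLeft p t = t := by
  induction t with
  | nil => rfl
  | node x l r ihl _ =>
    simp only [leftSeq, List.forall_mem_cons] at h
    rw [filterLeft, if_pos h.1, ihl h.2]

theorem filterLeft_eq_nil {p : ℕ → Bool} {t : BinaryTree ℕ} (h : ∀ y ∈ leftSeq t, p y = false) :
    filterLeft p t = nil := by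
  induction t with
  | nil => rfl
  | node x l r ihl _ =>
    simp only [leftSeq, List.forall_mem_cons] at h
    rw [filterLeft, h.1, if_neg (by simp), ihl h.2]

/-- If S is the whole left sequence below `b`, no node remains to take the place of `b`. -/
theorem prune_eq_cut {b : ℕ} {S : Finset ℕ} {t : BinaryTree ℕ} (hn : (word t).Nodup)
    (h : ∀ y ∈ leftSeq (subtreeAt b t), y ∈ insert b S) : prune b S t = cut b t := by
  induction t with
  | nil => rfl
  | node x l r ihl ihr =>
    obtain ⟨n1, n2, n3, n4, n5⟩ := nodup_node hn
    rw [subtreeAt] at h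
    rw [prune, cut]
    split_ifs with e
    · rw [if_pos e] at h
      exact filterLeft_eq_nil fun y hy => by simpa [or_iff_not_imp_left] using h y hy
    · rw [if_neg e] at h
      by_cases hl : b ∈ word l
      · rw [if_pos hl] at h
        rw [ihl n1 h, prune_of_notMem (n5 b hl), cut_of_notMem (n5 b hl)]
      · rw [if_neg hl] at h
        rw [ihr n2 h, prune_of_notMem hl, cut_of_notMem hl]

theorem Preorderly.subtreeAt {b : ℕ} {t : BinaryTree ℕ} (h : Preorderly t) :
    Preorderly (subtreeAt b t) := by
  induction t with
  | nil => trivial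
  | node x l r ihl ihr =>
    rw [Nccp.subtreeAt]
    split_ifs
    · exact h
    · exact ihl h.2.2.2.1
    · exact ihr h.2.2.2.2

/-- All labels of `s` precede those of `r`, so the merge only hangs `r` at the end of the root chain
of `s`. -/
theorem Preorderly.mergeRight {r s : BinaryTree ℕ} (hr : Preorderly r) (hs : Preorderly s)
    (h : ∀ y ∈ word s, ∀ z ∈ word r, y < z) : Preorderly (mergeRight r s) := by
  induction s with
  | nil => cases r <;> rwa [Nccp.mergeRight]
  | node x' l' r' _ ih =>
    cases r with
    | nil => rwa [Nccp.mergeRight]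
    | node x l r =>
      have hlt := h x' (by simp [word]) x (by simp [word])
      rw [Nccp.mergeRight, if_neg (by omega)]
      refine ⟨hs.1, fun z hz => ?_, fun y hy z hz => ?_, hs.2.2.2.1, ih hs.2.2.2.2
        fun y hy => h y (mem_word_node.2 (Or.inr (Or.inr hy)))⟩
      · rcases mem_word_mergeRight.1 hz with g | g
        · exact h x' (by simp [word]) z g
        · exact hs.2.1 z g
      · rcases mem_word_mergeRight.1 hz with g | g
        · exact h y (mem_word_node.2 (Or.inl hy)) z g
        · exact hs.2.2.1 y hy z g

theorem mem_word_attach {a : ℕ} {s t : BinaryTree ℕ} {w : ℕ} (h : w ∈ word (attach a s t)) :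
    w ∈ word t ∨ w ∈ word s := by
  induction t with
  | nil => simp [attach, word] at h
  | node x l r ihl ihr =>
    rw [attach] at h
    rw [mem_word_node]
    split_ifs at h with e
    · rcases mem_word_node.1 h with g | g | g
      · exact Or.inl (Or.inl g)
      · exact Or.inl (Or.inr (Or.inl g))
      · exact (mem_word_mergeRight.1 g).imp (fun g => Or.inr (Or.inr g)) id
    · rcases mem_word_node.1 h with g | g | g
      · exact (ihl g).imp (fun g => Or.inl g) id
      · exact Or.inl (Or.inr (Or.inl g))
      · exact (ihr g).imp (fun g => Or.inr (Or.inr g)) id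

/-- A label after the subtree of `b` in preorder would lie in the right subtree of some node having
`b` on its left; this node and its right child would be chain neighbors enclosing `b`, which `h1`
forbids. -/
theorem mem_subtreeAt_or_lt {b : ℕ} {t : BinaryTree ℕ} (h : Preorderly t) (hb : b ∈ word t)
    (h1 : ∀ p q, chainRel t p q → p < b → b < q → False) {w : ℕ} (hw : w ∈ word t) :
    w ∈ word (subtreeAt b t) ∨ w < b := by
  induction t with
  | nil => simp [word] at hb
  | node x l r ihl ihr =>
    rw [subtreeAt]
    split_ifs with e hl
    · exact Or.inl hw
    · have hxb := h.1 b hl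
      have hr : r = nil := by
        cases r with
        | nil => rfl
        | node y p q =>
          exact (h1 x y (chainRel_node.2 (Or.inr (Or.inr ⟨Or.inl rfl,
            Or.inr (by simp [rightSeq])⟩))) hxb (h.2.2.1 b hl y (by simp [word]))).elim
      subst hr
      rcases mem_word_node.1 hw with g | g | g
      · exact ihl h.2.2.2.1 hl (fun p q hpq => h1 p q (chainRel_node.2 (Or.inl hpq))) g
      · exact Or.inr (by omega)
      · simp [word] at g
    · have hr : b ∈ word r := ((mem_word_node.1 hb).resolve_left hl).resolve_left (Ne.symm e)
      rcases mem_word_node.1 hw with g | g | g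
      · exact Or.inr (h.2.2.1 w g b hr)
      · exact Or.inr (g ▸ h.2.1 b hr)
      · exact ihr h.2.2.2.2 hr
          (fun p q hpq => h1 p q (chainRel_node'.2 (Or.inr (Or.inl hpq)))) g

/-- The moved labels must fit between what remains to the left of `a` and the right subtree of `a`.
They precede the latter because they come from the left subtree of `a`; they follow the former by
`mem_subtreeAt_or_lt`. -/
theorem Preorderly.attach_cut {a b : ℕ} {t : BinaryTree ℕ} (h : Preorderly t)
    (hab : InLeftSet t b a) (h1 : ∀ p q, chainRel t p q → a < p → p < b → b < q → False) :
    Preorderly (attach a (Nccp.subtreeAt b t) (Nccp.cut b t)) := by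
  induction t with
  | nil =>
    obtain ⟨l, r, h, -⟩ := hab
    simp [IsSubtree] at h
  | node x l r ihl ihr =>
    obtain ⟨n1, n2, n3, n4, n5⟩ := nodup_node h.nodup
    obtain ⟨l0, r0, hs, hb⟩ := hab
    rcases hs with hs | hs | hs
    · injection hs with e1 e2 e3
      subst e1 e2 e3
      have hx : a ≠ b := (h.1 b hb).ne
      rw [Nccp.subtreeAt, if_neg hx, if_pos hb, Nccp.cut, if_neg hx, cut_of_notMem (n5 b hb),
        attach, if_pos rfl]
      have hsub : ∀ w ∈ word (Nccp.subtreeAt b l0), b ≤ w ∧ w ∈ word l0 := fun w hw =>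
        le_of_mem_subtreeAt h.2.2.2.1.increasing hb hw
      refine ⟨fun y hy => h.1 y (mem_word_cut n1 hb hy).1, fun z hz => ?_, fun y hy z hz => ?_,
        h.2.2.2.1.cut, h.2.2.2.2.mergeRight h.2.2.2.1.subtreeAt
          fun y hy z hz => h.2.2.1 y (hsub y hy).2 z hz⟩
      · rcases mem_word_mergeRight.1 hz with g | g
        · exact h.2.1 z g
        · exact h.1 z (hsub z g).2
      · obtain ⟨hy1, hy2⟩ := mem_word_cut n1 hb hy
        rcases mem_word_mergeRight.1 hz with g | g
        · exact h.2.2.1 y hy1 z g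
        · refine lt_of_lt_of_le ((mem_subtreeAt_or_lt h.2.2.2.1 hb ?_ hy1).resolve_left hy2)
            (hsub z g).1
          exact fun p q hpq => h1 p q (chainRel_node.2 (Or.inl hpq))
            (h.1 p (mem_word_of_chainRel hpq))
    · have ha : a ∈ word l := mem_word_of_isSubtree hs (by simp [word])
      have hb' : b ∈ word l := mem_word_of_isSubtree hs (by simp [word, hb])
      have hxa := (h.1 a ha).ne
      have hxb := (h.1 b hb').ne
      rw [Nccp.subtreeAt, if_neg hxb, if_pos hb', Nccp.cut, if_neg hxb, cut_of_notMem (n5 b hb'),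
        attach, if_neg hxa, attach_of_notMem (t := r) (n5 a ha)]
      have hsub : ∀ w ∈ word (attach a (Nccp.subtreeAt b l) (Nccp.cut b l)), w ∈ word l :=
        fun w hw => (mem_word_attach hw).elim (fun g => (mem_word_cut n1 hb' g).1)
          fun g => (le_of_mem_subtreeAt h.2.2.2.1.increasing hb' g).2
      exact ⟨fun y hy => h.1 y (hsub y hy), h.2.1, fun y hy => h.2.2.1 y (hsub y hy),
        ihl h.2.2.2.1 ⟨l0, r0, hs, hb⟩ fun p q hpq => h1 p q (chainRel_node.2 (Or.inl hpq)),
        h.2.2.2.2⟩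
    · have ha : a ∈ word r := mem_word_of_isSubtree hs (by simp [word])
      have hb' : b ∈ word r := mem_word_of_isSubtree hs (by simp [word, hb])
      have hxa := (h.2.1 a ha).ne
      have hxb := (h.2.1 b hb').ne
      have hal : a ∉ word l := fun hh => n5 a hh ha
      have hbl : b ∉ word l := fun hh => n5 b hh hb'
      rw [Nccp.subtreeAt, if_neg hxb, if_neg hbl, Nccp.cut, if_neg hxb, cut_of_notMem hbl,
        attach, if_neg hxa, attach_of_notMem hal]
      have hsub : ∀ w ∈ word (attach a (Nccp.subtreeAt b r) (Nccp.cut b r)), w ∈ word r :=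
        fun w hw => (mem_word_attach hw).elim (fun g => (mem_word_cut n2 hb' g).1)
          fun g => (le_of_mem_subtreeAt h.2.2.2.2.increasing hb' g).2
      exact ⟨h.1, fun y hy => h.2.1 y (hsub y hy), fun y hy z hz => h.2.2.1 y hy z (hsub z hz),
        h.2.2.2.1, ihr h.2.2.2.2 ⟨l0, r0, hs, hb⟩
          fun p q hpq => h1 p q (chainRel_node'.2 (Or.inr (Or.inl hpq)))⟩

/-- If the right chains of `t'` arise from those of `t` by merging the chain of `a` with a chain
whose least element is `b`, where `a` is the greatest element of its chain below `b`, then `t'` is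
a rotation of `t`. -/
theorem isRotation_of_chainRel {a b : ℕ} {t t' : BinaryTree ℕ} (h : Preorderly t)
    (h' : Preorderly t') (ha : a ∈ word t) (hb : b ∈ word t) (hab : a < b)
    (hmin : ∀ v, chainRel t b v → b ≤ v) (hmax : ∀ v, chainRel t a v → v ≤ a ∨ b < v)
    (e : ∀ u v, chainRel t' u v ↔ chainRel t u v ∨
      ((chainRel t a u ∨ chainRel t b u) ∧ (chainRel t a v ∨ chainRel t b v))) :
    IsRotation t t' b a := by
  have hn := h.nodup
  have hab' : chainRel t' a b := (e _ _).2 (Or.inr ⟨Or.inl (chainRel_refl ha),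
    Or.inr (chainRel_refl hb)⟩)
  have hnab : ¬ chainRel t b a := fun g => absurd (hmin a g) (by omega)
  have hle : ∀ u v, chainRel t u v → chainRel t' u v := fun u v g => (e u v).2 (Or.inl g)
  have hcls : ∀ v, chainRel t' a v → chainRel t a v ∨ chainRel t b v := by
    intro v g
    rcases (e a v).1 g with g | g
    · exact Or.inl g
    · exact g.2
  -- A chain of `t` that encloses `b`, or in `h2` the element `a`, in the forbidden way would cross
  -- the pair `a, b` of `t'`. It would then be part of the merged class, where `hmax` and `hmin`
  -- exclude it.
  have h1 : ∀ p q, chainRel t p q → a < p → p < b → b < q → False := by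
    intro p q hpq g1 g2 g3
    rcases hcls p (h'.noncrossing g1 g2 g3 hab' (hle p q hpq)) with g | g
    · have := hmax p g; omega
    · have := hmin p g; omega
  have h2 : ∀ p q, chainRel t p q → p < a → a < q → q ≤ b → False := by
    intro p q hpq g1 g2 g3
    rcases g3.eq_or_lt with rfl | g3
    · have := hmin p (chainRel_symm hpq); omega
    · have g := chainRel_symm (h'.noncrossing g1 g2 g3 (hle p q hpq) hab')
      rcases hcls p g with g | g
      · have := hmax q (chainRel_trans hn g hpq); omega
      · have := hmin p g; omega
  have hls := inLeftSet_of_noncrossing h ha hb hab hmax h2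
  have hlc : IsLeftChild b t := by
    refine isLeftChild_of_isMin h hb (fun v hv => hmin v (chainRel_symm hv)) fun hr => ?_
    cases t with
    | nil => simp [word] at ha
    | node x l r =>
      have g1 := h.root_le ha
      have g2 := hmin x (Or.inr ⟨hr, by simp [rightSeq]⟩)
      omega
  obtain ⟨l, r, es⟩ := subtreeAt_root hb
  -- S affects no right chain, so the preorder condition dictates the choice: the whole subtree
  -- below `b` has to move.
  let S : Finset ℕ := (leftSeq (subtreeAt b t)).tail.toFinset
  have hS : ∀ y ∈ leftSeq (subtreeAt b t), y ∈ insert b S := by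
    intro y hy
    simp only [S, Finset.mem_insert, List.mem_toFinset]
    rw [es, leftSeq] at hy ⊢
    exact List.mem_cons.1 hy
  have hrot : IsRotation t (attach a (extract b S t) (prune b S t)) b a :=
    ⟨hlc, h.admissible hls, S, fun m hm => List.mem_toFinset.1 hm, rfl⟩
  -- The rotated tree is labeled in preorder and has the chains of `t'`, so it is `t'`.
  have he : attach a (extract b S t) (prune b S t) = t' := by
    have hp : Preorderly (attach a (extract b S t) (prune b S t)) := by
      rw [prune_eq_cut hn hS, extract, filterLeft_eq_self fun y hy => by simpa using hS y hy]
      exact h.attach_cut hls h1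
    exact hp.ext h' fun u v => by rw [hrot.chainRel_iff hn h.increasing, e]
  rwa [he] at hrot

/-- In a rotation of a tree labeled in preorder, `b` is the least element of its right chain. -/
theorem IsRotation.isMin {t t' : BinaryTree ℕ} {a b : ℕ} (h : Preorderly t)
    (hr : IsRotation t t' b a) {v : ℕ} (hv : chainRel t b v) : b ≤ v :=
  (le_of_mem_subtreeAt h.increasing hr.2.1.1.mem.2
    (rightSeq_subset ((chainRel_of_isLeftChild h.nodup hr.1).1 hv))).1

/-- In a rotation of a tree labeled in preorder, `a` is the greatest element below `b` of its
right chain. -/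
theorem IsRotation.isMax {t t' : BinaryTree ℕ} {a b : ℕ} (h : Preorderly t)
    (hr : IsRotation t t' b a) {v : ℕ} (hv : chainRel t a v) : v ≤ a ∨ b < v := by
  have hab := hr.2.1.1
  clear hr
  induction t with
  | nil => exact hv.elim (fun h => h.elim) fun h => by simp [rightSeq] at h
  | node x l r ihl ihr =>
    have hn := h.nodup
    obtain ⟨n1, n2, n3, n4, n5⟩ := nodup_node hn
    obtain ⟨l0, r0, hs, hb⟩ := hab
    rcases hs with hs | hs | hs
    · injection hs with e1 e2 e3
      subst e1 e2 e3
      rcases (chainRel_root hn).1 hv with g | g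
      · exact Or.inl g.le
      · exact Or.inr (h.2.2.1 b hb v (rightSeq_subset g))
    · have ha : a ∈ word l := mem_word_of_isSubtree hs (by simp [word])
      exact ihl h.2.2.2.1 ((chainRel_node_left hn ha).1 hv) ⟨l0, r0, hs, hb⟩
    · have ha : a ∈ word r := mem_word_of_isSubtree hs (by simp [word])
      by_cases hvr : v ∈ word r
      · exact ihr h.2.2.2.2 ((chainRel_node_right hn ha hvr).1 hv) ⟨l0, r0, hs, hb⟩
      · left
        rcases mem_word_node.1 (mem_word_of_chainRel (chainRel_symm hv)) with g | g | g
        · exact (h.2.2.1 v g a ha).le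
        · exact g ▸ (h.2.1 a ha).le
        · exact absurd g hvr

/-! ### Trees, words and partitions -/

/-- The least letter must be the root; it cuts the word into the words of the two subtrees. -/
theorem exists_increasing {w : List ℕ} (hw : w.Nodup) : ∃ t, Increasing t ∧ word t = w := by
  induction h : w.length using Nat.strong_induction_on generalizing w with
  | _ m ih =>
    rcases w with _ | ⟨y, w'⟩
    · exact ⟨nil, trivial, rfl⟩
    obtain ⟨x, hx, hmin⟩ : ∃ x ∈ y :: w', ∀ z ∈ y :: w', x ≤ z := by
      obtain ⟨x, hx, h⟩ := Finset.exists_min_image (y :: w').toFinset id ⟨y, by simp⟩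
      exact ⟨x, List.mem_toFinset.1 hx, fun z hz => h z (List.mem_toFinset.2 hz)⟩
    generalize y :: w' = w at hw h hx hmin
    obtain ⟨p, q, rfl⟩ := List.append_of_mem hx
    simp only [List.nodup_append, List.nodup_cons, List.mem_cons] at hw
    obtain ⟨n1, ⟨n2, n3⟩, n4⟩ := hw
    simp only [List.length_append, List.length_cons] at h
    obtain ⟨l, hl, el⟩ := ih p.length (by omega) n1 rfl
    obtain ⟨r, hr, er⟩ := ih q.length (by omega) n3 rfl
    refine ⟨node x l r, ⟨fun z hz => ?_, fun z hz => ?_, hl, hr⟩, by rw [word, el, er]⟩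
    · rw [el] at hz
      exact lt_of_le_of_ne (hmin z (by simp [hz])) (n4 z hz x (Or.inl rfl)).symm
    · rw [er] at hz
      exact lt_of_le_of_ne (hmin z (by simp [hz])) fun e => n2 (e ▸ hz)

/-- Cutting a permutation at its descents gives the blocks. -/
theorem exists_NCCP_word {n : ℕ} {w : List ℕ} (hw : w.Perm (List.range' 1 n)) :
    ∃ π : NCCP n, π.word = w := by
  have hnd := hw.nodup_iff.2 List.nodup_range'
  refine ⟨⟨w.splitBy fun a b => decide (a ≤ b), ?_, ?_, ?_, ?_⟩, ?_⟩
  · rwa [List.flatten_splitBy]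
  · exact fun B hB => List.ne_nil_of_mem_splitBy hB
  · intro B hB
    have h1 := List.isChain_of_mem_splitBy hB
    simp only [decide_eq_true_eq] at h1
    rw [← List.flatten_splitBy (fun a b => decide (a ≤ b)) w, List.nodup_flatten] at hnd
    exact h1.pairwise.imp₂ (fun _ _ => lt_of_le_of_ne) (hnd.1 B hB)
  · refine (List.isChain_getLast_head_splitBy (fun a b => decide (a ≤ b)) w).imp ?_
    rintro B C ⟨h1, h2, h3⟩
    simp only [decide_eq_false_iff_not, not_le] at h3
    exact ⟨_, B.getLast_mem h1, _, C.head_mem h2, h3⟩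
  · exact List.flatten_splitBy _ _

theorem NCCP.exists_isTreeOf {n : ℕ} (π : NCCP n) : ∃ t, IsTreeOf t π :=
  exists_increasing π.nodup_word

/-- The labeled binary tree of a partition. -/
noncomputable def NCCP.tree {n : ℕ} (π : NCCP n) : BinaryTree ℕ := π.exists_isTreeOf.choose

theorem NCCP.isTreeOf_tree {n : ℕ} (π : NCCP n) : IsTreeOf π.tree π :=
  π.exists_isTreeOf.choose_spec

theorem IsTreeOf.eq_tree {n : ℕ} {π : NCCP n} {t : BinaryTree ℕ} (h : IsTreeOf t π) :
    t = π.tree :=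
  word_eq_of_increasing h.1 π.isTreeOf_tree.1 (h.2.trans π.isTreeOf_tree.2.symm)

theorem NCCP.tree_injective {n : ℕ} : Function.Injective (NCCP.tree (n := n)) := fun π π' h =>
  NCCP.word_injective (by rw [← π.isTreeOf_tree.2, h, π'.isTreeOf_tree.2])

theorem NCCP.nodup_tree {n : ℕ} (π : NCCP n) : (Nccp.word π.tree).Nodup := by
  rw [π.isTreeOf_tree.2]
  exact π.nodup_word

theorem NCCP.mem_tree {n : ℕ} (π : NCCP n) {u : ℕ} :
    u ∈ Nccp.word π.tree ↔ 1 ≤ u ∧ u ≤ n := by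
  have := π.perm.mem_iff (a := u)
  rw [List.mem_range'_1] at this
  rw [π.isTreeOf_tree.2]
  exact this.trans (by omega)

/-- The word contains no `x`, `y`, `z`, in this order, with `y < z < x`. -/
def WordAvoids312 (w : List ℕ) : Prop :=
  ∀ p y q, w = p ++ y :: q → ∀ x ∈ p, ∀ z ∈ q, ¬ (y < z ∧ z < x)

/-- The root label is least, so a left label larger than a right label forms the pattern 312 with
the root as its 1. Conversely, if left labels are below right labels, the 3 and the 2 of a pattern
lie in the same subtree, and so does the smaller letter between them. -/
theorem preorderly_iff {t : BinaryTree ℕ} (hi : Increasing t) (hn : (word t).Nodup) :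
    Preorderly t ↔ WordAvoids312 (word t) := by
  induction t with
  | nil =>
    refine ⟨fun _ p y q h => ?_, fun _ => trivial⟩
    simp [word] at h
  | node x l r ihl ihr =>
    obtain ⟨n1, n2, n3, n4, n5⟩ := nodup_node hn
    obtain ⟨i1, i2, i3, i4⟩ := hi
    constructor
    · rintro ⟨h1, h2, h3, h4, h5⟩ p y q e u hu z hz ⟨hyz, hzu⟩
      have key : (∃ q', word l = p ++ y :: q' ∧ q = q' ++ x :: word r) ∨
          (p = word l ∧ y = x ∧ q = word r) ∨
          (∃ p', word r = p' ++ y :: q ∧ p = word l ++ x :: p') := by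
        rw [word] at e
        rcases List.append_eq_append_iff.1 e with ⟨v, e1, e2⟩ | ⟨v, e1, e2⟩
        · rcases v with _ | ⟨v0, v⟩
          · simp only [List.nil_append, List.cons.injEq] at e2
            exact Or.inr (Or.inl ⟨by simpa using e1, e2.1.symm, e2.2.symm⟩)
          · simp only [List.cons_append, List.cons.injEq] at e2
            exact Or.inr (Or.inr ⟨v, e2.2, by rw [e1, e2.1]⟩)
        · rcases v with _ | ⟨v0, v⟩
          · simp only [List.nil_append, List.cons.injEq] at e2
            exact Or.inr (Or.inl ⟨by simpa using e1.symm, e2.1, e2.2⟩)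
          · simp only [List.cons_append, List.cons.injEq] at e2
            exact Or.inl ⟨v, by rw [e1, e2.1], e2.2⟩
      rcases key with ⟨q', e1, rfl⟩ | ⟨rfl, rfl, rfl⟩ | ⟨p', e1, rfl⟩
      · have hy := i1 y (by rw [e1]; simp)
        have hul : u ∈ word l := by rw [e1]; simp [hu]
        simp only [List.mem_append, List.mem_cons] at hz
        rcases hz with hz | hz | hz
        · exact (ihl i3 n1).1 h4 p y q' e1 u hu z hz ⟨hyz, hzu⟩
        · omega
        · have := h3 u hul z hz; omega
      · have := h3 u hu z hz; omega
      · have hzr : z ∈ word r := by rw [e1]; simp [hz]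
        have := i2 z hzr
        simp only [List.mem_append, List.mem_cons] at hu
        rcases hu with hu | hu | hu
        · have := h3 u hu z hzr; omega
        · omega
        · exact (ihr i4 n2).1 h5 p' y q e1 u hu z hz ⟨hyz, hzu⟩
    · intro h
      refine ⟨i1, i2, fun y hy z hz => ?_, (ihl i3 n1).2 ?_, (ihr i4 n2).2 ?_⟩
      · have h1 := h (word l) x (word r) rfl y hy z hz
        have h2 := i2 z hz
        have h3 : y ≠ z := fun e => n5 y hy (e ▸ hz)
        omega
      · intro p y q e u hu z hz
        exact h p y (q ++ x :: word r) (by rw [word, e]; simp) u hu z (by simp [hz])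
      · intro p y q e u hu z hz
        exact h (word l ++ x :: p) y q (by rw [word, e]; simp) u (by simp [hu]) z hz

theorem flatten_eq_append_cons {L : List (List ℕ)} {p q : List ℕ} {y : ℕ}
    (h : L.flatten = p ++ y :: q) : ∃ L₁ B L₂ p' q', L = L₁ ++ B :: L₂ ∧ B = p' ++ y :: q' ∧
      p = L₁.flatten ++ p' ∧ q = q' ++ L₂.flatten := by
  induction L generalizing p with
  | nil => simp at h
  | cons A L ih =>
    rw [List.flatten_cons] at h
    rcases List.append_eq_append_iff.1 h with ⟨v, e1, e2⟩ | ⟨v, e1, e2⟩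
    · obtain ⟨L₁, B, L₂, p', q', rfl, h2, h3, h4⟩ := ih e2
      exact ⟨A :: L₁, B, L₂, p', q', rfl, h2, by rw [e1, h3]; simp, h4⟩
    · rcases v with _ | ⟨v0, v⟩
      · obtain ⟨L₁, B, L₂, p', q', rfl, h2, h3, h4⟩ := ih (p := []) e2.symm
        exact ⟨A :: L₁, B, L₂, p', q', rfl, h2, by simpa [← h3] using e1.symm, h4⟩
      · simp only [List.cons_append, List.cons.injEq] at e2
        exact ⟨[], A, L, p, v, rfl, by rw [e1, e2.1], by simp, e2.2⟩

/-- Blocks increase: the 3 and the 1 of a pattern are in different blocks, while the 2 may share the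
block of the 1. This is the reason for `i < j ≤ k`. -/
theorem NCCP.avoids312_iff {n : ℕ} (π : NCCP n) : π.Avoids312 ↔ WordAvoids312 π.word := by
  constructor
  · intro h p y q e x hx z hz ⟨hyz, hzx⟩
    obtain ⟨L₁, B, L₂, p', q', e1, rfl, rfl, rfl⟩ := flatten_eq_append_cons e
    have hinc := π.increasing (p' ++ y :: q') (by rw [e1]; simp)
    rw [List.pairwise_append] at hinc
    have hx' : x ∈ L₁.flatten := (List.mem_append.1 hx).resolve_right fun g => by
      have := hinc.2.2 x g y (by simp)
      omega
    obtain ⟨A, hA, hxA⟩ := List.mem_flatten.1 hx'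
    obtain ⟨i, hi, rfl⟩ := List.mem_iff_getElem.1 hA
    have hlen : π.blocks.length = L₁.length + (L₂.length + 1) := by rw [e1]; simp
    have gi : π.blocks[i]'(by omega) = L₁[i] := by
      rw [List.getElem_of_eq e1]
      exact List.getElem_append_left hi
    have gj : π.blocks[L₁.length]'(by omega) = p' ++ y :: q' := by
      rw [List.getElem_of_eq e1]
      simp
    have hk : ∃ k, ∃ hk : k < π.blocks.length, L₁.length ≤ k ∧ z ∈ π.blocks[k] := by
      rcases List.mem_append.1 hz with hz | hz
      · exact ⟨L₁.length, by omega, le_rfl, by rw [gj]; simp [hz]⟩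
      · obtain ⟨C, hC, hzC⟩ := List.mem_flatten.1 hz
        obtain ⟨k, hk, rfl⟩ := List.mem_iff_getElem.1 hC
        refine ⟨L₁.length + (k + 1), by omega, by omega, ?_⟩
        rw [List.getElem_of_eq e1]
        simpa using hzC
    obtain ⟨k, hk, hjk, hzk⟩ := hk
    refine h ⟨i, by omega⟩ ⟨L₁.length, by omega⟩ ⟨k, hk⟩ hi hjk x ?_ y ?_ z hzk ⟨hyz, hzx⟩
    · simpa [gi] using hxA
    · simp [gj]
  · intro h i j k hij hjk x hx y hy z hz ⟨hyz, hzx⟩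
    have e1 : π.blocks = π.blocks.take j ++ π.blocks[j] :: π.blocks.drop (j + 1) := by
      simp
    obtain ⟨p, q, e2⟩ := List.append_of_mem hy
    have hinc := π.increasing π.blocks[j] (List.getElem_mem _)
    refine h ((π.blocks.take j).flatten ++ p) y (q ++ (π.blocks.drop (j + 1)).flatten) ?_ x ?_ z ?_
      ⟨hyz, hzx⟩
    · rw [NCCP.word]
      conv_lhs => rw [e1, e2]
      simp
    · refine List.mem_append_left _ (List.mem_flatten.2 ⟨_, ?_, hx⟩)
      rw [List.mem_take_iff_getElem]
      exact ⟨i, by have := i.2; simpa using hij, rfl⟩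
    · rcases hjk.eq_or_lt with e | hlt
      · subst e
        rw [e2] at hz hinc
        rw [List.pairwise_append] at hinc
        simp only [List.mem_append, List.mem_cons] at hz
        rcases hz with hz | hz | hz
        · have := hinc.2.2 z hz y (by simp)
          omega
        · omega
        · simp [hz]
      · refine List.mem_append_right _ (List.mem_flatten.2 ⟨_, ?_, hz⟩)
        rw [List.mem_drop_iff_getElem]
        have := k.2
        have := Fin.lt_def.1 hlt
        exact ⟨k - (j + 1), by omega, by simp; congr 1; omega⟩

theorem NCCP.avoids312_iff_preorderly {n : ℕ} (π : NCCP n) :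
    π.Avoids312 ↔ Preorderly π.tree := by
  rw [π.avoids312_iff, preorderly_iff π.isTreeOf_tree.1 π.nodup_tree, π.isTreeOf_tree.2]

/-! ### The number of blocks -/

/-- The number of ascents of a word. -/
def ascents : List ℕ → ℕ
  | [] => 0
  | [_] => 0
  | x :: y :: w => (if x < y then 1 else 0) + ascents (y :: w)

theorem ascents_append_cons {w w' : List ℕ} {x : ℕ} (h : ∀ y ∈ w, x ≤ y) :
    ascents (w ++ x :: w') = ascents w + ascents (x :: w') := by
  induction w with
  | nil => simp [ascents]
  | cons y w ih =>
    rcases w with _ | ⟨z, w⟩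
    · have := h y (by simp)
      simp [ascents, this]
    · have := ih fun u hu => h u (List.mem_cons_of_mem _ hu)
      simp only [List.cons_append, ascents] at this ⊢
      omega

/-- The letter before a node with a left subtree is larger than it, so ascents occur exactly after
the nodes that have a right child. -/
theorem ascents_word {t : BinaryTree ℕ} (h : Increasing t) : ascents (word t) = rightEdges t := by
  induction t with
  | nil => rfl
  | node x l r ihl ihr =>
    rw [word, ascents_append_cons fun y hy => (h.1 y hy).le, ihl h.2.2.1, rightEdges]
    have : ascents (x :: word r) = rightEdges r + if r = nil then 0 else 1 := by
      rw [← ihr h.2.2.2]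
      cases hr : word r with
      | nil => cases r with
        | nil => rfl
        | node y p q => simp [word] at hr
      | cons y w =>
        have := h.2.1 y (by rw [hr]; simp)
        rw [ascents, if_pos this, if_neg, add_comm]
        rintro rfl
        simp [word] at hr
    omega

/-- Neighboring letters form an ascent inside a block and a descent between two blocks. With
`NCCP.length_blocks` this turns the number of blocks into a count of right edges, which rotations
increase. -/
theorem length_add_ascents {L : List (List ℕ)} (h1 : ∀ B ∈ L, B ≠ [])
    (h2 : ∀ B ∈ L, B.Pairwise (· < ·)) (h3 : L.IsChain fun B C => ∃ b ∈ B, ∃ c ∈ C, c < b) :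
    L.length + ascents L.flatten = L.flatten.length := by
  have single : ∀ B : List ℕ, B ≠ [] → B.Pairwise (· < ·) → 1 + ascents B = B.length := by
    intro B
    induction B with
    | nil => simp
    | cons x B ih =>
      intro _ h
      rcases B with _ | ⟨y, B⟩
      · rfl
      · have := ih (by simp) (List.pairwise_cons.1 h).2
        have := (List.pairwise_cons.1 h).1 y (by simp)
        simp only [ascents, List.length_cons, if_pos this] at *
        omega
  have app : ∀ (B w : List ℕ) (c : ℕ), B.Pairwise (· < ·) → (∃ b ∈ B, c < b) →
      ascents (B ++ c :: w) = ascents B + ascents (c :: w) := by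
    intro B w c hB hc
    induction B with
    | nil => simp at hc
    | cons x B ih =>
      obtain ⟨b, hb, hcb⟩ := hc
      rcases B with _ | ⟨y, B⟩
      · simp only [List.mem_singleton] at hb
        subst hb
        simp [ascents, hcb.le]
      · have : ∃ b ∈ y :: B, c < b := by
          rcases List.mem_cons.1 hb with rfl | hb
          · exact ⟨y, by simp, hcb.trans ((List.pairwise_cons.1 hB).1 y (by simp))⟩
          · exact ⟨b, hb, hcb⟩
        have := ih (List.pairwise_cons.1 hB).2 this
        simp only [List.cons_append, ascents] at this ⊢
        omega
  induction L with
  | nil => rfl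
  | cons B L ih =>
    have hB := single B (h1 B (by simp)) (h2 B (by simp))
    have := ih (fun C hC => h1 C (by simp [hC])) (fun C hC => h2 C (by simp [hC])) h3.tail
    rw [List.flatten_cons, List.length_cons, List.length_append]
    rcases L with _ | ⟨C, L⟩
    · simpa [add_comm] using hB
    · obtain ⟨b, hb, c, hc, hcb⟩ := (List.isChain_cons_cons.1 h3).1
      have hCi := h2 C (by simp)
      rcases C with _ | ⟨c0, C⟩
      · simp at hc
      · have hc0 : c0 < b := by
          rcases List.mem_cons.1 hc with rfl | hc
          · exact hcb
          · exact ((List.pairwise_cons.1 hCi).1 c hc).trans hcb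
        have := app B (C ++ L.flatten) c0 (h2 B (by simp)) ⟨b, hb, hc0⟩
        simp only [List.flatten_cons, List.cons_append] at *
        omega

theorem NCCP.length_blocks {n : ℕ} (π : NCCP n) : π.blocks.length + rightEdges π.tree = n := by
  have := length_add_ascents π.nonempty π.increasing π.descent
  rw [π.perm.length_eq, List.length_range'] at this
  rwa [← ascents_word π.isTreeOf_tree.1, π.isTreeOf_tree.2]

/-! ### The relation of a partition given by the right chains of its tree -/

/-- Two numbers are related if they are equal or lie on the same right chain of the tree of `π`. -/
def NCCP.chains {n : ℕ} (π : NCCP n) : Setoid ℕ where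
  r u v := u = v ∨ chainRel π.tree u v
  iseqv := by
    refine ⟨fun u => Or.inl rfl, ?_, ?_⟩
    · rintro u v (h | h)
      · exact Or.inl h.symm
      · exact Or.inr (chainRel_symm h)
    · rintro u v w (rfl | h) (rfl | g)
      · exact Or.inl rfl
      · exact Or.inr g
      · exact Or.inr h
      · exact Or.inr (chainRel_trans π.nodup_tree h g)

theorem NCCP.chains_apply {n : ℕ} {π : NCCP n} {u v : ℕ} :
    π.chains u v ↔ u = v ∨ chainRel π.tree u v := Iff.rfl

theorem NCCP.chains_iff {n : ℕ} {π : NCCP n} {u v : ℕ} (hu : 1 ≤ u ∧ u ≤ n) :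
    π.chains u v ↔ chainRel π.tree u v := by
  rw [NCCP.chains_apply]
  refine ⟨?_, Or.inr⟩
  rintro (rfl | h)
  · exact chainRel_refl (π.mem_tree.2 hu)
  · exact h

theorem NCCP.chainRel_tree_iff {n : ℕ} {π : NCCP n} {u v : ℕ} :
    chainRel π.tree u v ↔ (1 ≤ u ∧ u ≤ n) ∧ π.chains u v :=
  ⟨fun h => ⟨π.mem_tree.1 (mem_word_of_chainRel h), Or.inr h⟩, fun h => (chains_iff h.1).1 h.2⟩

/-- Avoidance is essential: it makes both trees preorder trees, and these are determined by their
chains. -/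
theorem NCCP.chains_injective {n : ℕ} {π π' : NCCP n} (h : π.Avoids312) (h' : π'.Avoids312)
    (e : π.chains = π'.chains) : π = π' :=
  NCCP.tree_injective ((π.avoids312_iff_preorderly.1 h).ext (π'.avoids312_iff_preorderly.1 h')
    fun u v => by rw [chainRel_tree_iff, chainRel_tree_iff, e])

theorem NCCP.isNC_chains {n : ℕ} {π : NCCP n} (h : π.Avoids312) : IsNC n π.chains := by
  refine ⟨fun u v huv hne => ?_, fun a b c d hab hbc hcd hac hbd => ?_⟩
  · exact (chainRel_tree_iff.1 (huv.resolve_left hne)).1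
  · exact Or.inr ((π.avoids312_iff_preorderly.1 h).noncrossing hab hbc hcd
      (hac.resolve_left (by omega)) (hbd.resolve_left (by omega)))

theorem exists_NCCP_chains {n : ℕ} {E : Setoid ℕ} (hE : IsNC n E) :
    ∃ π : NCCP n, π.Avoids312 ∧ π.chains = E := by
  obtain ⟨t, ht, e⟩ := exists_preorderly E hE.2 n 1
  have hw : ∀ u, u ∈ word t ↔ 1 ≤ u ∧ u < 1 + n := fun u => by
    rw [mem_word_iff_chainRel, e]
    exact ⟨fun h => h.2.1, fun h => ⟨E.refl u, h, h⟩⟩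
  obtain ⟨π, hπ⟩ := exists_NCCP_word (n := n) (w := word t)
    ((List.perm_ext_iff_of_nodup ht.nodup List.nodup_range').2 fun u => by
      rw [hw, List.mem_range'_1])
  have hT : t = π.tree := IsTreeOf.eq_tree ⟨ht.increasing, hπ.symm⟩
  refine ⟨π, π.avoids312_iff_preorderly.2 (hT ▸ ht), Setoid.ext fun u v => ?_⟩
  rw [NCCP.chains_apply, ← hT, e]
  constructor
  · rintro (rfl | h)
    · exact E.refl u
    · exact h.1
  · intro h
    by_cases huv : u = v
    · exact Or.inl huv
    · have := hE.1 u v h huv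
      have := hE.1 v u (E.symm h) (Ne.symm huv)
      exact Or.inr ⟨h, by omega, by omega⟩

theorem merge_apply' {E : Setoid ℕ} {a b u v : ℕ} :
    merge E a b u v ↔ E u v ∨ ((E a u ∨ E b u) ∧ (E a v ∨ E b v)) := by
  rw [merge_apply]
  constructor
  · rintro (h | ⟨h, h'⟩ | ⟨h, h'⟩)
    · exact Or.inl h
    · exact Or.inr ⟨Or.inl (E.symm h), Or.inr h'⟩
    · exact Or.inr ⟨Or.inr (E.symm h), Or.inl h'⟩
  · rintro (h | ⟨h | h, h' | h'⟩)
    · exact Or.inl h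
    · exact Or.inl (E.trans (E.symm h) h')
    · exact Or.inr (Or.inl ⟨E.symm h, h'⟩)
    · exact Or.inr (Or.inr ⟨E.symm h, h'⟩)
    · exact Or.inl (E.trans (E.symm h) h')

theorem IsRotationOf.isRotation {n : ℕ} {π π' : NCCP n} {b a : ℕ} (h : IsRotationOf π π' b a) :
    IsRotation π.tree π'.tree b a := by
  obtain ⟨t, t', h1, h2, h⟩ := h
  rwa [← h1.eq_tree, ← h2.eq_tree]

theorem IsRotationOf.bounds {n : ℕ} {π π' : NCCP n} {b a : ℕ} (h : IsRotationOf π π' b a) :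
    1 ≤ a ∧ a < b ∧ b ≤ n := by
  have hr := h.isRotation.2.1.1
  have := π.mem_tree.1 hr.mem.1
  have := π.mem_tree.1 hr.mem.2
  have := hr.lt π.isTreeOf_tree.1
  omega

theorem IsRotationOf.chains_eq {n : ℕ} {π π' : NCCP n} {b a : ℕ} (h : IsRotationOf π π' b a) :
    π'.chains = merge π.chains a b := by
  have hb := h.bounds
  refine Setoid.ext fun u v => ?_
  rw [merge_apply', NCCP.chains_iff (π := π) (u := a) (by omega),
    NCCP.chains_iff (π := π) (u := b) (by omega), NCCP.chains_iff (π := π) (u := a) (by omega),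
    NCCP.chains_iff (π := π) (u := b) (by omega), NCCP.chains_apply, NCCP.chains_apply,
    h.isRotation.chainRel_iff π.nodup_tree π.isTreeOf_tree.1, or_assoc]

theorem IsRotationOf.isMin {n : ℕ} {π π' : NCCP n} {b a : ℕ} (hπ : π.Avoids312)
    (h : IsRotationOf π π' b a) : IsMin π.chains b := fun v hv =>
  have := h.bounds
  h.isRotation.isMin (π.avoids312_iff_preorderly.1 hπ) ((NCCP.chains_iff (by omega)).1 hv)

theorem IsRotationOf.isMax {n : ℕ} {π π' : NCCP n} {b a : ℕ} (hπ : π.Avoids312)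
    (h : IsRotationOf π π' b a) {v : ℕ} (hv : π.chains a v) : v ≤ a ∨ b < v :=
  have := h.bounds
  h.isRotation.isMax (π.avoids312_iff_preorderly.1 hπ) ((NCCP.chains_iff (by omega)).1 hv)

theorem isRotationOf_of_chains {n : ℕ} {π π' : NCCP n} {b a : ℕ} (hπ : π.Avoids312)
    (hπ' : π'.Avoids312) (ha : 1 ≤ a) (hab : a < b) (hb : b ≤ n) (hmin : IsMin π.chains b)
    (hmax : ∀ v, π.chains a v → v ≤ a ∨ b < v) (e : π'.chains = merge π.chains a b) :
    IsRotationOf π π' b a := by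
  refine ⟨π.tree, π'.tree, π.isTreeOf_tree, π'.isTreeOf_tree, ?_⟩
  refine isRotation_of_chainRel (π.avoids312_iff_preorderly.1 hπ)
    (π'.avoids312_iff_preorderly.1 hπ') (π.mem_tree.2 (by omega)) (π.mem_tree.2 (by omega)) hab
    (fun v hv => hmin v (Or.inr hv)) (fun v hv => hmax v (Or.inr hv)) fun u v => ?_
  rw [NCCP.chainRel_tree_iff, e, merge_apply', NCCP.chainRel_tree_iff (u := u),
    ← NCCP.chains_iff (π := π) (u := a) (by omega),
    ← NCCP.chains_iff (π := π) (u := b) (by omega), ← NCCP.chains_iff (π := π) (u := a) (by omega),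
    ← NCCP.chains_iff (π := π) (u := b) (by omega), and_or_left]
  refine or_congr Iff.rfl ⟨fun h => h.2, fun h => ⟨?_, h⟩⟩
  have hI := NCCP.isNC_chains hπ
  rcases h.1 with g | g
  · by_cases e : u = a
    · omega
    · exact hI.1 u a (π.chains.symm g) e
  · by_cases e : u = b
    · omega
    · exact hI.1 u b (π.chains.symm g) e

/-! ### The order on the `312`-avoiding partitions -/

/-- The noncrossing relation of a `312`-avoiding partition. -/
def NCCP312.toNC {n : ℕ} (π : NCCP312 n) : NC n := ⟨π.1.chains, NCCP.isNC_chains π.2⟩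

/-- No avoidance is needed, and this matters: in the order induced from `NCCP n` the intermediate
partitions may contain the pattern 312. -/
theorem chains_mono {n : ℕ} {π π' : NCCP n} (h : π ≤ π') : π.chains ≤ π'.chains := by
  have h' : Relation.ReflTransGen Covers π π' := h
  induction h' with
  | refl => exact le_rfl
  | tail h1 h2 ih =>
    obtain ⟨b, a, h2⟩ := h2
    rw [h2.chains_eq]
    exact (ih h1).trans (le_merge _ _ _)

/-- Between two noncrossing relations there is one which arises from the smaller one by merging
two classes. -/
theorem exists_merge_le {n : ℕ} {E F : Setoid ℕ} (hE : IsNC n E) (hF : IsNC n F) (h : E < F) :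
    ∃ a b, 1 ≤ a ∧ a < b ∧ b ≤ n ∧ IsMin E b ∧ (∀ v, E a v → v ≤ a ∨ b < v) ∧
      IsNC n (merge E a b) ∧ merge E a b ≤ F := by
  classical
  obtain ⟨u, w, huw, hne⟩ : ∃ u w, F u w ∧ ¬ E u w := by
    by_contra hcon
    push Not at hcon
    exact h.not_ge fun u w => hcon u w
  -- In an `F`-class that is not a single `E`-class, `p` is the least element and `q` the least one
  -- not `E`-related to `p`. Then `q` is least in its `E`-class, since everything below it in the
  -- `F`-class belongs to `p`.
  obtain ⟨p, hp, hpu⟩ := exists_isMin F u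
  have hex : ∃ q, F p q ∧ ¬ E p q := by
    by_contra hcon
    push Not at hcon
    exact hne (E.trans (E.symm (hcon u hpu)) (hcon w (F.trans hpu huw)))
  obtain ⟨h1, h2⟩ := Nat.find_spec hex
  have h3 : ∀ v, F p v → v < Nat.find hex → E p v := fun v hv hlt => by
    by_contra hcon
    exact Nat.find_min hex hlt ⟨hv, hcon⟩
  generalize Nat.find hex = q at h1 h2 h3
  have hpq : p ≠ q := fun e => h2 (e ▸ E.refl p)
  have hlt : p < q := lt_of_le_of_ne (hp q h1) hpq
  -- For a rotation, `p` has to be replaced by the greatest element `a` below `q` in its `E`-class;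
  -- the merged relation is the same.
  let T := (range q).filter (E p)
  have hpT : p ∈ T := mem_filter.2 ⟨mem_range.2 hlt, E.refl p⟩
  obtain ⟨a1, a2⟩ := mem_filter.1 (T.max'_mem ⟨p, hpT⟩)
  have a3 : ∀ v, E p v → v < q → v ≤ T.max' ⟨p, hpT⟩ := fun v g g' =>
    T.le_max' v (mem_filter.2 ⟨mem_range.2 g', g⟩)
  generalize T.max' ⟨p, hpT⟩ = a at a1 a2 a3
  rw [mem_range] at a1
  have e : merge E p q = merge E a q := merge_congr a2 (E.refl q)
  refine ⟨a, q, ?_, a1, (hF.1 q p (F.symm h1) hpq.symm).2, ?_, ?_, ?_, ?_⟩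
  · have := (hF.1 p q h1 hpq).1
    have := hp a (h.le a2)
    omega
  · intro v hv
    by_contra hcon
    exact h2 (E.trans (h3 v (F.trans h1 (h.le hv)) (by omega)) (E.symm hv))
  · intro v hv
    have hv' := E.trans a2 hv
    by_contra hcon
    rcases (show v ≤ q by omega).eq_or_lt with g | g
    · exact h2 (g ▸ hv')
    · have := a3 v hv' g
      omega
  · rw [← e]
    exact hE.merge hF h.le h1 hlt h3
  · rw [← e]
    exact merge_le h.le h1

/-- By induction from the top of the finite lattice `NC n`: as long as the relations differ,
`exists_merge_le` provides a larger relation below the target, and the partition belonging to it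
covers π. -/
theorem le_of_chains_le {n : ℕ} {π π' : NCCP n} (hπ : π.Avoids312) (hπ' : π'.Avoids312)
    (h : π.chains ≤ π'.chains) : π ≤ π' := by
  have key : ∀ E : NC n, ∀ π : NCCP n, π.Avoids312 → π.chains = E.1 → π.chains ≤ π'.chains →
      π ≤ π' := by
    intro E
    induction E using WellFoundedGT.induction with
    | _ E ih =>
      intro π hπ hE h
      rcases h.eq_or_lt with e | hlt
      · exact (NCCP.chains_injective hπ hπ' e).le
      · obtain ⟨a, b, ha, hab, hb, hmin, hmax, hNC, hle⟩ :=
          exists_merge_le (NCCP.isNC_chains hπ) (NCCP.isNC_chains hπ') hlt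
        obtain ⟨σ, hσ, hσE⟩ := exists_NCCP_chains hNC
        have hcov : Covers π σ :=
          ⟨b, a, isRotationOf_of_chains hπ hσ ha hab hb hmin hmax hσE⟩
        refine (Relation.ReflTransGen.single hcov : π ≤ σ).trans
          (ih ⟨σ.chains, NCCP.isNC_chains hσ⟩ ?_ σ hσ rfl (hσE ▸ hle))
        refine lt_of_le_of_ne (show E.1 ≤ σ.chains from hσE ▸ hE ▸ le_merge _ _ _) fun e => ?_
        have : π.chains a b := by
          rw [hE, e]
          exact (hσE ▸ merge_rel π.chains a b : σ.chains a b)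
        have := hmin a (π.chains.symm this)
        omega
  exact key ⟨π.chains, NCCP.isNC_chains hπ⟩ π hπ rfl h

/-- The `312`-avoiding partitions form the lattice of noncrossing equivalence relations. -/
noncomputable def NCCP312.orderIso (n : ℕ) : NCCP312 n ≃o NC n :=
  RelIso.ofSurjective (OrderEmbedding.ofMapLEIff NCCP312.toNC
    fun π π' => ⟨fun h => le_of_chains_le π.2 π'.2 h, fun h => chains_mono h⟩)
    fun E => by
      obtain ⟨π, h, e⟩ := exists_NCCP_chains E.2
      exact ⟨⟨π, h⟩, Subtype.ext e⟩

/-! ### The trees of the least and of the greatest partition -/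

/-- The tree with the labels `s`, `s + 1`, …, in which every edge is a left edge. -/
def leftComb : ℕ → ℕ → BinaryTree ℕ
  | _, 0 => nil
  | s, m + 1 => node s (leftComb (s + 1) m) nil

theorem word_leftComb (s m : ℕ) : word (leftComb s m) = (List.range' s m).reverse := by
  induction m generalizing s with
  | zero => rfl
  | succ m ih => rw [leftComb, word, ih, List.range'_succ, List.reverse_cons, word]

theorem increasing_leftComb (s m : ℕ) : Increasing (leftComb s m) := by
  induction m generalizing s with
  | zero => trivial
  | succ m ih =>
    refine ⟨fun y hy => ?_, by simp [word], ih _, trivial⟩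
    rw [word_leftComb, List.mem_reverse, List.mem_range'_1] at hy
    omega

theorem chainRel_leftComb {s m u v : ℕ} (h : chainRel (leftComb s m) u v) : u = v := by
  induction m generalizing s with
  | zero => exact h.elim (fun h => h.elim) fun h => by simp [leftComb, rightSeq] at h
  | succ m ih =>
    rcases chainRel_node.1 h with h | h | h
    · exact ih h
    · exact h.elim
    · simp only [rightSeq, List.not_mem_nil, or_false] at h
      exact h.1.trans h.2.symm

/-- The tree with the labels `s`, `s + 1`, …, in which every edge is a right edge. -/
def rightComb : ℕ → ℕ → BinaryTree ℕ
  | _, 0 => nil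
  | s, m + 1 => node s nil (rightComb (s + 1) m)

theorem word_rightComb (s m : ℕ) : word (rightComb s m) = List.range' s m := by
  induction m generalizing s with
  | zero => rfl
  | succ m ih => rw [rightComb, word, ih, List.range'_succ, word, List.nil_append]

theorem rightSeq_rightComb (s m : ℕ) : rightSeq (rightComb s m) = List.range' s m := by
  induction m generalizing s with
  | zero => rfl
  | succ m ih => rw [rightComb, rightSeq, ih, List.range'_succ]

theorem increasing_rightComb (s m : ℕ) : Increasing (rightComb s m) := by
  induction m generalizing s with
  | zero => trivial
  | succ m ih =>
    refine ⟨by simp [word], fun y hy => ?_, trivial, ih _⟩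
    rw [word_rightComb, List.mem_range'_1] at hy
    omega

theorem NCCP.word_zero (n : ℕ) : (NCCP.zero n).word = (List.range' 1 n).reverse := by
  have h : ∀ l : List ℕ, (l.map fun i => [i]).flatten = l := by
    intro l
    induction l with
    | nil => rfl
    | cons x l ih => simp [ih]
  exact h _

theorem NCCP.word_one (n : ℕ) : (NCCP.one n).word = List.range' 1 n := by
  rw [NCCP.word, NCCP.one]
  by_cases h : n = 0
  · subst h; simp
  · simp [h]

theorem NCCP.chains_zero (n : ℕ) : (NCCP.zero n).chains = ⊥ := by
  have h : leftComb 1 n = (NCCP.zero n).tree :=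
    IsTreeOf.eq_tree ⟨increasing_leftComb 1 n, by rw [word_leftComb, NCCP.word_zero]⟩
  refine le_antisymm ?_ bot_le
  rintro u v (e | e)
  · exact e
  · rw [← h] at e
    exact chainRel_leftComb e

theorem NCCP.chains_one (n : ℕ) : (NCCP.one n).chains = (NC.top n).1 := by
  have h : rightComb 1 n = (NCCP.one n).tree :=
    IsTreeOf.eq_tree ⟨increasing_rightComb 1 n, by rw [word_rightComb, NCCP.word_one]⟩
  refine le_antisymm ?_ ?_
  · intro u v e
    by_cases huv : u = v
    · exact Or.inl huv
    · have e' := (e : u = v ∨ _).resolve_left huv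
      exact Or.inr ⟨(NCCP.chainRel_tree_iff.1 e').1,
        (NCCP.chainRel_tree_iff.1 (chainRel_symm e')).1⟩
  · rintro u v (e | ⟨hu, hv⟩)
    · exact Or.inl e
    · simp only [Set.mem_ofPred_eq] at hu hv
      refine Or.inr (Or.inr ?_)
      rw [← h, rightSeq_rightComb, List.mem_range'_1, List.mem_range'_1]
      omega

theorem moebius_NCCP312 {n : ℕ} (hn : 1 ≤ n) :
    moebius (NCCP312.zero n) (NCCP312.one n) = (-1) ^ (n - 1) * (catalan (n - 1) : ℤ) := by
  have h0 : NCCP312.orderIso n (NCCP312.zero n) = NC.bot n := Subtype.ext (NCCP.chains_zero n)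
  have h1 : NCCP312.orderIso n (NCCP312.one n) = NC.top n := Subtype.ext (NCCP.chains_one n)
  rw [← moebius_NC_top hn, ← h0, ← h1]
  refine (moebius_orderIso _ _ _ ?_).symm
  rw [← (NCCP312.orderIso n).le_iff_le, h0]
  exact NC.bot_le _

/-! ### Maximal chains -/

theorem Covers.length_lt {n : ℕ} {π π' : NCCP n} (h : Covers π π') :
    π'.blocks.length < π.blocks.length := by
  obtain ⟨b, a, h⟩ := h
  have := h.isRotation.rightEdges_lt π.nodup_tree
  have := π.length_blocks
  have := π'.length_blocks
  omega

/-- Each rotation lowers the number of blocks by at least one, and `n - 1` rotations lead from `n`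
blocks to 1, so each lowers it by exactly one. -/
theorem IsMaximalChain.length {n : ℕ} (hn : 1 ≤ n) {c : Fin (n - 1 + 1) → NCCP n}
    (hc : IsMaximalChain c) (i : Fin (n - 1 + 1)) : (c i).blocks.length + i = n := by
  obtain ⟨h0, h1, hcov⟩ := hc
  have upper : ∀ i, (c i).blocks.length + i ≤ n := by
    intro i
    induction i using Fin.induction with
    | zero => rw [h0]; simp [NCCP.zero]
    | succ i ih =>
      have := (hcov i).length_lt
      simp only [Fin.val_castSucc, Fin.val_succ] at ih ⊢
      omega
  have lower : ∀ i, n ≤ (c i).blocks.length + i := by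
    intro i
    induction i using Fin.reverseInduction with
    | last =>
      rw [h1]
      simp only [NCCP.one, Fin.val_last]
      rw [if_neg (by omega)]
      simp only [List.length_singleton]
      omega
    | cast i ih =>
      have := (hcov i).length_lt
      simp only [Fin.val_castSucc, Fin.val_succ] at ih ⊢
      omega
  exact le_antisymm (upper i) (lower i)

/-- A maximal chain is decreasing if and only if the labels `L̃` increase weakly. -/
theorem IsMaximalChain.isDecreasing_iff {n : ℕ} (hn : 1 ≤ n) {c : Fin (n - 1 + 1) → NCCP n}
    (hc : IsMaximalChain c) :
    IsDecreasing c ↔ Monotone fun i : Fin (n - 1) => tildeLabel (c i.castSucc) (c i.succ) := by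
  -- With zero-based `i`, the partition before the step has `n - i` blocks. Since -i alone falls by
  -- one per step, strict decrease of L amounts to weak increase of L̃.
  have hlen : ∀ i : Fin (n - 1), edgeLabel (c i.castSucc) (c i.succ) =
      2 * n - i - tildeLabel (c i.castSucc) (c i.succ) := by
    intro i
    have := hc.length hn i.castSucc
    simp only [Fin.val_castSucc] at this
    rw [edgeLabel]
    omega
  rw [IsDecreasing]
  simp only [hlen]
  obtain ⟨f, hf⟩ : ∃ f : Fin (n - 1) → ℕ, ∀ i, tildeLabel (c i.castSucc) (c i.succ) = f i :=
    ⟨_, fun _ => rfl⟩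
  simp only [hf]
  constructor
  · intro h
    have key : ∀ (k i : ℕ) (hi : i + k < n - 1), f ⟨i, by omega⟩ ≤ f ⟨i + k, hi⟩ := by
      intro k i
      induction k with
      | zero => intro _; exact le_rfl
      | succ k ih =>
        intro hi
        have h1 := ih (by omega)
        have h2 := h (show (⟨i + k, by omega⟩ : Fin (n - 1)) < ⟨i + (k + 1), hi⟩ by
          rw [Fin.lt_def]; simp)
        simp only at h2
        push_cast at h2
        omega
    intro i j hij
    have := key (j - i) i (by have := j.2; have := Fin.le_def.1 hij; omega)
    have e : (⟨i + (j - i), by have := j.2; have := Fin.le_def.1 hij; omega⟩ : Fin (n - 1)) = j :=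
      Fin.ext (by have := Fin.le_def.1 hij; simp only; omega)
    rwa [e] at this
  · intro h i j hij
    have h1 : f i ≤ f j := h hij.le
    have h2 := Fin.lt_def.1 hij
    simp only
    omega

theorem merge_singleClass {A : Set ℕ} {a b : ℕ} (ha : a ∈ A) :
    merge (singleClass A) a b = singleClass (insert b A) := by
  apply le_antisymm
  · apply merge_le
    · rintro u v (h | h)
      · exact Or.inl h
      · exact Or.inr ⟨Or.inr h.1, Or.inr h.2⟩
    · exact Or.inr ⟨Or.inr ha, Or.inl rfl⟩
  · rintro u v (h | ⟨rfl | h, rfl | h'⟩)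
    · exact Or.inl (Or.inl h)
    · exact Or.inl (Or.inl rfl)
    · exact Or.inr (Or.inr ⟨Or.inl rfl, Or.inr ⟨ha, h'⟩⟩)
    · exact Or.inr (Or.inl ⟨Or.inr ⟨h, ha⟩, Or.inl rfl⟩)
    · exact Or.inl (Or.inr ⟨h, h'⟩)

theorem NC.coe_top (n : ℕ) : (NC.top n).1 = singleClass (Icc 1 n : Finset ℕ) := by
  rw [coe_Icc]
  rfl

/-! ### Decreasing chains, read backwards from the greatest element -/

section Decreasing

variable {n : ℕ} {c : Fin (n - 1 + 1) → NCCP n}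

theorem IsMaximalChain.exists_rotation (hc : IsMaximalChain c) (i : Fin (n - 1)) :
    ∃ b, IsRotationOf (c i.castSucc) (c i.succ) b (tildeLabel (c i.castSucc) (c i.succ)) := by
  obtain ⟨b, a, h⟩ := hc.2.2 i
  exact ⟨b, by rwa [tildeLabel_eq h]⟩

/-- Every nontrivial class contains one of the previous labels. -/
theorem IsMaximalChain.exists_label_mem (hc : IsMaximalChain c) (i : Fin (n - 1 + 1)) {u v : ℕ}
    (huv : (c i).chains u v) (hne : u ≠ v) :
    ∃ j : Fin (n - 1), j.castSucc < i ∧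
      (c i).chains u (tildeLabel (c j.castSucc) (c j.succ)) := by
  induction i using Fin.induction generalizing u v with
  | zero =>
    rw [hc.1, NCCP.chains_zero] at huv
    exact absurd huv hne
  | succ i ih =>
    obtain ⟨b, h⟩ := hc.exists_rotation i
    have e := h.chains_eq
    rw [e] at huv ⊢
    rcases merge_apply'.1 huv with g | g
    · obtain ⟨j, hj, g'⟩ := ih g hne
      exact ⟨j, hj.trans i.castSucc_lt_succ, Or.inl g'⟩
    · refine ⟨i, i.castSucc_lt_succ, merge_apply'.2 (Or.inr ⟨g.1, Or.inl ((c i.castSucc).chains.refl _)⟩)⟩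

/-- In a decreasing chain of `312`-avoiding partitions the class of `1` grows by one element in
every step, and all other classes are trivial. -/
theorem IsMaximalChain.step (hc : IsMaximalChain c) (hav : ∀ i, (c i).Avoids312)
    (hmono : Monotone fun i : Fin (n - 1) => tildeLabel (c i.castSucc) (c i.succ))
    (i : Fin (n - 1)) {A : Set ℕ} (h1 : 1 ∈ A) (hA : (c i.succ).chains = singleClass A) :
    ∃ b ∈ A, tildeLabel (c i.castSucc) (c i.succ) < b ∧
      (∀ v ∈ A, tildeLabel (c i.castSucc) (c i.succ) < v → b ≤ v) ∧ 1 ∈ A \ {b} ∧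
      (c i.castSucc).chains = singleClass (A \ {b}) := by
  obtain ⟨b, h⟩ := hc.exists_rotation i
  have hm : ∀ j : Fin (n - 1), j.castSucc < i.castSucc →
      tildeLabel (c j.castSucc) (c j.succ) ≤ tildeLabel (c i.castSucc) (c i.succ) :=
    fun j hj => hmono (Fin.castSucc_lt_castSucc_iff.1 hj).le
  generalize tildeLabel (c i.castSucc) (c i.succ) = a at h hm
  obtain ⟨g1, g2, g3⟩ := h.bounds
  have hmin := h.isMin (hav _)
  have e := h.chains_eq
  -- A nontrivial class of `b` contains an earlier label; that label is at least `b` by minimality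
  -- and at most `a < b` by monotonicity.
  have htriv : ∀ v, (c i.castSucc).chains b v → v = b := by
    intro v hv
    by_contra hne
    obtain ⟨j, hj, hj'⟩ := hc.exists_label_mem _ hv (Ne.symm hne)
    have := hmin _ hj'
    have := hm j hj
    omega
  have hab : singleClass A a b := by rw [← hA, e]; exact merge_rel _ _ _
  obtain ⟨ha, hb⟩ := (singleClass_apply.1 hab).resolve_left g2.ne
  have hE : (c i.castSucc).chains = singleClass (A \ {b}) := by
    refine Setoid.ext fun u v => ⟨fun huv => ?_, ?_⟩
    · have h' : singleClass A u v := by rw [← hA, e]; exact Or.inl huv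
      rcases h' with h' | ⟨hu, hv⟩
      · exact Or.inl h'
      · by_cases eu : u = b
        · exact Or.inl ((htriv v (eu ▸ huv)).trans eu.symm).symm
        by_cases ev : v = b
        · exact Or.inl ((htriv u (ev ▸ (c i.castSucc).chains.symm huv)).trans ev.symm)
        exact Or.inr ⟨⟨hu, eu⟩, ⟨hv, ev⟩⟩
    · rintro (rfl | ⟨⟨hu, hub⟩, ⟨hv, hvb⟩⟩)
      · exact (c i.castSucc).chains.refl _
      · have h' : merge (c i.castSucc).chains a b u v := by
          rw [← e, hA]
          exact Or.inr ⟨hu, hv⟩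
        rcases h' with h' | h' | h'
        · exact h'
        · exact absurd (htriv v h'.2) hvb
        · exact absurd (htriv u ((c i.castSucc).chains.symm h'.1)) hub
  -- An element of the class strictly between `a` and `b` would be related to `a` before the
  -- rotation, contrary to `IsRotationOf.isMax`.
  refine ⟨b, hb, g2, fun v hv hav' => ?_, ⟨h1, fun e1 => ?_⟩, hE⟩
  · by_contra hlt
    have : (c i.castSucc).chains a v := by
      rw [hE]
      exact Or.inr ⟨⟨ha, g2.ne⟩, ⟨hv, fun e' => hlt (le_of_eq (Set.mem_singleton_iff.1 e').symm)⟩⟩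
    have := h.isMax (hav _) this
    omega
  · have := Set.mem_singleton_iff.1 e1
    omega

theorem IsMaximalChain.exists_singleClass (hn : 1 ≤ n) (hc : IsMaximalChain c)
    (hav : ∀ i, (c i).Avoids312)
    (hmono : Monotone fun i : Fin (n - 1) => tildeLabel (c i.castSucc) (c i.succ))
    (i : Fin (n - 1 + 1)) : ∃ A : Set ℕ, 1 ∈ A ∧ (c i).chains = singleClass A := by
  induction i using Fin.reverseInduction with
  | last => exact ⟨{u | 1 ≤ u ∧ u ≤ n}, ⟨le_rfl, hn⟩, by rw [hc.2.1, NCCP.chains_one]; rfl⟩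
  | cast i ih =>
    obtain ⟨A, h1, hA⟩ := ih
    obtain ⟨b, -, -, -, h1', h'⟩ := hc.step hav hmono i h1 hA
    exact ⟨_, h1', h'⟩

/-- A decreasing chain of `312`-avoiding partitions is determined by its labels. -/
theorem IsMaximalChain.ext_labels (hn : 1 ≤ n) (hc : IsMaximalChain c)
    (hav : ∀ i, (c i).Avoids312)
    (hmono : Monotone fun i : Fin (n - 1) => tildeLabel (c i.castSucc) (c i.succ))
    {c' : Fin (n - 1 + 1) → NCCP n} (hc' : IsMaximalChain c') (hav' : ∀ i, (c' i).Avoids312)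
    (he : ∀ i : Fin (n - 1), tildeLabel (c i.castSucc) (c i.succ) =
      tildeLabel (c' i.castSucc) (c' i.succ)) : c = c' := by
  have hmono' : Monotone fun i : Fin (n - 1) => tildeLabel (c' i.castSucc) (c' i.succ) := by
    simpa only [he] using hmono
  funext i
  induction i using Fin.reverseInduction with
  | last => rw [hc.2.1, hc'.2.1]
  | cast i ih =>
    obtain ⟨A, h1, hA⟩ := hc.exists_singleClass hn hav hmono i.succ
    obtain ⟨b, hb, hlt, hle, -, h⟩ := hc.step hav hmono i h1 hA
    obtain ⟨b', hb', hlt', hle', -, h'⟩ := hc'.step hav' hmono' i h1 (ih ▸ hA)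
    have e := he i
    have : b = b' := le_antisymm (hle b' hb' (by omega)) (hle' b hb (by omega))
    subst this
    exact NCCP.chains_injective (hav _) (hav' _) (h.trans h'.symm)

/-- Going backwards from [n] to the class before step `i`, every removed element exceeds a label
that is at least `a i`. So 1, …, `a i` all survive in that class, which has `i + 1` elements. -/
theorem IsMaximalChain.isSeqA (hn : 1 ≤ n) (hc : IsMaximalChain c)
    (hav : ∀ i, (c i).Avoids312)
    (hmono : Monotone fun i : Fin (n - 1) => tildeLabel (c i.castSucc) (c i.succ)) :
    IsSeqA fun i : Fin (n - 1) => tildeLabel (c i.castSucc) (c i.succ) := by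
  refine ⟨hmono, fun i => ⟨?_, ?_⟩⟩
  · obtain ⟨b, h⟩ := hc.exists_rotation i
    exact h.bounds.1
  simp only
  set a := tildeLabel (c i.castSucc) (c i.succ) with ha
  have han : a ≤ n := by
    obtain ⟨b, h⟩ := hc.exists_rotation i
    have := h.bounds
    omega
  have hA : ∀ j : Fin (n - 1 + 1), ∃ A : Finset ℕ, 1 ∈ A ∧
      (c j).chains = singleClass A ∧ A.card = j + 1 ∧
      (i.castSucc ≤ j → ∀ m, 1 ≤ m → m ≤ a → m ∈ A) := by
    intro j
    induction j using Fin.reverseInduction with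
    | last =>
      refine ⟨Icc 1 n, mem_Icc.2 ⟨le_rfl, hn⟩, ?_, ?_, fun _ m h1 h2 => mem_Icc.2 ⟨h1, by omega⟩⟩
      · rw [hc.2.1, NCCP.chains_one, NC.coe_top]
      · rw [Nat.card_Icc, Fin.val_last]
        omega
    | cast j ih =>
      obtain ⟨A, h1, hE, hcard, hsub⟩ := ih
      obtain ⟨b, hb, hlt, hle, h1', h'⟩ := hc.step hav hmono j (mem_coe.2 h1) hE
      refine ⟨A.erase b, mem_erase.2 ⟨fun e => h1'.2 e, h1⟩, ?_, ?_, fun hij m hm1 hm2 => ?_⟩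
      · rw [h', coe_erase]
      · rw [card_erase_of_mem (mem_coe.1 hb), hcard, Fin.val_succ, Fin.val_castSucc]
        omega
      · refine mem_erase.2 ⟨?_, hsub (hij.trans j.castSucc_lt_succ.le) m hm1 hm2⟩
        have : a ≤ tildeLabel (c j.castSucc) (c j.succ) :=
          hmono (Fin.castSucc_le_castSucc_iff.1 hij)
        omega
  obtain ⟨A, -, -, hcard, hsub⟩ := hA i.castSucc
  have := card_le_card (s := Icc 1 a) (t := A) fun m hm =>
    hsub le_rfl m (mem_Icc.1 hm).1 (mem_Icc.1 hm).2
  rw [Nat.card_Icc, hcard, Fin.val_castSucc] at this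
  omega

end Decreasing

/-! ### The chain with given labels -/

/-- Starting from `[n]`, remove successively for `k = 0, 1, …` the least element above `f k`. -/
noncomputable def removeSeq (n : ℕ) (f : ℕ → ℕ) : ℕ → Finset ℕ
  | 0 => Icc 1 n
  | k + 1 => (removeSeq n f k).erase (sInf {v | v ∈ removeSeq n f k ∧ f k < v})

theorem removeSeq_subset (n : ℕ) (f : ℕ → ℕ) (k : ℕ) : removeSeq n f k ⊆ Icc 1 n := by
  induction k with
  | zero => exact Subset.rfl
  | succ k ih => exact (erase_subset _ _).trans ih

theorem mem_removeSeq {n : ℕ} {f : ℕ → ℕ} {k m : ℕ} (h1 : 1 ≤ m) (h2 : m ≤ n)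
    (h : ∀ j < k, m ≤ f j) : m ∈ removeSeq n f k := by
  induction k with
  | zero => exact mem_Icc.2 ⟨h1, h2⟩
  | succ k ih =>
    refine mem_erase.2 ⟨fun e => ?_, ih fun j hj => h j (by omega)⟩
    have hm := h k (by omega)
    -- The infimum of the empty set is 0, which is not in [n]; erasing it changes nothing.
    rcases Set.eq_empty_or_nonempty {v | v ∈ removeSeq n f k ∧ f k < v} with hs | hs
    · rw [hs, Nat.sInf_empty] at e
      omega
    · have := (Nat.sInf_mem hs).2
      omega

/-- After `k` removals `n - k` elements of [n] remain. These are more than `f k`, so one of them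
exceeds `f k` and the next removal is a genuine one. -/
theorem removeSeq_succ {n : ℕ} {f : ℕ → ℕ} {K : ℕ}
    (hf : ∀ k < K, f k + k < n) (k : ℕ) (hk : k ≤ K) :
    (removeSeq n f k).card + k = n ∧ (k < K → ∃ b ∈ removeSeq n f k, f k < b ∧
      (∀ v ∈ removeSeq n f k, f k < v → b ≤ v) ∧
      removeSeq n f (k + 1) = (removeSeq n f k).erase b) := by
  have step : ∀ k < K, (removeSeq n f k).card + k = n → ∃ b ∈ removeSeq n f k, f k < b ∧
      (∀ v ∈ removeSeq n f k, f k < v → b ≤ v) ∧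
      removeSeq n f (k + 1) = (removeSeq n f k).erase b := by
    intro k hk hcard
    have hs : {v | v ∈ removeSeq n f k ∧ f k < v}.Nonempty := by
      by_contra hcon
      rw [Set.not_nonempty_iff_eq_empty, Set.eq_empty_iff_forall_notMem] at hcon
      have hsub : removeSeq n f k ⊆ Icc 1 (f k) := fun v hv => by
        have h1 := mem_Icc.1 (removeSeq_subset n f k hv)
        have h2 : ¬ (v ∈ removeSeq n f k ∧ f k < v) := hcon v
        exact mem_Icc.2 ⟨h1.1, not_lt.1 fun h => h2 ⟨hv, h⟩⟩
      have := card_le_card hsub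
      rw [Nat.card_Icc] at this
      have := hf k hk
      omega
    obtain ⟨h1, h2⟩ := Nat.sInf_mem hs
    exact ⟨_, h1, h2, fun v hv hlt => Nat.sInf_le ⟨hv, hlt⟩, rfl⟩
  have hcard : ∀ k ≤ K, (removeSeq n f k).card + k = n := by
    intro k
    induction k with
    | zero => intro _; simp [removeSeq]
    | succ k ih =>
      intro hk
      have h := ih (by omega)
      obtain ⟨b, hb, -, -, e⟩ := step k (by omega) h
      rw [e, card_erase_of_mem hb]
      have := card_pos.2 ⟨b, hb⟩
      omega
  exact ⟨hcard k hk, fun h => step k h (hcard k hk)⟩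

/-- The chain is forced from the top, so it is built there: the sets of `removeSeq` serve as the
only nontrivial classes. -/
theorem exists_chain {n : ℕ} (hn : 1 ≤ n) {a : Fin (n - 1) → ℕ} (ha : IsSeqA a) :
    ∃ c : Fin (n - 1 + 1) → NCCP n, IsMaximalChain c ∧ (∀ i, (c i).Avoids312) ∧
      ∀ i : Fin (n - 1), tildeLabel (c i.castSucc) (c i.succ) = a i := by
  obtain ⟨hmono, hbd⟩ := ha
  -- The labels in reverse order. The default 0 is taken only for `n = 1`, where there are no
  -- labels.
  let f : ℕ → ℕ := fun k => if h : n - 1 - (k + 1) < n - 1 then a ⟨n - 1 - (k + 1), h⟩ else 0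
  have hfa : ∀ i : Fin (n - 1), f (n - 1 - (i + 1)) = a i := by
    intro i
    have hi := i.2
    have e : n - 1 - (n - 1 - (i + 1) + 1) = i := by omega
    simp only [f, e]
    rw [dif_pos hi]
  have hf : ∀ k, k < n - 1 → ∃ i : Fin (n - 1), k = n - 1 - (i + 1) ∧ f k = a i := by
    intro k hk
    have e : k = n - 1 - ((n - 1 - (k + 1)) + 1) := by omega
    refine ⟨⟨n - 1 - (k + 1), by omega⟩, e, ?_⟩
    rw [← hfa]
    congr 1
  -- With k = n - 2 - i the bound `a i ≤ i + 1` reads f k + k ≤ n - 1.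
  have hrs := removeSeq_succ (n := n) (f := f) (K := n - 1) fun k hk => by
    obtain ⟨i, e, e'⟩ := hf k hk
    have := (hbd i).2
    have := i.2
    omega
  have hNC : ∀ k, IsNC n (singleClass (removeSeq n f k : Set ℕ)) := fun k =>
    isNC_singleClass fun u hu => mem_Icc.1 (removeSeq_subset n f k hu)
  choose C hC1 hC2 using fun k => exists_NCCP_chains (hNC k)
  have hrot : ∀ i : Fin (n - 1), ∃ b, IsRotationOf (C (n - 1 - i)) (C (n - 1 - (i + 1))) b (a i) := by
    intro i
    have hi := i.2
    obtain ⟨b, hb, hlt, hle, e⟩ := (hrs (n - 1 - (i + 1)) (by omega)).2 (by omega)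
    rw [hfa] at hlt hle
    rw [show n - 1 - ((i : ℕ) + 1) + 1 = n - 1 - i by omega] at e
    have hbn := mem_Icc.1 (removeSeq_subset n f _ hb)
    -- The removals made so far belong to labels with index at least `i`, which are at least `a i`,
    -- so none of them hits `a i`.
    have hai : a i ∈ removeSeq n f (n - 1 - i) := by
      refine mem_removeSeq (hbd i).1 (by omega) fun j hj => ?_
      obtain ⟨i', e1, e2⟩ := hf j (by omega)
      rw [e2]
      refine hmono (Fin.le_def.2 ?_)
      have := i'.2
      omega
    have hbi : b ∉ removeSeq n f (n - 1 - i) := by rw [e]; simp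
    refine ⟨b, isRotationOf_of_chains (hC1 _) (hC1 _) (hbd i).1 hlt hbn.2 ?_ ?_ ?_⟩
    · rw [hC2]
      rintro v (rfl | h)
      · exact le_rfl
      · exact absurd (mem_coe.1 h.1) hbi
    · rw [hC2]
      rintro v (rfl | h)
      · exact Or.inl le_rfl
      · have hv := mem_coe.1 h.2
        by_cases hva : v ≤ a i
        · exact Or.inl hva
        · right
          rw [e] at hv
          exact lt_of_le_of_ne (hle v (mem_of_mem_erase hv) (by omega)) (ne_of_mem_erase hv).symm
    · rw [hC2, hC2, merge_singleClass (mem_coe.2 hai), e, coe_erase, Set.insert_sdiff_singleton,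
        Set.insert_eq_of_mem (mem_coe.2 hb)]
  refine ⟨fun i => C (n - 1 - i), ⟨?_, ?_, fun i => ?_⟩, fun i => hC1 _, fun i => ?_⟩
  · refine NCCP.chains_injective (hC1 _) (NCCP312.zero n).2 ?_
    change (C (n - 1 - 0)).chains = (NCCP.zero n).chains
    rw [hC2, NCCP.chains_zero, Nat.sub_zero]
    have h1 : 1 ∈ removeSeq n f (n - 1) := mem_removeSeq le_rfl hn fun j hj => by
      obtain ⟨i, -, e⟩ := hf j hj
      rw [e]
      exact (hbd i).1
    have h2 := (hrs (n - 1) le_rfl).1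
    obtain ⟨x, hx⟩ := card_eq_one.1 (show (removeSeq n f (n - 1)).card = 1 by omega)
    refine le_antisymm ?_ bot_le
    rintro u v (h | h)
    · exact h
    · rw [hx] at h
      simp only [coe_singleton, Set.mem_singleton_iff] at h
      exact h.1.trans h.2.symm
  · refine NCCP.chains_injective (hC1 _) (NCCP312.one n).2 ?_
    change (C (n - 1 - (n - 1))).chains = (NCCP.one n).chains
    rw [hC2, NCCP.chains_one, Nat.sub_self, NC.coe_top, removeSeq]
  · obtain ⟨b, h⟩ := hrot i
    exact ⟨b, a i, h⟩
  · obtain ⟨b, h⟩ := hrot i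
    exact tildeLabel_eq h

end Nccp

theorem mainTheorem8 (n : ℕ) (hn : 1 ≤ n) :
    (∀ a : Fin (n - 1) → ℕ, IsSeqA a →
      ∃! c : Fin (n - 1 + 1) → NCCP n,
        IsMaximalChain c ∧ IsDecreasing c ∧ (∀ i, (c i).Avoids312) ∧
          ∀ i : Fin (n - 1), tildeLabel (c i.castSucc) (c i.succ) = a i) ∧
    (∀ c : Fin (n - 1 + 1) → NCCP n,
      IsMaximalChain c → IsDecreasing c → (∀ i, (c i).Avoids312) →
        IsSeqA fun i : Fin (n - 1) => tildeLabel (c i.castSucc) (c i.succ)) ∧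
    moebius (NCCP312.zero n) (NCCP312.one n) = (-1) ^ (n - 1) * (catalan (n - 1) : ℤ) ∧
    moebius (NCP.zero n) (NCP.one n) = (-1) ^ (n - 1) * (catalan (n - 1) : ℤ) := by
  refine ⟨fun a ha => ?_, fun c hc hdec hav => ?_, moebius_NCCP312 hn, moebius_NCP hn⟩
  · obtain ⟨c, hc, hav, hl⟩ := exists_chain hn ha
    have hmono : Monotone fun i : Fin (n - 1) => tildeLabel (c i.castSucc) (c i.succ) := by
      simpa only [hl] using ha.1
    refine ⟨c, ⟨hc, (hc.isDecreasing_iff hn).2 hmono, hav, hl⟩, ?_⟩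
    rintro c' ⟨hc', -, hav', hl'⟩
    exact (hc.ext_labels hn hav hmono hc' hav' fun i => by rw [hl, hl']).symm
  · exact hc.isSeqA hn hav ((hc.isDecreasing_iff hn).1 hdec)
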